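/- A \emph{countable word} over a finite alphabet $A$ is a map $w:\alpha\to A$ from a finite (possibly empty) or countably infinite linear order $\alpha$, taken up to isomorphism; $A^{\circledast}$ denotes the set of these words, and $\prod_{i\in\alpha}w_i$ the concatenation of a family of words indexed by a countable linear order. A \emph{$\circledast$-monoid} is a set $M$ with a map $\pi:M^{\circledast}\to M$ such that $\pi(a)=a$ for each one-letter word $a$, and $\pi\big(\prod_{i\in\alpha}\pi(u_i)\big)=\pi\big(\prod_{i\in\alpha}u_i\big)$ for every countable family $(u_i)_{i\in\alpha}$ of words in $M^{\circledast}$. It \emph{induces} the operations $1=\pi(\varepsilon)$, $a\cdot b=\pi(ab)$, $a^{\tau}=\pi(a^{\omega})$, $a^{\tau^*}=\pi(a^{\omega^*})$ and, for nonempty $P\subseteq M$, $P^{\kappa}=\pi(P^{\eta})$, where $P^{\eta}$ is the word with domain of order type $\mathbb Q$ and letters in $P$ in which every letter of $P$ occurs densely. A \emph{$\circledast$-algebra} is a structure $(M,1,\cdot,\tau,\tau^*,\kappa)$, with $\kappa$ defined on the nonempty subsets of $M$, such that $(M,\cdot,1)$ is a monoid; for all $a,b\in M$ and $n>0$, $(ab)^{\tau}=a(ba)^{\tau}$,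 $(a^n)^{\tau}=a^{\tau}$, $(ba)^{\tau^*}=(ab)^{\tau^*}a$, $(a^n)^{\tau^*}=a^{\tau^*}$; for every nonempty $P\subseteq M$, every $c\in P$, every $P'\subseteq P$ and every nonempty $P''\subseteq\{P^\kappa,\,aP^\kappa,\,P^\kappa b,\,aP^\kappa b : a,b\in P\}$, $$P^\kappa=P^\kappa P^\kappa=P^\kappa cP^\kappa=(P^\kappa)^\tau=(P^\kappa c)^\tau=(P^\kappa)^{\tau^*}=(cP^\kappa)^{\tau^*}=(P'\cup P'')^\kappa;$$ and $1^\tau=1^{\tau^*}=\{1\}^\kappa=1$ and $P^\kappa=(P\cup\{1\})^\kappa$ for every nonempty $P\subseteq M$. A language $L\subseteq A^{\circledast}$ is \emph{recognized} by a finite $\circledast$-algebra on $M$, a map $h_0:A\to M$ and a set $F\subseteq M$ if the algebra is induced by exactly one $\circledast$-monoid $(M,\pi)$ and there is a morphism $h:(A^{\circledast},\prod)\to(M,\pi)$, i.e. $h\big(\prod_{i\in\alpha}w_i\big)=\pi\big((h(w_i))_{i\in\alpha}\big)$ for every countable family of words, that extends $h_0$ and satisfies $L=h^{-1}(F)$.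 \textbf{Theorem.} The MSO-definable languages of countable words are effectively recognizable: there is an algorithm which, given $k\in\mathbb N$ and a sentence $\varphi$ of monadic second-order logic (atomic formulas $x<y$, $x=y$, $a(x)$ for letters $a$, and $x\in X$; Boolean connectives; quantification over positions and over sets of positions), computes the finite tables of the operations of a finite $\circledast$-algebra, together with a map $h_0:\{0,\dots,k-1\}\to M$ and a set $F\subseteq M$, which recognize the language of all countable words over the alphabet $\{0,\dots,k-1\}$ that satisfy $\varphi$. -/

import Mathlib

/-! Countable words, MSO logic over them, ⊛-monoids and ⊛-algebras. -/

namespace CountableWords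

universe u v

/-! ### Countable words -/

/-- A word over `A` with countable (possibly empty) domain: a countable linear order whose
positions are labelled by `A`. Every countable linear order is isomorphic to one in `Type`. -/
structure CWord (A : Type u) : Type (max u 1) where
  Dom : Type
  [ord : LinearOrder Dom]
  [cnt : Countable Dom]
  label : Dom → A

attribute [instance] CWord.ord CWord.cnt

namespace CWord

variable {A : Type u} {B : Type v}

/-- Isomorphism of words. Words are considered up to this relation: every function on words
below is required to respect it. -/
def Iso (w w' : CWord A) : Prop :=
  ∃ e : w.Dom ≃o w'.Dom, ∀ x, w'.label (e x) = w.label x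

/-- The finite word given by a list. -/
def ofList (l : List A) : CWord A where
  Dom := Fin l.length
  label := l.get

/-- The empty word. -/
def empty : CWord A := ofList []

/-- The one-letter word `a`. -/
def single (a : A) : CWord A := ofList [a]

/-- The word `a^ω`. -/
def omega (a : A) : CWord A where
  Dom := ℕ
  label := fun _ => a

/-- The word `a^{ω*}`, with domain the reverse of `ℕ`. -/
def omegaRev (a : A) : CWord A where
  Dom := ℕᵒᵈ
  label := fun _ => a

/-- Pointwise extension of a map to words. -/
def map (f : A → B) (w : CWord A) : CWord B where
  Dom := w.Dom
  label := fun x => f (w.label x)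

/-- Concatenation `∏_{i ∈ α} w_i` of a countable word of words; its domain is the ordered sum
of the domains. -/
def concat (W : CWord (CWord A)) : CWord A where
  Dom := Σₗ i : W.Dom, (W.label i).Dom
  cnt := inferInstanceAs (Countable (Σ i : W.Dom, (W.label i).Dom))
  label := fun p => (W.label (ofLex p).1).label (ofLex p).2

/-- `w` is the `η`-shuffle of the set of letters `P`: its domain has the order type of `ℚ`, its
letters belong to `P`, and every letter of `P` occurs densely. -/
def IsShuffle (P : Set A) (w : CWord A) : Prop :=
  Nonempty (w.Dom ≃o ℚ) ∧ (∀ x, w.label x ∈ P) ∧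
    ∀ a ∈ P, ∀ x y : w.Dom, x < y → ∃ z, x < z ∧ z < y ∧ w.label z = a

end CWord

/-! ### ⊛-monoids and ⊛-algebras -/

/-- A ⊛-monoid with support `M`: a generalized product `π : M^⊛ → M`. -/
structure OMonoid (M : Type u) where
  π : CWord M → M
  π_iso : ∀ w w' : CWord M, w.Iso w' → π w = π w'
  π_single : ∀ a, π (CWord.single a) = a
  π_assoc : ∀ W : CWord (CWord M), π (W.map π) = π W.concat

/-- `h` is a morphism from the free ⊛-monoid `(A^⊛, ∏)` to the ⊛-monoid `S`. -/
def IsMorphism {A : Type u} {M : Type v} (S : OMonoid M) (h : CWord A → M) : Prop :=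
  (∀ w w' : CWord A, w.Iso w' → h w = h w') ∧
    ∀ W : CWord (CWord A), h W.concat = S.π (W.map h)

/-- `powSucc mul a n` is the power `a^(n+1)`. -/
def powSucc {M : Type u} (mul : M → M → M) (a : M) : ℕ → M
  | 0 => a
  | n + 1 => mul (powSucc mul a n) a

/-- A ⊛-algebra with support `M`. The operator `kappa` is meant on nonempty subsets only: no axiom
constrains its value at `∅`, and nothing below depends on that value. -/
structure OAlgebra (M : Type u) where
  one : M
  mul : M → M → M
  tau : M → M
  tauRev : M → M
  kappa : Set M → M
  mul_assoc : ∀ a b c, mul a (mul b c) = mul (mul a b) c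
  tau_mul : ∀ a b, tau (mul a b) = mul a (tau (mul b a))
  tau_pow : ∀ a n, tau (powSucc mul a n) = tau a
  tauRev_mul : ∀ a b, tauRev (mul b a) = mul (tauRev (mul a b)) a
  tauRev_pow : ∀ a n, tauRev (powSucc mul a n) = tauRev a
  kappa_mul_kappa : ∀ P : Set M, P.Nonempty → kappa P = mul (kappa P) (kappa P)
  kappa_mul_mul_kappa : ∀ P : Set M, ∀ c ∈ P, kappa P = mul (mul (kappa P) c) (kappa P)
  kappa_tau : ∀ P : Set M, P.Nonempty → kappa P = tau (kappa P)
  kappa_mul_tau : ∀ P : Set M, ∀ c ∈ P, kappa P = tau (mul (kappa P) c)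
  kappa_tauRev : ∀ P : Set M, P.Nonempty → kappa P = tauRev (kappa P)
  mul_kappa_tauRev : ∀ P : Set M, ∀ c ∈ P, kappa P = tauRev (mul c (kappa P))
  kappa_union : ∀ P : Set M, P.Nonempty → ∀ P' : Set M, P' ⊆ P → ∀ P'' : Set M, P''.Nonempty →
    (∀ x ∈ P'', x = kappa P ∨ (∃ a ∈ P, x = mul a (kappa P)) ∨ (∃ b ∈ P, x = mul (kappa P) b) ∨
      ∃ a ∈ P, ∃ b ∈ P, x = mul (mul a (kappa P)) b) →
    kappa P = kappa (P' ∪ P'')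
  mul_one : ∀ x, mul x one = x
  one_mul : ∀ x, mul one x = x
  tau_one : tau one = one
  tauRev_one : tauRev one = one
  kappa_one : kappa {one} = one
  kappa_union_one : ∀ P : Set M, P.Nonempty → kappa P = kappa (P ∪ {one})

/-- The operators of the ⊛-algebra `R` are those induced by the product of the ⊛-monoid `S`. -/
def OMonoid.Induces {M : Type u} (S : OMonoid M) (R : OAlgebra M) : Prop :=
  R.one = S.π CWord.empty ∧
  (∀ a b, R.mul a b = S.π (CWord.ofList [a, b])) ∧
  (∀ a, R.tau a = S.π (CWord.omega a)) ∧
  (∀ a, R.tauRev a = S.π (CWord.omegaRev a)) ∧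
  ∀ P : Set M, P.Nonempty → ∀ w : CWord M, w.IsShuffle P → R.kappa P = S.π w

/-! ### Finite presentations of recognizable languages -/

/-- A finite ⊛-algebra with support `{0, …, n-1}`, the images of the letters of the alphabet
`{0, …, k-1}`, and a set of accepting elements. -/
structure Recognizer (k : ℕ) where
  n : ℕ
  alg : OAlgebra (Fin n)
  letter : Fin k → Fin n
  accept : Finset (Fin n)

/-- The finite tables output by an algorithm: the size, the element `1`, the multiplication table,
the tables of `tau`, `tauRev` and `kappa`, the images of the letters, the accepting elements. -/
abbrev Table : Type :=
  ℕ × ℕ × List (List ℕ) × List ℕ × List ℕ × List ℕ × List ℕ × List Bool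

/-- The tables that describe a recognizer. Entry number `m < 2 ^ n` of the table of `kappa` is its
value at the subset of `{0, …, n-1}` whose indicator is the binary expansion of `m`. -/
def Recognizer.table {k : ℕ} (R : Recognizer k) : Table :=
  (R.n, (R.alg.one : ℕ),
    List.ofFn fun i => List.ofFn fun j => (R.alg.mul i j : ℕ),
    List.ofFn fun i => (R.alg.tau i : ℕ),
    List.ofFn fun i => (R.alg.tauRev i : ℕ),
    List.ofFn fun m : Fin (2 ^ R.n) => (R.alg.kappa {i | (m : ℕ).testBit i = true} : ℕ),
    List.ofFn fun a => (R.letter a : ℕ),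
    List.ofFn fun i => decide (i ∈ R.accept))

/-- `R` recognizes the language `L`: its ⊛-algebra is induced by one and only one ⊛-monoid `S`, and
`L` is the inverse image of the accepting set under a morphism from the free ⊛-monoid to `S` that
has the prescribed values on letters. -/
def Recognizer.Recognizes {k : ℕ} (R : Recognizer k) (L : Set (CWord (Fin k))) : Prop :=
  ∃ S : OMonoid (Fin R.n), S.Induces R.alg ∧ (∀ S' : OMonoid (Fin R.n), S'.Induces R.alg → S' = S) ∧
    ∃ h : CWord (Fin k) → Fin R.n, IsMorphism S h ∧ (∀ a, h (CWord.single a) = R.letter a) ∧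
      L = h ⁻¹' {i | i ∈ R.accept}

/-! ### Monadic second-order logic -/

/-- MSO formulas over words, with first-order variables `x_0, x_1, …`, set variables
`X_0, X_1, …`, and letters named by natural numbers. The other connectives and the universal
quantifiers are abbreviations. -/
inductive MSO : Type
  /-- `x_i < x_j` -/
  | lt (i j : ℕ)
  /-- `x_i = x_j` -/
  | eq (i j : ℕ)
  /-- `a(x_i)`: position `x_i` carries the letter `a` -/
  | letter (a i : ℕ)
  /-- `x_i ∈ X_j` -/
  | mem (i j : ℕ)
  | neg (φ : MSO)
  | and (φ ψ : MSO)
  /-- `∃ x_i, φ` -/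
  | exFO (i : ℕ) (φ : MSO)
  /-- `∃ X_j, φ` -/
  | exSO (j : ℕ) (φ : MSO)

namespace MSO

/-- Free first-order variables. -/
def freeFO : MSO → Set ℕ
  | lt i j => {i, j}
  | eq i j => {i, j}
  | letter _ i => {i}
  | mem i _ => {i}
  | neg φ => φ.freeFO
  | and φ ψ => φ.freeFO ∪ ψ.freeFO
  | exFO i φ => φ.freeFO \ {i}
  | exSO _ φ => φ.freeFO

/-- Free set variables. -/
def freeSO : MSO → Set ℕ
  | lt _ _ => ∅
  | eq _ _ => ∅
  | letter _ _ => ∅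
  | mem _ j => {j}
  | neg φ => φ.freeSO
  | and φ ψ => φ.freeSO ∪ ψ.freeSO
  | exFO _ φ => φ.freeSO
  | exSO j φ => φ.freeSO \ {j}

/-- A sentence is a formula without free variables. -/
def IsSentence (φ : MSO) : Prop := φ.freeFO = ∅ ∧ φ.freeSO = ∅

/-- Satisfaction in a word over the alphabet `{0, …, k-1}`. The valuation `v` of the first-order
variables is partial, so that one exists also when the domain is empty. -/
def Sat {k : ℕ} (w : CWord (Fin k)) : (ℕ → Option w.Dom) → (ℕ → Set w.Dom) → MSO → Prop
  | v, _, lt i j => ∃ x y, v i = some x ∧ v j = some y ∧ x < y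
  | v, _, eq i j => ∃ x y, v i = some x ∧ v j = some y ∧ x = y
  | v, _, letter a i => ∃ x, v i = some x ∧ (w.label x : ℕ) = a
  | v, V, mem i j => ∃ x, v i = some x ∧ x ∈ V j
  | v, V, neg φ => ¬ Sat w v V φ
  | v, V, and φ ψ => Sat w v V φ ∧ Sat w v V ψ
  | v, V, exFO i φ => ∃ x : w.Dom, Sat w (Function.update v i (some x)) V φ
  | v, V, exSO j φ => ∃ X : Set w.Dom, Sat w v (Function.update V j X) φ

/-- The language over the alphabet `{0, …, k-1}` defined by a sentence; for a sentence the choice of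
the valuation is immaterial. -/
def language (k : ℕ) (φ : MSO) : Set (CWord (Fin k)) :=
  {w | Sat w (fun _ => none) (fun _ => ∅) φ}

/-- A formula written as a finite sequence of symbols in prefix notation, to be read by an algorithm:
a symbol is a tag for the constructor together with the indices that the constructor carries. -/
def symbols : MSO → List (ℕ × ℕ × ℕ)
  | lt i j => [(0, i, j)]
  | eq i j => [(1, i, j)]
  | letter a i => [(2, a, i)]
  | mem i j => [(3, i, j)]
  | neg φ => (4, 0, 0) :: φ.symbols
  | and φ ψ => (5, 0, 0) :: (φ.symbols ++ ψ.symbols)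
  | exFO i φ => (6, i, 0) :: φ.symbols
  | exSO j φ => (7, j, 0) :: φ.symbols

end MSO

end CountableWords

namespace CountableWords

universe u v

namespace CWord

variable {A : Type u} {B : Type v}

/-! The recognizer is built by recursion on the formula. A word together with a valuation is coded
as a word over a larger finite alphabet, with one bit for each variable. Atomic formulas are
recognized by the fixed finite ⊛-monoid `occMonoid`. Negation complements the accepting set and
conjunction takes a product. An existential set quantifier guesses one bit at each position, which
is recognized by the powerset ⊛-monoid `OMonoid.pow`; a first-order quantifier does the same after
intersection with the condition that the bit is set exactly once.

Every ⊛-algebra that occurs is induced by an explicit ⊛-monoid, so its axioms follow by evaluating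
one word in two ways, and only the uniqueness of the product needs an argument. The other difficulty
is effectivity: the tables of the powerset have to be found from the tables of the given ⊛-monoid
alone. For `τ`, Ramsey's theorem reduces an infinite choice of letters to a prefix and a repeated
block value, both in a finitely generated subsemigroup (`mem_pow_tau`). For `κ`, the value is the
least set closed under finitely many explicit rules (`mem_pow_kappa`).

Uniqueness and the description of `κ` both rest on `ConvexInduction.property_univ`: a property of
convex sets of positions that passes to concatenations, to increasing and decreasing sequences of
blocks of equal value, and to shuffles of blocks, holds for the whole word. To see this, identify
two positions if all convex sets between them have the property. By Ramsey each class has it, so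
adjacent classes would merge and the quotient is a dense order or a point. A dense order coloured by
finitely many values contains an interval in which all occurring colours are dense; this is a
shuffle, so its classes would merge too, and the quotient is a point.

Subsets are coded by binary expansions, so every rule becomes a bounded search and the algorithm is
primitive recursive. -/

theorem Iso.symm {w w' : CWord A} (h : w.Iso w') : w'.Iso w := by
  obtain ⟨e, he⟩ := h
  exact ⟨e.symm, fun x => by rw [← he, e.apply_symm_apply]⟩

theorem Iso.map {w w' : CWord A} (f : A → B) (h : w.Iso w') : (w.map f).Iso (w'.map f) := by
  obtain ⟨e, he⟩ := h
  exact ⟨e, fun x => congrArg f (he x)⟩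

end CWord

instance countable_orderDual {D : Type} [h : Countable D] : Countable Dᵒᵈ := h

/-! ### Products over sets of positions. -/

namespace OMonoid

variable {M : Type u} (S : OMonoid M)

/-- A form of `π_single` for words whose one-point domain is not literally that of `CWord.single`,
such as subtypes and order duals. -/
theorem π_of_forall_eq (w : CWord M) (x : w.Dom) (h : ∀ y, y = x) : S.π w = w.label x := by
  rw [← S.π_single (w.label x)]
  refine S.π_iso _ _ ⟨⟨⟨fun _ => (0 : Fin 1), fun _ => x, fun y => (h y).symm,
    fun y => Subsingleton.elim (α := Fin 1) _ _⟩, fun {y z} => ?_⟩, fun y => ?_⟩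
  · exact iff_of_true le_rfl (le_of_eq ((h y).trans (h z).symm))
  · rw [h y]; rfl

/-- The product of the restriction of the labelling `l` to the set of positions `s`. -/
def val {D : Type} [LinearOrder D] [Countable D] (l : D → M) (s : Set D) : M :=
  S.π ⟨s, fun x => l x⟩

section val

variable {D E : Type} [LinearOrder D] [Countable D] [LinearOrder E] [Countable E]

theorem val_congr_iso {l : D → M} {l' : E → M} {s : Set D} {t : Set E} (e : s ≃o t)
    (h : ∀ x, l' (e x) = l x) : S.val l s = S.val l' t :=
  S.π_iso _ _ ⟨e, h⟩

theorem val_congr {l l' : D → M} {s : Set D} (h : ∀ x ∈ s, l x = l' x) :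
    S.val l s = S.val l' s :=
  S.val_congr_iso (OrderIso.refl s) fun x => (h x x.2).symm

theorem π_eq_val (w : CWord M) : S.π w = S.val w.label Set.univ :=
  S.π_iso _ _ ⟨OrderIso.Set.univ.symm, fun _ => rfl⟩

theorem val_univ (l : D → M) : S.val l Set.univ = S.π ⟨D, l⟩ :=
  (S.π_eq_val ⟨D, l⟩).symm

theorem val_subtype (l : D → M) (s : Set D) :
    S.val (fun x : s => l x) Set.univ = S.val l s :=
  S.val_univ (fun x : s => l x)

/-- A product can be computed by first evaluating the fibers of a monotone map. -/
theorem val_fiber (l : D → M) (s : Set D) (f : D → E) (hf : MonotoneOn f s) :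
    S.val l s = S.val (fun i => S.val l (s ∩ f ⁻¹' {i})) Set.univ := by
  let W : CWord (CWord M) := ⟨E, fun i => ⟨(s ∩ f ⁻¹' {i} : Set D), fun x => l x⟩⟩
  rw [val_univ]
  refine Eq.trans ?_ (S.π_assoc W).symm
  apply S.π_iso
  let g : s → Σₗ i : E, (s ∩ f ⁻¹' {i} : Set D) := fun x => toLex ⟨f x, x, x.2, rfl⟩
  have hg : StrictMono g := by
    intro x y hxy
    rcases (hf x.2 y.2 (le_of_lt hxy)).lt_or_eq with h | h
    · exact Sigma.Lex.left _ _ h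
    · have key : ∀ (i j : E) (hij : i = j) (x y : D) (hx : x ∈ s ∩ f ⁻¹' {i})
          (hy : y ∈ s ∩ f ⁻¹' {j}), x < y →
          (toLex ⟨i, x, hx⟩ : Σₗ i : E, (s ∩ f ⁻¹' {i} : Set D)) < toLex ⟨j, y, hy⟩ := by
        rintro i _ rfl x y hx hy h
        exact Sigma.Lex.right _ _ h
      exact key _ _ h _ _ _ _ hxy
  have hs : Function.Surjective g := by
    intro p
    obtain ⟨i, x, hx, rfl⟩ := p
    exact ⟨⟨x, hx⟩, rfl⟩
  exact ⟨hg.orderIsoOfSurjective g hs, fun x => rfl⟩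

end val

/-- The operations induced by the product. -/
def one : M := S.π CWord.empty

def mul (a b : M) : M := S.π (CWord.ofList [a, b])

def tau (a : M) : M := S.π (CWord.omega a)

def tauRev (a : M) : M := S.π (CWord.omegaRev a)

section val

variable {D E : Type} [LinearOrder D] [Countable D] [LinearOrder E] [Countable E]

theorem val_empty (l : D → M) : S.val l ∅ = S.one := by
  have : IsEmpty (CWord.empty : CWord M).Dom := inferInstanceAs (IsEmpty (Fin 0))
  exact S.π_iso _ _ ⟨⟨Equiv.equivOfIsEmpty _ _, fun {a} => a.2.elim⟩, fun x => x.2.elim⟩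

theorem val_singleton (l : D → M) (x : D) : S.val l {x} = l x := by
  exact S.π_of_forall_eq ⟨({x} : Set D), fun y => l y⟩ ⟨x, rfl⟩ fun y => Subtype.ext y.2

/-- The map to `Fin 2` that separates `s` from `t` is monotone because `s` lies before `t`, so this
is an instance of `val_fiber`. -/
theorem val_union (l : D → M) {s t : Set D} (h : ∀ x ∈ s, ∀ y ∈ t, x < y) :
    S.val l (s ∪ t) = S.mul (S.val l s) (S.val l t) := by
  classical
  have hst : ∀ x ∈ t, x ∉ s := fun x hx hs => lt_irrefl x (h x hs x hx)
  let f : D → Fin 2 := fun x => if x ∈ s then 0 else 1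
  rw [S.val_fiber l (s ∪ t) f, val_univ]
  · refine S.π_iso _ _ ⟨OrderIso.refl (Fin 2), fun i => ?_⟩
    change [S.val l s, S.val l t].get i = _
    have h0 : (s ∪ t) ∩ f ⁻¹' {0} = s := by
      ext x
      by_cases hx : x ∈ s <;> simp [f, hx]
    have h1 : (s ∪ t) ∩ f ⁻¹' {1} = t := by
      ext x
      by_cases hx : x ∈ s
      · simp only [Set.mem_inter_iff, Set.mem_preimage, f, hx, if_true]
        exact ⟨fun h => absurd h.2 (by simp), fun h => absurd hx (hst x h)⟩
      · simp [f, hx]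
    match i with
    | 0 => simp [h0]
    | 1 => simp [h1]
  · intro x hx y hy hxy
    by_cases hs : x ∈ s
    · simp [f, hs]
    · by_cases hys : y ∈ s
      · exact absurd (h y hys x (hx.resolve_left hs)) (not_lt.2 hxy)
      · simp [f, hs, hys]

theorem val_nat (a : M) : S.val (fun _ : ℕ => a) Set.univ = S.tau a := S.val_univ _

/-- Evaluation of a sequence of blocks of equal value. -/
theorem val_eq_tau (l : D → M) (s : Set D) (f : D → ℕ) (hf : MonotoneOn f s) (a : M)
    (h : ∀ n, S.val l (s ∩ f ⁻¹' {n}) = a) : S.val l s = S.tau a := by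
  rw [S.val_fiber l s f hf, ← val_nat]
  exact S.val_congr fun n _ => h n

end val

/-- The value of the concatenation, with explicit index order. -/
theorem π_concat_eq {I : Type} [LinearOrder I] [Countable I] (u : I → CWord M) :
    S.π (CWord.concat ⟨I, u⟩) = S.π ⟨I, fun i => S.π (u i)⟩ :=
  (S.π_assoc ⟨I, u⟩).symm

theorem π_ext {S T : OMonoid M} (h : ∀ w, S.π w = T.π w) : S = T := by
  obtain ⟨p, _, _, _⟩ := S
  obtain ⟨q, _, _, _⟩ := T
  obtain rfl : p = q := funext h
  rfl

/-! ### Constructions of ⊛-monoids -/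

/-- The monoid of the reversed product. -/
def op : OMonoid M where
  π w := S.π ⟨w.Domᵒᵈ, fun x => w.label (OrderDual.ofDual x)⟩
  π_iso w w' h := by
    obtain ⟨e, he⟩ := h
    exact S.π_iso _ _ ⟨e.dual, fun x => he _⟩
  π_single a := by
    exact S.π_of_forall_eq ⟨(CWord.single a).Domᵒᵈ, fun x => (CWord.single a).label x.ofDual⟩
      (OrderDual.toDual (0 : Fin 1)) fun y => Subsingleton.elim (α := Fin 1) _ _
  π_assoc W := by
    let V : CWord (CWord M) := ⟨W.Domᵒᵈ, fun i =>
      ⟨(W.label (OrderDual.ofDual i)).Domᵒᵈ, fun x => (W.label (OrderDual.ofDual i)).label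
        (OrderDual.ofDual x)⟩⟩
    refine Eq.trans (S.π_assoc V) (S.π_iso _ _ ?_)
    let g : V.concat.Dom → (W.concat.Dom)ᵒᵈ := fun p =>
      OrderDual.toDual (toLex ⟨OrderDual.ofDual (ofLex p).1, OrderDual.ofDual (ofLex p).2⟩)
    have hg : StrictMono g := by
      intro p q h
      cases h with
      | left _ _ h => exact Sigma.Lex.left _ _ h
      | right _ _ h => exact Sigma.Lex.right _ _ h
    refine ⟨hg.orderIsoOfSurjective g fun p => ?_, fun x => rfl⟩
    exact ⟨toLex ⟨OrderDual.toDual (ofLex (OrderDual.ofDual p)).1,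
      OrderDual.toDual (ofLex (OrderDual.ofDual p)).2⟩, rfl⟩

/-- The product of two ⊛-monoids. -/
def prod {N : Type v} (T : OMonoid N) : OMonoid (M × N) where
  π w := (S.π (w.map Prod.fst), T.π (w.map Prod.snd))
  π_iso _ _ h := Prod.ext (S.π_iso _ _ (h.map _)) (T.π_iso _ _ (h.map _))
  π_single a := Prod.ext
    (S.π_of_forall_eq ((CWord.single a).map Prod.fst) (0 : Fin 1)
      fun _ => Subsingleton.elim (α := Fin 1) _ _)
    (T.π_of_forall_eq ((CWord.single a).map Prod.snd) (0 : Fin 1)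
      fun _ => Subsingleton.elim (α := Fin 1) _ _)
  π_assoc W := Prod.ext (S.π_assoc (W.map (CWord.map Prod.fst)))
    (T.π_assoc (W.map (CWord.map Prod.snd)))

/-- Transport of a ⊛-monoid along a bijection. -/
def transport {N : Type v} (e : M ≃ N) : OMonoid N where
  π w := e (S.π (w.map e.symm))
  π_iso w w' h := congrArg e (S.π_iso _ _ (h.map _))
  π_single a := by
    have := S.π_of_forall_eq ((CWord.single a).map e.symm) (0 : Fin 1)
      fun _ => Subsingleton.elim (α := Fin 1) _ _
    rw [this]
    exact e.apply_symm_apply a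
  π_assoc W := by
    congr 1
    refine Eq.trans ?_ (S.π_assoc (W.map (CWord.map e.symm)))
    simp [CWord.map]

/-- The powerset of a ⊛-monoid: the product of a word of sets is the set of the products of the
words that choose a letter in each set. -/
def pow : OMonoid (Set M) where
  π W := {m | ∃ l : W.Dom → M, (∀ x, l x ∈ W.label x) ∧ S.π ⟨W.Dom, l⟩ = m}
  π_iso W W' h := by
    have key : ∀ W W' : CWord (Set M), W.Iso W' → ∀ m,
        (∃ l : W.Dom → M, (∀ x, l x ∈ W.label x) ∧ S.π ⟨W.Dom, l⟩ = m) →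
        ∃ l : W'.Dom → M, (∀ x, l x ∈ W'.label x) ∧ S.π ⟨W'.Dom, l⟩ = m := by
      rintro W W' ⟨e, he⟩ m ⟨l, hl, rfl⟩
      refine ⟨fun x => l (e.symm x), fun x => ?_, ?_⟩
      · have := hl (e.symm x)
        rwa [← he, e.apply_symm_apply] at this
      · exact S.π_iso _ _ ⟨e.symm, fun x => rfl⟩
    ext m
    exact ⟨key _ _ h m, key _ _ h.symm m⟩
  π_single P := by
    ext m
    constructor
    · rintro ⟨l, hl, rfl⟩
      have := S.π_of_forall_eq ⟨(CWord.single P).Dom, l⟩ (0 : Fin 1)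
        fun _ => Subsingleton.elim (α := Fin 1) _ _
      exact Set.mem_of_eq_of_mem this (hl (0 : Fin 1))
    · intro hm
      refine ⟨fun _ => m, fun x => ?_, ?_⟩
      · have : x = (0 : Fin 1) := Subsingleton.elim (α := Fin 1) _ _
        subst this; exact hm
      · exact S.π_of_forall_eq ⟨(CWord.single P).Dom, _⟩ (0 : Fin 1)
          fun _ => Subsingleton.elim (α := Fin 1) _ _
  π_assoc W := by
    ext m
    constructor
    · rintro ⟨l, hl, rfl⟩
      -- Each chosen factor is the product of a choice inside its block; the choices of the blocks
      -- are glued to one choice on the concatenation.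
      choose L hL using hl
      refine ⟨fun p => L (ofLex p).1 (ofLex p).2, fun p => (hL _).1 _, ?_⟩
      refine Eq.trans (S.π_assoc ⟨W.Dom, fun i => ⟨(W.label i).Dom, L i⟩⟩).symm ?_
      have : (fun i => S.π ⟨(W.label i).Dom, L i⟩) = l := funext fun i => (hL i).2
      rw [← this]
      rfl
    · rintro ⟨l, hl, rfl⟩
      refine ⟨fun i => S.π ⟨(W.label i).Dom, fun x => l (toLex ⟨i, x⟩)⟩, fun i => ?_, ?_⟩
      · exact ⟨fun x => l (toLex ⟨i, x⟩), fun x => hl (toLex ⟨i, x⟩), rfl⟩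
      · exact S.π_assoc ⟨W.Dom, fun i => ⟨(W.label i).Dom, fun x => l (toLex ⟨i, x⟩)⟩⟩

end OMonoid

end CountableWords

namespace CountableWords

universe u v

/-! ### Shuffles: existence and uniqueness -/

section BackAndForth

variable {α β : Type*} [LinearOrder α] [LinearOrder β] {C : Type*}

/-- Finite partial isomorphisms between two coloured linear orders. -/
def ColoredPartialIso (c : α → C) (d : β → C) : Type _ :=
  {f : Finset (α × β) // (∀ p ∈ f, ∀ q ∈ f, cmp p.1 q.1 = cmp p.2 q.2) ∧ ∀ p ∈ f, c p.1 = d p.2}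

instance (c : α → C) (d : β → C) : Preorder (ColoredPartialIso c d) :=
  inferInstanceAs (Preorder (Subtype _))

variable {c : α → C} {d : β → C}

/-- The extension step of the back-and-forth argument. The partners of the points below `a` lie
before the partners of the points above `a`, and the required colour is found in the gap. -/
theorem ColoredPartialIso.exists_across [DenselyOrdered β] [NoMinOrder β] [NoMaxOrder β]
    [Nonempty β] (hd : ∀ (a : α) (x y : β), x < y → ∃ z, x < z ∧ z < y ∧ d z = c a)
    (f : Finset (α × β)) (hf : ∀ p ∈ f, ∀ q ∈ f, cmp p.1 q.1 = cmp p.2 q.2)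
    (hc : ∀ p ∈ f, c p.1 = d p.2) (a : α) :
    ∃ b : β, (∀ p ∈ f, cmp p.1 a = cmp p.2 b) ∧ c a = d b := by
  classical
  by_cases h : ∃ b, (a, b) ∈ f
  · obtain ⟨b, hb⟩ := h
    exact ⟨b, fun p hp => hf _ hp _ hb, hc _ hb⟩
  have hlt : ∀ x ∈ {p ∈ f | p.1 < a}.image Prod.snd,
      ∀ y ∈ {p ∈ f | a < p.1}.image Prod.snd, x < y := by
    intro x hx y hy
    rw [Finset.mem_image] at hx hy
    obtain ⟨p, hp, rfl⟩ := hx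
    obtain ⟨q, hq, rfl⟩ := hy
    rw [Finset.mem_filter] at hp hq
    rw [← lt_iff_lt_of_cmp_eq_cmp (hf _ hp.1 _ hq.1)]
    exact hp.2.trans hq.2
  obtain ⟨m, hm1, hm2⟩ := Order.exists_between_finsets _ _ hlt
  -- The gap may be unbounded, whereas density of a colour is stated between two points; `m` and
  -- `m'` are two points inside the gap.
  obtain ⟨m', hm1', hm2'⟩ := Order.exists_between_finsets {m} _
    (fun x hx y hy => by rw [Finset.mem_singleton.1 hx]; exact hm2 y hy)
  obtain ⟨b, hb1, hb2, hb3⟩ := hd a m m' (hm1' m (Finset.mem_singleton_self m))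
  refine ⟨b, ?_, hb3.symm⟩
  rintro ⟨p1, p2⟩ hp
  have hne : p1 ≠ a := fun he => h ⟨p2, he ▸ hp⟩
  rcases lt_or_gt_of_ne hne with hl | hr
  · have h2 : p2 < b := (hm1 _ (Finset.mem_image.2
      ⟨(p1, p2), Finset.mem_filter.2 ⟨hp, hl⟩, rfl⟩)).trans hb1
    exact ((cmp_eq_lt_iff _ _).2 hl).trans ((cmp_eq_lt_iff _ _).2 h2).symm
  · have h2 : b < p2 := hb2.trans (hm2' _ (Finset.mem_image.2
      ⟨(p1, p2), Finset.mem_filter.2 ⟨hp, hr⟩, rfl⟩))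
    exact ((cmp_eq_gt_iff _ _).2 hr).trans ((cmp_eq_gt_iff _ _).2 h2).symm

theorem ColoredPartialIso.insert_prop {f : Finset (α × β)} [DecidableEq (α × β)]
    (hf : ∀ p ∈ f, ∀ q ∈ f, cmp p.1 q.1 = cmp p.2 q.2) (hc : ∀ p ∈ f, c p.1 = d p.2) {a : α}
    {b : β} (hab : ∀ p ∈ f, cmp p.1 a = cmp p.2 b) (hcd : c a = d b) :
    (∀ p ∈ insert (a, b) f, ∀ q ∈ insert (a, b) f, cmp p.1 q.1 = cmp p.2 q.2) ∧
      ∀ p ∈ insert (a, b) f, c p.1 = d p.2 := by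
  refine ⟨fun p hp q hq => ?_, fun p hp => ?_⟩
  · rw [Finset.mem_insert] at hp hq
    rcases hp with rfl | hp <;> rcases hq with rfl | hq
    · simp only [cmp_self_eq_eq]
    · rw [cmp_eq_cmp_symm]
      exact hab _ hq
    · exact hab _ hp
    · exact hf _ hp _ hq
  · rcases Finset.mem_insert.1 hp with rfl | hp
    · exact hcd
    · exact hc _ hp

/-- Two countable dense coloured orders without endpoints in which the same colours occur, each of
them densely, are isomorphic. -/
theorem exists_orderIso_colored [Countable α] [Countable β] [DenselyOrdered α] [NoMinOrder α]
    [NoMaxOrder α] [Nonempty α] [DenselyOrdered β] [NoMinOrder β] [NoMaxOrder β] [Nonempty β]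
    (c : α → C) (d : β → C)
    (hc : ∀ (b : β) (x y : α), x < y → ∃ z, x < z ∧ z < y ∧ c z = d b)
    (hd : ∀ (a : α) (x y : β), x < y → ∃ z, x < z ∧ z < y ∧ d z = c a) :
    ∃ e : α ≃o β, ∀ x, d (e x) = c x := by
  classical
  cases nonempty_encodable α
  cases nonempty_encodable β
  let L : α → Order.Cofinal (ColoredPartialIso c d) := fun a =>
    { carrier := {f | ∃ b : β, (a, b) ∈ f.1}
      isCofinal := fun f => by
        obtain ⟨b, hb, hcd⟩ := ColoredPartialIso.exists_across hd f.1 f.2.1 f.2.2 a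
        exact ⟨⟨insert (a, b) f.1, ColoredPartialIso.insert_prop f.2.1 f.2.2 hb hcd⟩,
          ⟨b, Finset.mem_insert_self _ _⟩, Finset.subset_insert _ _⟩ }
  let R : β → Order.Cofinal (ColoredPartialIso c d) := fun b =>
    { carrier := {f | ∃ a : α, (a, b) ∈ f.1}
      isCofinal := fun f => by
        obtain ⟨a, ha, hcd⟩ := ColoredPartialIso.exists_across hc (f.1.image Prod.swap)
          (by
            intro p hp q hq
            obtain ⟨p, hp', rfl⟩ := Finset.mem_image.1 hp
            obtain ⟨q, hq', rfl⟩ := Finset.mem_image.1 hq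
            exact (f.2.1 p hp' q hq').symm)
          (by
            intro p hp
            obtain ⟨p, hp', rfl⟩ := Finset.mem_image.1 hp
            exact (f.2.2 p hp').symm) b
        exact ⟨⟨insert (a, b) f.1, ColoredPartialIso.insert_prop f.2.1 f.2.2
          (fun p hp => (ha _ (Finset.mem_image_of_mem _ hp)).symm) hcd.symm⟩,
          ⟨a, Finset.mem_insert_self _ _⟩, Finset.subset_insert _ _⟩ }
  let K : α ⊕ β → Order.Cofinal (ColoredPartialIso c d) := fun p => Sum.recOn p L R
  let start : ColoredPartialIso c d := ⟨∅, by simp, by simp⟩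
  -- A directed family that meets the countably many cofinal sets: each point receives a partner,
  -- and any two members have a common extension, which makes the partners consistent.
  let J : Order.Ideal (ColoredPartialIso c d) := Order.idealOfCofinals start K
  have hF : ∀ a, ∃ b, ∃ f ∈ J, (a, b) ∈ f.1 := fun a => by
    obtain ⟨f, ⟨b, hb⟩, hf⟩ := Order.cofinal_meets_idealOfCofinals start K (Sum.inl a)
    exact ⟨b, f, hf, hb⟩
  have hG : ∀ b, ∃ a, ∃ f ∈ J, (a, b) ∈ f.1 := fun b => by
    obtain ⟨f, ⟨a, ha⟩, hf⟩ := Order.cofinal_meets_idealOfCofinals start K (Sum.inr b)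
    exact ⟨a, f, hf, ha⟩
  choose F hF using hF
  choose G hG using hG
  refine ⟨OrderIso.ofCmpEqCmp F G fun a b => ?_, fun a => ?_⟩
  · obtain ⟨f, hf, ha⟩ := hF a
    obtain ⟨g, hg, hb⟩ := hG b
    obtain ⟨m, _, fm, gm⟩ := J.directed _ hf _ hg
    exact m.2.1 (a, _) (fm ha) (_, b) (gm hb)
  · obtain ⟨f, hf, ha⟩ := hF a
    exact (f.2.2 _ ha).symm

end BackAndForth

/-- Infinite sets indexed by `ℕ` have an injective choice function. -/
theorem exists_injective_choice {α : Type*} (I : ℕ → Set α) (hI : ∀ n, (I n).Infinite) :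
    ∃ z : ℕ → α, Function.Injective z ∧ ∀ n, z n ∈ I n := by
  classical
  -- With `n + 1` candidates for the index `n`, Hall's condition holds: a finite set of indices has
  -- at most as many elements as there are candidates for its maximum.
  choose t ht hcard using fun n => (hI n).exists_subset_card_eq (n + 1)
  obtain ⟨z, hz, hzt⟩ := (Finset.all_card_le_biUnion_card_iff_exists_injective t).1 (by
    intro s
    rcases s.eq_empty_or_nonempty with rfl | hs
    · simp
    · calc s.card ≤ (Finset.range (s.max' hs + 1)).card :=
            Finset.card_le_card fun i hi => Finset.mem_range.2
              (Nat.lt_succ_of_le (Finset.le_max' s i hi))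
        _ = (t (s.max' hs)).card := by rw [Finset.card_range, hcard]
        _ ≤ _ := Finset.card_le_card (Finset.subset_biUnion_of_mem t (Finset.max'_mem s hs)))
  exact ⟨z, hz, fun n => ht n (hzt n)⟩

namespace CWord

variable {A : Type u}

/-- Enumerate all requests to place a letter `a` between two rationals and answer each of them at a
rational of its own. Injectivity of the answers excludes conflicts; the remaining rationals carry an
arbitrary letter. -/
theorem exists_isShuffle {P : Set A} (hP : P.Nonempty) (hc : P.Countable) :
    ∃ w : CWord A, w.IsShuffle P := by
  classical
  have : Countable P := hc
  have : Nonempty P := hP.to_subtype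
  obtain ⟨g, hg⟩ := exists_surjective_nat (ℚ × ℚ × P)
  obtain ⟨z, hz, hzI⟩ := exists_injective_choice
    (fun n => if (g n).1 < (g n).2.1 then Set.Ioo (g n).1 (g n).2.1 else Set.univ) (by
      intro n
      split_ifs with h
      · exact Set.Ioo_infinite h
      · exact Set.infinite_univ)
  refine ⟨⟨ℚ, fun q => (Function.extend z (fun n => (g n).2.2)
    (fun _ => Classical.arbitrary P) q : P)⟩, ⟨OrderIso.refl ℚ⟩, fun q => Subtype.coe_prop _, ?_⟩
  intro a ha x y hxy
  obtain ⟨n, hn⟩ := hg (x, y, ⟨a, ha⟩)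
  have := hzI n
  simp only [hn] at this
  rw [if_pos hxy] at this
  refine ⟨z n, this.1, this.2, ?_⟩
  simp only [hz.extend_apply, hn]

theorem IsShuffle.nonempty {P : Set A} {w : CWord A} (h : w.IsShuffle P) : P.Nonempty := by
  obtain ⟨⟨e⟩, h, -⟩ := h
  exact ⟨_, h (e.symm 0)⟩

theorem IsShuffle.noMinOrder {P : Set A} {w : CWord A} (h : w.IsShuffle P) : NoMinOrder w.Dom := by
  obtain ⟨⟨e⟩, -⟩ := h
  exact ⟨fun x => ⟨e.symm (e x - 1), by rw [e.symm_apply_lt]; linarith⟩⟩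

theorem IsShuffle.noMaxOrder {P : Set A} {w : CWord A} (h : w.IsShuffle P) : NoMaxOrder w.Dom := by
  obtain ⟨⟨e⟩, -⟩ := h
  exact ⟨fun x => ⟨e.symm (e x + 1), by rw [e.lt_symm_apply]; linarith⟩⟩

theorem IsShuffle.domNonempty {P : Set A} {w : CWord A} (h : w.IsShuffle P) : Nonempty w.Dom := by
  obtain ⟨⟨e⟩, -⟩ := h
  exact ⟨e.symm 0⟩

theorem IsShuffle.denselyOrdered {P : Set A} {w : CWord A} (h : w.IsShuffle P) :
    DenselyOrdered w.Dom := by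
  obtain ⟨a, ha⟩ := h.nonempty
  exact ⟨fun x y hxy => (h.2.2 a ha x y hxy).imp fun z hz => ⟨hz.1, hz.2.1⟩⟩

theorem IsShuffle.iso {P : Set A} {w w' : CWord A} (h : w.IsShuffle P) (h' : w'.IsShuffle P) :
    w.Iso w' := by
  have := h.noMinOrder
  have := h.noMaxOrder
  have := h.domNonempty
  have := h.denselyOrdered
  have := h'.noMinOrder
  have := h'.noMaxOrder
  have := h'.domNonempty
  have := h'.denselyOrdered
  exact exists_orderIso_colored w.label w'.label (fun b => h.2.2 _ (h'.2.1 b))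
    (fun a => h'.2.2 _ (h.2.1 a))

/-- Density of a single letter makes the order dense, and Cantor's theorem then yields the order
type of `ℚ`. -/
theorem isShuffle_mk {P : Set A} (hP : P.Nonempty) {D : Type} [LinearOrder D] [Countable D]
    [Nonempty D] [NoMinOrder D] [NoMaxOrder D] (l : D → A) (hl : ∀ x, l x ∈ P)
    (hd : ∀ a ∈ P, ∀ x y : D, x < y → ∃ z, x < z ∧ z < y ∧ l z = a) :
    (⟨D, l⟩ : CWord A).IsShuffle P := by
  have : DenselyOrdered D := by
    obtain ⟨a, ha⟩ := hP
    exact ⟨fun x y hxy => (hd a ha x y hxy).imp fun z hz => ⟨hz.1, hz.2.1⟩⟩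
  exact ⟨Order.iso_of_countable_dense _ _, hl, hd⟩

end CWord

/-- All letters of `P` occur densely in the part `s` of the labelling `l`, which uses no other
letters. -/
def DenseOn {A : Type u} {D : Type} [LinearOrder D] (P : Set A) (l : D → A) (s : Set D) : Prop :=
  (∀ x ∈ s, l x ∈ P) ∧ ∀ a ∈ P, ∀ x ∈ s, ∀ y ∈ s, x < y → ∃ z ∈ s, x < z ∧ z < y ∧ l z = a

/-- `s` is nonempty and has neither a least nor a greatest element. -/
def NoEnds {D : Type} [LinearOrder D] (s : Set D) : Prop :=
  s.Nonempty ∧ (∀ x ∈ s, ∃ y ∈ s, y < x) ∧ ∀ x ∈ s, ∃ y ∈ s, x < y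

theorem DenseOn.mono {A : Type u} {D : Type} [LinearOrder D] {P : Set A} {l : D → A} {s t : Set D}
    (h : DenseOn P l s) (ht : t.OrdConnected) (hts : t ⊆ s) : DenseOn P l t := by
  refine ⟨fun x hx => h.1 x (hts hx), fun a ha x hx y hy hxy => ?_⟩
  obtain ⟨z, -, h1, h2, h3⟩ := h.2 a ha x (hts hx) y (hts hy) hxy
  exact ⟨z, ht.out hx hy ⟨h1.le, h2.le⟩, h1, h2, h3⟩

theorem CWord.IsShuffle.denseOn {A : Type u} {P : Set A} {w : CWord A} (h : w.IsShuffle P) :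
    DenseOn P w.label Set.univ := by
  refine ⟨fun x _ => h.2.1 x, fun a ha x _ y _ hxy => ?_⟩
  obtain ⟨z, hz⟩ := h.2.2 a ha x y hxy
  exact ⟨z, trivial, hz⟩

theorem DenseOn.isShuffle {A : Type u} {D : Type} [LinearOrder D] [Countable D] {P : Set A}
    {l : D → A} {s : Set D} (h : DenseOn P l s) (hs : NoEnds s) :
    (⟨s, fun x => l x⟩ : CWord A).IsShuffle P := by
  have : Nonempty s := hs.1.to_subtype
  have : NoMinOrder s := ⟨fun x => by
    obtain ⟨y, hy, hyx⟩ := hs.2.1 x x.2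
    exact ⟨⟨y, hy⟩, hyx⟩⟩
  have : NoMaxOrder s := ⟨fun x => by
    obtain ⟨y, hy, hyx⟩ := hs.2.2 x x.2
    exact ⟨⟨y, hy⟩, hyx⟩⟩
  refine CWord.isShuffle_mk ⟨_, h.1 _ hs.1.some_mem⟩ _ (fun x => h.1 x x.2) ?_
  intro a ha x y hxy
  obtain ⟨z, hz, h1, h2, h3⟩ := h.2 a ha x x.2 y y.2 hxy
  exact ⟨⟨z, hz⟩, h1, h2, h3⟩

namespace OMonoid

variable {M : Type u} (S : OMonoid M)

open Classical in
/-- The induced operation `κ`; its value at `∅` is set to `1`. -/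
noncomputable def kappa (P : Set M) : M :=
  if h : ∃ w : CWord M, w.IsShuffle P then S.π h.choose else S.one

theorem kappa_eq_π {P : Set M} {w : CWord M} (h : w.IsShuffle P) : S.kappa P = S.π w := by
  have hex : ∃ w : CWord M, w.IsShuffle P := ⟨w, h⟩
  rw [kappa, dif_pos hex]
  exact S.π_iso _ _ (hex.choose_spec.iso h)

theorem kappa_empty : S.kappa ∅ = S.one := by
  rw [kappa, dif_neg]
  rintro ⟨w, h⟩
  exact Set.not_nonempty_empty h.nonempty

theorem val_eq_kappa {D : Type} [LinearOrder D] [Countable D] {P : Set M} {l : D → M} {s : Set D}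
    (h : DenseOn P l s) (hs : NoEnds s) : S.val l s = S.kappa P :=
  (S.kappa_eq_π (h.isShuffle hs)).symm

end OMonoid

end CountableWords

namespace CountableWords

universe u v

namespace OMonoid

variable {M : Type u} (S : OMonoid M)

/-! ### The induced ⊛-algebra -/

/-- Both sides evaluate the same three-letter word, cut in two ways. The other identities are proved
in the same manner. -/
theorem mul_assoc' (a b c : M) : S.mul a (S.mul b c) = S.mul (S.mul a b) c := by
  let l : ℕ → M := fun n => if n = 0 then a else if n = 1 then b else c
  have h1 : S.val l ({0} ∪ ({1} ∪ {2})) = S.mul a (S.mul b c) := by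
    rw [val_union, val_union, val_singleton, val_singleton, val_singleton] <;> simp [l]
  have h2 : S.val l (({0} ∪ {1}) ∪ {2}) = S.mul (S.mul a b) c := by
    rw [val_union, val_union, val_singleton, val_singleton, val_singleton] <;> simp [l]
  rw [← h1, ← h2, Set.union_assoc]

theorem mul_one' (a : M) : S.mul a S.one = a := by
  have h1 : S.val (fun _ : ℕ => a) ({0} ∪ ∅) = S.mul a S.one := by
    rw [val_union, val_singleton, val_empty]; simp
  rw [← h1, Set.union_empty, val_singleton]

theorem one_mul' (a : M) : S.mul S.one a = a := by
  have h1 : S.val (fun _ : ℕ => a) (∅ ∪ {0}) = S.mul S.one a := by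
    rw [val_union, val_singleton, val_empty]; simp
  rw [← h1, Set.empty_union, val_singleton]

/-- The alternating word on `ℕ` is cut into the blocks `{2n, 2n+1}`, or into `{0}` followed by the
blocks `{2n+1, 2n+2}`. -/
theorem tau_mul' (a b : M) : S.tau (S.mul a b) = S.mul a (S.tau (S.mul b a)) := by
  let l : ℕ → M := fun n => if n % 2 = 0 then a else b
  have h1 : S.val l Set.univ = S.tau (S.mul a b) := by
    refine S.val_eq_tau l _ (fun n => n / 2) (fun x _ y _ h => Nat.div_le_div_right h) _ ?_
    intro n
    have : Set.univ ∩ (fun n => n / 2) ⁻¹' {n} = ({2 * n} ∪ {2 * n + 1} : Set ℕ) := by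
      ext m; simp; omega
    rw [this, val_union, val_singleton, val_singleton]
    · simp [l, Nat.add_mod]
    · simp
  have h2 : S.val l (Set.Ici 1) = S.tau (S.mul b a) := by
    refine S.val_eq_tau l _ (fun n => (n - 1) / 2) (fun x _ y _ h => ?_) _ ?_
    · exact Nat.div_le_div_right (Nat.sub_le_sub_right h 1)
    intro n
    have : Set.Ici 1 ∩ (fun n => (n - 1) / 2) ⁻¹' {n} = ({2 * n + 1} ∪ {2 * n + 2} : Set ℕ) := by
      ext m; simp; omega
    rw [this, val_union, val_singleton, val_singleton]
    · simp [l, Nat.add_mod]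
    · simp
  have h3 : (Set.univ : Set ℕ) = {0} ∪ Set.Ici 1 := by
    ext m; simp; omega
  rw [← h1, h3, val_union, h2, val_singleton]
  · rfl
  · intro x hx y hy
    simp at hx hy; omega

theorem val_Ico_const (a : M) (m n : ℕ) :
    S.val (fun _ : ℕ => a) (Set.Ico m (m + n + 1)) = powSucc S.mul a n := by
  induction n with
  | zero =>
    have : Set.Ico m (m + 0 + 1) = {m} := by ext x; simp; omega
    rw [this, val_singleton]; rfl
  | succ n ih =>
    have : Set.Ico m (m + (n + 1) + 1) = Set.Ico m (m + n + 1) ∪ {m + n + 1} := by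
      ext x; simp; omega
    rw [this, val_union, ih, val_singleton]
    · rfl
    · intro x hx y hy
      simp at hx hy; omega

theorem tau_pow' (a : M) (n : ℕ) : S.tau (powSucc S.mul a n) = S.tau a := by
  rw [← val_nat S a]
  symm
  -- `powSucc` at `n` has `n + 1` factors, which is the length of the blocks.
  refine S.val_eq_tau _ _ (fun m => m / (n + 1)) (fun x _ y _ h => Nat.div_le_div_right h) _ ?_
  intro m
  have : Set.univ ∩ (fun m => m / (n + 1)) ⁻¹' {m} =
      Set.Ico (m * (n + 1)) (m * (n + 1) + n + 1) := by
    ext x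
    simp only [Set.univ_inter, Set.mem_preimage, Set.mem_singleton_iff, Set.mem_Ico]
    rw [Nat.div_eq_iff (Nat.succ_pos n), Nat.succ_eq_add_one]
    constructor
    · rintro ⟨h1, h2⟩; constructor <;> omega
    · rintro ⟨h1, h2⟩; constructor <;> omega
  rw [this, val_Ico_const]

/-- Splitting the empty set along the identity map presents a word of letters `1` as a concatenation
of empty words. -/
theorem val_eq_one {D : Type} [LinearOrder D] [Countable D] (l : D → M) (s : Set D)
    (h : ∀ x ∈ s, l x = S.one) : S.val l s = S.one := by
  rw [← S.val_subtype, ← S.val_empty (fun x : s => l x),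
    S.val_fiber (fun x : s => l x) ∅ (id : s → s) (fun _ h => h.elim)]
  refine S.val_congr fun x _ => ?_
  rw [Set.empty_inter, val_empty]
  exact h x x.2

/-- Letters `1` may be erased: over a position outside `s` the fiber of the identity is empty and
contributes `1`. -/
theorem val_eq_val_univ {D : Type} [LinearOrder D] [Countable D] (l : D → M) {s : Set D}
    (h : ∀ x ∉ s, l x = S.one) : S.val l s = S.val l Set.univ := by
  classical
  rw [S.val_fiber l s id (monotone_id.monotoneOn _)]
  refine S.val_congr fun x _ => ?_
  by_cases hx : x ∈ s
  · have : s ∩ id ⁻¹' {x} = {x} := by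
      ext y; simp only [Set.mem_inter_iff, Set.mem_preimage, id, Set.mem_singleton_iff]
      exact ⟨fun h => h.2, fun h => ⟨h ▸ hx, h⟩⟩
    rw [this, val_singleton]
  · have : s ∩ id ⁻¹' {x} = ∅ := by
      ext y; simp only [Set.mem_inter_iff, Set.mem_preimage, id, Set.mem_singleton_iff]
      exact ⟨fun h => hx (h.2 ▸ h.1), fun h => h.elim⟩
    rw [this, val_empty, h x hx]

/-- Evaluation of the union of a set of fibers of a monotone map. -/
theorem val_preimage {D I : Type} [LinearOrder D] [Countable D] [LinearOrder I] [Countable I]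
    (l : D → M) (f : D → I) (hf : Monotone f) (J : Set I) :
    S.val l (f ⁻¹' J) = S.val (fun i => S.val l (f ⁻¹' {i})) J := by
  rw [S.val_fiber l _ f (hf.monotoneOn _), ← S.val_eq_val_univ (s := J)]
  · refine S.val_congr fun i hi => ?_
    rw [Set.inter_eq_right.2 (Set.preimage_mono (Set.singleton_subset_iff.2 hi))]
  · intro i hi
    have : f ⁻¹' J ∩ f ⁻¹' {i} = ∅ := by
      rw [← Set.preimage_inter, Set.inter_singleton_eq_empty.2 hi, Set.preimage_empty]
    rw [this, val_empty]

theorem tau_one' : S.tau S.one = S.one := by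
  rw [← val_nat]; exact S.val_eq_one _ _ fun _ _ => rfl

/-! ### Duality -/

section op

variable {D : Type} [LinearOrder D] [Countable D]

theorem op_val (l : D → M) (s : Set D) :
    S.op.val l s = S.val (fun x : Dᵒᵈ => l (OrderDual.ofDual x)) (OrderDual.ofDual ⁻¹' s) :=
  S.π_iso _ _ ⟨⟨⟨fun x => ⟨OrderDual.toDual (OrderDual.ofDual x).1, (OrderDual.ofDual x).2⟩,
    fun x => OrderDual.toDual ⟨OrderDual.ofDual x.1, x.2⟩, fun _ => rfl, fun _ => rfl⟩, Iff.rfl⟩,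
    fun _ => rfl⟩

theorem op_one : S.op.one = S.one := by
  rw [← S.op.val_empty (fun _ : ℕ => S.one), op_val, Set.preimage_empty, val_empty]

theorem op_mul (a b : M) : S.op.mul a b = S.mul b a := by
  let l : ℕ → M := fun n => if n = 0 then a else b
  have h : S.op.val l ({0} ∪ {1}) = S.op.mul a b := by
    rw [val_union, val_singleton, val_singleton] <;> simp [l]
  have h2 : OrderDual.ofDual ⁻¹' ({0} ∪ {1} : Set ℕ) =
      ({OrderDual.toDual 1} ∪ {OrderDual.toDual 0} : Set ℕᵒᵈ) := by
    rw [Set.union_comm]; rfl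
  rw [← h, op_val, h2, val_union, val_singleton, val_singleton]
  · rfl
  · rintro x rfl y rfl
    rw [OrderDual.toDual_lt_toDual]; exact one_pos

theorem op_tau (a : M) : S.op.tau a = S.tauRev a := rfl

theorem _root_.CountableWords.CWord.IsShuffle.dual {P : Set M} {w : CWord M} (h : w.IsShuffle P) :
    (⟨w.Domᵒᵈ, fun x => w.label (OrderDual.ofDual x)⟩ : CWord M).IsShuffle P := by
  have := h.noMinOrder
  have := h.noMaxOrder
  have := h.domNonempty
  refine CWord.isShuffle_mk h.nonempty _ (fun x => h.2.1 _) ?_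
  intro a ha x y hxy
  obtain ⟨z, h1, h2, h3⟩ := h.2.2 a ha _ _ hxy
  exact ⟨OrderDual.toDual z, h2, h1, h3⟩

theorem op_kappa (P : Set M) : S.op.kappa P = S.kappa P := by
  by_cases h : ∃ w : CWord M, w.IsShuffle P
  · obtain ⟨w, hw⟩ := h
    rw [S.op.kappa_eq_π hw, S.kappa_eq_π hw.dual]
    rfl
  · rw [kappa, kappa, dif_neg h, dif_neg h, op_one]

end op

theorem powSucc_swap (a : M) (n : ℕ) :
    powSucc (fun x y => S.mul y x) a n = powSucc S.mul a n := by
  have h : ∀ n, S.mul a (powSucc S.mul a n) = powSucc S.mul a (n + 1) := by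
    intro n
    induction n with
    | zero => rfl
    | succ n ih => rw [powSucc, mul_assoc', ih]; rfl
  induction n with
  | zero => rfl
  | succ n ih => rw [powSucc, ih, h]

theorem tauRev_mul' (a b : M) : S.tauRev (S.mul b a) = S.mul (S.tauRev (S.mul a b)) a := by
  simpa only [op_mul, op_tau] using S.op.tau_mul' a b

theorem tauRev_pow' (a : M) (n : ℕ) : S.tauRev (powSucc S.mul a n) = S.tauRev a := by
  have h := S.op.tau_pow' a n
  have : S.op.mul = fun x y => S.mul y x := by funext x y; exact S.op_mul x y
  rwa [this, powSucc_swap, op_tau, op_tau] at h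

theorem tauRev_one' : S.tauRev S.one = S.one := by
  have := S.op.tau_one'
  rwa [op_tau, op_one] at this

/-! ### The identities of `κ` -/

/-- A concatenation of words in which all letters of `P` occur densely is a shuffle of `P` if
between two positions of different blocks there are two positions of the same block. -/
theorem isShuffle_concat {P : Set M} (hP : P.Nonempty) {I : Type} [LinearOrder I] [Countable I]
    (u : I → CWord M) (hd : ∀ i, DenseOn P (u i).label Set.univ)
    (hb : ∀ i j, i < j → ∀ (x : (u i).Dom) (y : (u j).Dom), ∃ k, ∃ p q : (u k).Dom, p < q ∧
      (toLex ⟨i, x⟩ : Σₗ i, (u i).Dom) ≤ toLex ⟨k, p⟩ ∧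
      (toLex ⟨k, q⟩ : Σₗ i, (u i).Dom) ≤ toLex ⟨j, y⟩)
    (hne : Nonempty (Σₗ i, (u i).Dom)) (hmin : NoMinOrder (Σₗ i, (u i).Dom))
    (hmax : NoMaxOrder (Σₗ i, (u i).Dom)) :
    (CWord.concat ⟨I, u⟩).IsShuffle P := by
  have : Countable (Σₗ i, (u i).Dom) := inferInstanceAs (Countable (Σ i, (u i).Dom))
  refine CWord.isShuffle_mk hP (D := Σₗ i, (u i).Dom) _ (fun x => (hd _).1 _ trivial) ?_
  intro a ha
  have key : ∀ k, ∀ p q : (u k).Dom, p < q → ∃ z : Σₗ i, (u i).Dom, toLex ⟨k, p⟩ < z ∧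
      z < toLex ⟨k, q⟩ ∧ (u (ofLex z).1).label (ofLex z).2 = a := by
    intro k p q hpq
    obtain ⟨z, -, h1, h2, h3⟩ := (hd k).2 a ha p trivial q trivial hpq
    exact ⟨toLex ⟨k, z⟩, Sigma.Lex.right _ _ h1, Sigma.Lex.right _ _ h2, h3⟩
  intro x y hxy
  cases hxy with
  | @left i j x y hij =>
    obtain ⟨k, p, q, hpq, h1, h2⟩ := hb i j hij x y
    obtain ⟨z, hz1, hz2, hz3⟩ := key k p q hpq
    exact ⟨z, h1.trans_lt hz1, hz2.trans_le h2, hz3⟩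
  | @right i x y hxy => exact key i x y hxy

/-- The repetition of `u` along `ω` is again a shuffle: as `u` has no least position, a position of
a later block is preceded by another one of the same block. A greatest position is allowed, which
covers `P^κ c` as well as `P^κ`. -/
theorem kappa_eq_tau {P : Set M} (hP : P.Nonempty) (u : CWord M)
    (hd : DenseOn P u.label Set.univ) (hne : Nonempty u.Dom) (hmin : NoMinOrder u.Dom) :
    S.kappa P = S.tau (S.π u) := by
  have h : (CWord.concat ⟨ℕ, fun _ => u⟩).IsShuffle P := by
    refine isShuffle_concat hP _ (fun _ => hd) ?_ ?_ ?_ ?_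
    · intro i j hij x y
      obtain ⟨z, hz⟩ := exists_lt y
      exact ⟨j, z, y, hz, le_of_lt (Sigma.Lex.left _ _ hij), le_rfl⟩
    · exact hne.map fun x => toLex ⟨0, x⟩
    · refine ⟨fun x => ?_⟩
      obtain ⟨i, x⟩ := x
      obtain ⟨z, hz⟩ := exists_lt x
      exact ⟨toLex ⟨i, z⟩, Sigma.Lex.right _ _ hz⟩
    · refine ⟨fun x => ?_⟩
      obtain ⟨i, x⟩ := x
      exact ⟨toLex ⟨i + 1, x⟩, Sigma.Lex.left _ _ (Nat.lt_succ_self i)⟩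
  rw [S.kappa_eq_π h, π_concat_eq]
  rfl

theorem val_of_isShuffle {P : Set M} {w : CWord M} (h : w.IsShuffle P) {s : Set w.Dom}
    (hs : s.OrdConnected) (hn : NoEnds s) : S.val w.label s = S.kappa P :=
  S.val_eq_kappa (h.denseOn.mono hs (Set.subset_univ s)) hn

theorem val_Ioo {P : Set M} {w : CWord M} (h : w.IsShuffle P) {p q : w.Dom} (hpq : p < q) :
    S.val w.label (Set.Ioo p q) = S.kappa P := by
  have := h.denselyOrdered
  refine S.val_of_isShuffle h Set.ordConnected_Ioo ⟨Set.nonempty_Ioo.2 hpq, ?_, ?_⟩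
  · intro x hx
    obtain ⟨y, hy⟩ := exists_between hx.1
    exact ⟨y, ⟨hy.1, hy.2.trans hx.2⟩, hy.2⟩
  · intro x hx
    obtain ⟨y, hy⟩ := exists_between hx.2
    exact ⟨y, ⟨hx.1.trans hy.1, hy.2⟩, hy.1⟩

theorem val_Iio {P : Set M} {w : CWord M} (h : w.IsShuffle P) (q : w.Dom) :
    S.val w.label (Set.Iio q) = S.kappa P := by
  have := h.denselyOrdered
  have := h.noMinOrder
  refine S.val_of_isShuffle h Set.ordConnected_Iio ⟨Set.nonempty_Iio, ?_, ?_⟩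
  · intro x hx
    obtain ⟨y, hy⟩ := exists_lt x
    exact ⟨y, hy.trans hx, hy⟩
  · intro x hx
    obtain ⟨y, hy⟩ := exists_between (Set.mem_Iio.1 hx)
    exact ⟨y, hy.2, hy.1⟩

theorem val_Ioi {P : Set M} {w : CWord M} (h : w.IsShuffle P) (q : w.Dom) :
    S.val w.label (Set.Ioi q) = S.kappa P := by
  have := h.denselyOrdered
  have := h.noMaxOrder
  refine S.val_of_isShuffle h Set.ordConnected_Ioi ⟨Set.nonempty_Ioi, ?_, ?_⟩
  · intro x hx
    obtain ⟨y, hy⟩ := exists_between (Set.mem_Ioi.1 hx)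
    exact ⟨y, hy.1, hy.2⟩
  · intro x hx
    obtain ⟨y, hy⟩ := exists_gt x
    exact ⟨y, lt_trans hx hy, hy⟩

theorem val_Iic {P : Set M} {w : CWord M} (h : w.IsShuffle P) (q : w.Dom) :
    S.val w.label (Set.Iic q) = S.mul (S.kappa P) (w.label q) := by
  rw [← Set.Iio_union_right, val_union, val_Iio S h, val_singleton]
  rintro x hx y rfl
  exact hx

theorem exists_label {P : Set M} {w : CWord M} (h : w.IsShuffle P) {c : M} (hc : c ∈ P) :
    ∃ q, w.label q = c := by
  have := h.noMaxOrder
  obtain ⟨x⟩ := h.domNonempty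
  obtain ⟨y, hy⟩ := exists_gt x
  obtain ⟨z, -, -, hz⟩ := h.2.2 c hc x y hy
  exact ⟨z, hz⟩

variable [Countable M]

theorem kappa_tau' {P : Set M} (hP : P.Nonempty) : S.kappa P = S.tau (S.kappa P) := by
  obtain ⟨w, h⟩ := CWord.exists_isShuffle hP P.to_countable
  conv_rhs => rw [S.kappa_eq_π h]
  exact S.kappa_eq_tau hP w h.denseOn h.domNonempty h.noMinOrder

/-- An element equal to its own `τ` is idempotent, by `tau_mul'` with the second factor `1`. -/
theorem kappa_mul_kappa' {P : Set M} (hP : P.Nonempty) :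
    S.kappa P = S.mul (S.kappa P) (S.kappa P) := by
  have h := S.tau_mul' (S.kappa P) S.one
  rwa [mul_one', one_mul', ← S.kappa_tau' hP] at h

theorem kappa_mul_mul_kappa' {P : Set M} {c : M} (hc : c ∈ P) :
    S.kappa P = S.mul (S.mul (S.kappa P) c) (S.kappa P) := by
  obtain ⟨w, h⟩ := CWord.exists_isShuffle ⟨c, hc⟩ P.to_countable
  obtain ⟨q, rfl⟩ := exists_label h hc
  conv_rhs => rw [← S.val_Iic h q, ← S.val_Ioi h q]
  rw [← val_union, Set.Iic_union_Ioi, ← π_eq_val, S.kappa_eq_π h]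
  intro x hx y hy
  exact lt_of_le_of_lt hx hy

theorem kappa_mul_tau' {P : Set M} {c : M} (hc : c ∈ P) :
    S.kappa P = S.tau (S.mul (S.kappa P) c) := by
  obtain ⟨w, h⟩ := CWord.exists_isShuffle ⟨c, hc⟩ P.to_countable
  obtain ⟨q, rfl⟩ := exists_label h hc
  have := h.noMinOrder
  conv_rhs => rw [← S.val_Iic h q]
  refine S.kappa_eq_tau ⟨_, hc⟩ ⟨Set.Iic q, fun x => w.label x⟩ ?_ ⟨⟨q, le_rfl⟩⟩ ?_
  · refine ⟨fun x _ => h.2.1 _, fun a ha x _ y _ hxy => ?_⟩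
    obtain ⟨z, h1, h2, h3⟩ := h.2.2 a ha _ _ hxy
    exact ⟨⟨z, h2.le.trans y.2⟩, trivial, h1, h2, h3⟩
  · refine ⟨fun x => ?_⟩
    obtain ⟨y, hy⟩ := exists_lt x.1
    exact ⟨⟨y, hy.le.trans x.2⟩, hy⟩

theorem kappa_tauRev' {P : Set M} (hP : P.Nonempty) : S.kappa P = S.tauRev (S.kappa P) := by
  simpa only [op_kappa, op_tau] using S.op.kappa_tau' hP

theorem mul_kappa_tauRev' {P : Set M} {c : M} (hc : c ∈ P) :
    S.kappa P = S.tauRev (S.mul c (S.kappa P)) := by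
  simpa only [op_kappa, op_tau, op_mul] using S.op.kappa_mul_tau' hc

theorem kappa_one' : S.kappa {S.one} = S.one := by
  obtain ⟨w, h⟩ := CWord.exists_isShuffle (Set.singleton_nonempty S.one)
    (Set.countable_singleton _)
  rw [S.kappa_eq_π h, π_eq_val]
  exact S.val_eq_one _ _ fun x _ => h.2.1 x

/-- If `1` is a new letter, erasing it from a shuffle of `P ∪ {1}` leaves a shuffle of `P` and does
not change the value. -/
theorem kappa_union_one' {P : Set M} (hP : P.Nonempty) :
    S.kappa P = S.kappa (P ∪ {S.one}) := by
  classical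
  by_cases h1 : S.one ∈ P
  · rw [Set.union_eq_self_of_subset_right (Set.singleton_subset_iff.2 h1)]
  obtain ⟨w, h⟩ := CWord.exists_isShuffle (hP.mono Set.subset_union_left)
    (P ∪ {S.one}).to_countable
  have := h.noMaxOrder
  have := h.noMinOrder
  obtain ⟨c, hc⟩ := hP
  let s : Set w.Dom := {x | w.label x ∈ P}
  have hs : S.val w.label s = S.kappa P := by
    refine S.val_eq_kappa ⟨fun x hx => hx, fun a ha x hx y hy hxy => ?_⟩ ⟨?_, ?_, ?_⟩
    · obtain ⟨z, h1, h2, rfl⟩ := h.2.2 a (Or.inl ha) x y hxy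
      exact ⟨z, ha, h1, h2, rfl⟩
    · obtain ⟨q, hq⟩ := exists_label h (Or.inl hc : c ∈ P ∪ {S.one})
      exact ⟨q, by rw [← hq] at hc; exact hc⟩
    · intro x _
      obtain ⟨y, hy⟩ := exists_lt x
      obtain ⟨z, h1, h2, rfl⟩ := h.2.2 c (Or.inl hc) y x hy
      exact ⟨z, hc, h2⟩
    · intro x _
      obtain ⟨y, hy⟩ := exists_gt x
      obtain ⟨z, h1, h2, rfl⟩ := h.2.2 c (Or.inl hc) x y hy
      exact ⟨z, hc, h1⟩
  rw [← hs, S.kappa_eq_π h, π_eq_val]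
  exact S.val_eq_val_univ _ fun x hx => (h.2.1 x).resolve_left hx

/-- The four shapes are the values of open, half-open and closed intervals in a shuffle of `P`. The
two distinct positions are recorded because `isShuffle_concat` needs blocks with two positions. -/
theorem exists_part {P : Set M} {w : CWord M} (h : w.IsShuffle P) {x : M}
    (hx : x = S.kappa P ∨ (∃ a ∈ P, x = S.mul a (S.kappa P)) ∨
      (∃ b ∈ P, x = S.mul (S.kappa P) b) ∨
      ∃ a ∈ P, ∃ b ∈ P, x = S.mul (S.mul a (S.kappa P)) b) :
    ∃ s : Set w.Dom, s.OrdConnected ∧ (∃ p ∈ s, ∃ q ∈ s, p < q) ∧ S.val w.label s = x := by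
  have := h.denselyOrdered
  have := h.noMaxOrder
  have hnt : ∀ p q : w.Dom, p < q → ∀ s, Set.Ioo p q ⊆ s → ∃ p ∈ s, ∃ q ∈ s, p < q := by
    intro p q hpq s hs
    obtain ⟨y, hy⟩ := exists_between hpq
    obtain ⟨z, hz⟩ := exists_between hy.2
    exact ⟨y, hs hy, z, hs ⟨hy.1.trans hz.1, hz.2⟩, hz.1⟩
  have hIoc : ∀ p q : w.Dom, p < q →
      S.val w.label (Set.Ioc p q) = S.mul (S.kappa P) (w.label q) := by
    intro p q hpq
    rw [← Set.Ioo_union_right hpq, val_union, val_Ioo S h hpq, val_singleton]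
    rintro x hx y rfl
    exact hx.2
  have hlt : ∀ a ∈ P, ∀ b ∈ P, ∃ p q, p < q ∧ w.label p = a ∧ w.label q = b := by
    intro a ha b hb
    obtain ⟨p, hp⟩ := exists_label h ha
    obtain ⟨q', hq'⟩ := exists_gt p
    obtain ⟨q, hpq, -, hq⟩ := h.2.2 b hb p q' hq'
    exact ⟨p, q, hpq, hp, hq⟩
  rcases hx with rfl | ⟨a, ha, rfl⟩ | ⟨b, hb, rfl⟩ | ⟨a, ha, b, hb, rfl⟩
  · obtain ⟨c, hc⟩ := h.nonempty
    obtain ⟨p, q, hpq, -, -⟩ := hlt c hc c hc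
    exact ⟨Set.Ioo p q, Set.ordConnected_Ioo, hnt p q hpq _ subset_rfl, S.val_Ioo h hpq⟩
  · obtain ⟨p, q, hpq, rfl, -⟩ := hlt a ha a ha
    refine ⟨Set.Ico p q, Set.ordConnected_Ico, hnt p q hpq _ Set.Ioo_subset_Ico_self, ?_⟩
    rw [← Set.Ioo_union_left hpq, Set.union_comm, val_union, val_Ioo S h hpq, val_singleton]
    rintro x rfl y hy
    exact hy.1
  · obtain ⟨p, q, hpq, -, rfl⟩ := hlt b hb b hb
    exact ⟨Set.Ioc p q, Set.ordConnected_Ioc, hnt p q hpq _ Set.Ioo_subset_Ioc_self, hIoc p q hpq⟩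
  · obtain ⟨p, q, hpq, rfl, rfl⟩ := hlt a ha b hb
    refine ⟨Set.Icc p q, Set.ordConnected_Icc, hnt p q hpq _ Set.Ioo_subset_Icc_self, ?_⟩
    rw [← Set.Ioc_union_left hpq.le, Set.union_comm, val_union, hIoc p q hpq, val_singleton,
      mul_assoc']
    rintro x rfl y hy
    exact hy.1

/-- In a shuffle of `P' ∪ P''`, expand each letter of `P''` to an interval, with that value, of a
shuffle of `P`, and keep the other letters as single positions. As `P''` is nonempty, blocks with
two positions occur between any two blocks, so the expanded word is a shuffle of `P`. -/
theorem kappa_union' {P : Set M} (hP : P.Nonempty) {P' : Set M} (hP' : P' ⊆ P) {P'' : Set M}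
    (hne : P''.Nonempty)
    (hP'' : ∀ x ∈ P'', x = S.kappa P ∨ (∃ a ∈ P, x = S.mul a (S.kappa P)) ∨
      (∃ b ∈ P, x = S.mul (S.kappa P) b) ∨
      ∃ a ∈ P, ∃ b ∈ P, x = S.mul (S.mul a (S.kappa P)) b) :
    S.kappa P = S.kappa (P' ∪ P'') := by
  classical
  obtain ⟨w, h⟩ := CWord.exists_isShuffle hP P.to_countable
  obtain ⟨v, hv⟩ := CWord.exists_isShuffle (hne.mono Set.subset_union_right)
    (P' ∪ P'').to_countable
  have := hv.noMinOrder
  have := hv.noMaxOrder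
  have hblock : ∀ x ∈ P' ∪ P'', ∃ u : CWord M, S.π u = x ∧ DenseOn P u.label Set.univ ∧
      (x ∈ P'' → ∃ p q : u.Dom, p < q) := by
    intro x hx
    by_cases hx2 : x ∈ P''
    · obtain ⟨s, hs, ⟨p, hp, q, hq, hpq⟩, rfl⟩ := S.exists_part h (hP'' x hx2)
      refine ⟨⟨s, fun x => w.label x⟩, rfl, ?_, fun _ => ⟨⟨p, hp⟩, ⟨q, hq⟩, hpq⟩⟩
      refine ⟨fun x _ => h.2.1 _, fun a ha x _ y _ hxy => ?_⟩
      obtain ⟨z, h1, h2, h3⟩ := h.2.2 a ha _ _ hxy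
      exact ⟨⟨z, hs.out x.2 y.2 ⟨h1.le, h2.le⟩⟩, trivial, h1, h2, h3⟩
    · refine ⟨CWord.single x, S.π_single x, ⟨fun y _ => ?_, fun a ha y _ z _ hyz => ?_⟩,
        fun h => absurd h hx2⟩
      · have : y = (0 : Fin 1) := Subsingleton.elim (α := Fin 1) _ _
        subst this
        exact hP' (hx.resolve_right hx2)
      · have : y = z := Subsingleton.elim (α := Fin 1) _ _
        exact absurd hyz (this ▸ lt_irrefl _)
  choose u hu1 hu2 hu3 using fun i : v.Dom => hblock (v.label i) (hv.2.1 i)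
  obtain ⟨c, hc⟩ := hne
  have hbig : ∀ i j : v.Dom, i < j → ∃ k, i < k ∧ k < j ∧ ∃ p q : (u k).Dom, p < q := by
    intro i j hij
    obtain ⟨k, h1, h2, rfl⟩ := hv.2.2 c (Or.inr hc) i j hij
    exact ⟨k, h1, h2, hu3 k hc⟩
  have hsh : (CWord.concat ⟨v.Dom, u⟩).IsShuffle P := by
    refine isShuffle_concat hP u hu2 ?_ ?_ ?_ ?_
    · intro i j hij x y
      obtain ⟨k, h1, h2, p, q, hpq⟩ := hbig i j hij
      exact ⟨k, p, q, hpq, le_of_lt (Sigma.Lex.left _ _ h1), le_of_lt (Sigma.Lex.left _ _ h2)⟩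
    · obtain ⟨i⟩ := hv.domNonempty
      obtain ⟨j, hj⟩ := exists_gt i
      obtain ⟨k, h1, h2, p, q, hpq⟩ := hbig i j hj
      exact ⟨toLex ⟨k, p⟩⟩
    · refine ⟨fun x => ?_⟩
      obtain ⟨i, x⟩ := x
      obtain ⟨j, hj⟩ := exists_lt i
      obtain ⟨k, h1, h2, p, q, hpq⟩ := hbig j i hj
      exact ⟨toLex ⟨k, p⟩, Sigma.Lex.left _ _ h2⟩
    · refine ⟨fun x => ?_⟩
      obtain ⟨i, x⟩ := x
      obtain ⟨j, hj⟩ := exists_gt i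
      obtain ⟨k, h1, h2, p, q, hpq⟩ := hbig i j hj
      exact ⟨toLex ⟨k, p⟩, Sigma.Lex.left _ _ h1⟩
  rw [S.kappa_eq_π hsh, S.kappa_eq_π hv, π_concat_eq]
  congr 2
  funext i
  exact hu1 i

/-- The ⊛-algebra induced by a ⊛-monoid. -/
noncomputable def alg : OAlgebra M where
  one := S.one
  mul := S.mul
  tau := S.tau
  tauRev := S.tauRev
  kappa := S.kappa
  mul_assoc := S.mul_assoc'
  tau_mul := S.tau_mul'
  tau_pow := S.tau_pow'
  tauRev_mul := S.tauRev_mul'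
  tauRev_pow := S.tauRev_pow'
  kappa_mul_kappa _ := S.kappa_mul_kappa'
  kappa_mul_mul_kappa _ _ := S.kappa_mul_mul_kappa'
  kappa_tau _ := S.kappa_tau'
  kappa_mul_tau _ _ := S.kappa_mul_tau'
  kappa_tauRev _ := S.kappa_tauRev'
  mul_kappa_tauRev _ _ := S.mul_kappa_tauRev'
  kappa_union _ hP _ hP' _ hne h := S.kappa_union' hP hP' hne h
  mul_one := S.mul_one'
  one_mul := S.one_mul'
  tau_one := S.tau_one'
  tauRev_one := S.tauRev_one'
  kappa_one := S.kappa_one'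
  kappa_union_one _ := S.kappa_union_one'

theorem induces_alg : S.Induces S.alg :=
  ⟨rfl, fun _ _ => rfl, fun _ => rfl, fun _ => rfl, fun _ _ _ hw => S.kappa_eq_π hw⟩

end OMonoid

end CountableWords

namespace CountableWords

universe u v

/-! ### Induction on countable orders -/

/-- A nonempty part without greatest element of a countable order has a cofinal increasing
sequence whose consecutive terms all have the same colour, for a given finite colouring of pairs. -/
theorem exists_cofinal_seq_const {D : Type} [LinearOrder D] [Countable D] {M : Type u} [Finite M]
    (c : D → D → M) {v : Set D} (hv : v.Nonempty) (hmax : ∀ x ∈ v, ∃ y ∈ v, x < y) :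
    ∃ (x : ℕ → D) (e : M), StrictMono x ∧ (∀ n, x n ∈ v) ∧ (∀ y ∈ v, ∃ n, y < x n) ∧
      ∀ n, c (x n) (x (n + 1)) = e := by
  have : Nonempty v := hv.to_subtype
  have : NoMaxOrder v := ⟨fun x => by
    obtain ⟨y, hy, h⟩ := hmax x x.2
    exact ⟨⟨y, hy⟩, h⟩⟩
  -- An ultrafilter replaces Ramsey's theorem: for each `a`, almost all later `b` give the pair one
  -- colour `E a`, and almost all `a` have the same `E a = e`.
  let U : Ultrafilter v := Ultrafilter.of Filter.atTop
  have hU : (U : Filter v) ≤ Filter.atTop := Ultrafilter.of_le _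
  have hconst : ∀ f : v → M, ∃ e, ∀ᶠ b in (U : Filter v), f b = e := by
    intro f
    obtain ⟨e, he⟩ := Ultrafilter.eq_pure_of_finite (U.map f)
    refine ⟨e, ?_⟩
    have : {e} ∈ U.map f := by rw [he]; exact Set.mem_singleton e
    exact this
  choose E hE using fun a : v => hconst fun b => c a b
  obtain ⟨e, he⟩ := hconst E
  obtain ⟨g, hg⟩ := exists_surjective_nat v
  -- The next term also exceeds the `n`-th element of an enumeration of `v`, which makes the
  -- sequence cofinal.
  have hstep : ∀ (n : ℕ) (a : v), ∃ b : v, E a = e → a < b ∧ g n < b ∧ c a b = e ∧ E b = e := by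
    intro n a
    by_cases ha : E a = e
    · have h1 : ∀ᶠ b in (U : Filter v), a < b := hU (Filter.eventually_gt_atTop a)
      have h2 : ∀ᶠ b in (U : Filter v), g n < b := hU (Filter.eventually_gt_atTop (g n))
      obtain ⟨b, h1, h2, h3, h4⟩ := (h1.and (h2.and ((hE a).and he))).exists
      exact ⟨b, fun _ => ⟨h1, h2, h3.trans ha, h4⟩⟩
    · exact ⟨a, fun h => absurd h ha⟩
  choose step hstep using hstep
  obtain ⟨a, ha⟩ := he.exists
  let x : ℕ → v := fun n => Nat.rec a (fun n b => step n b) n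
  have hx : ∀ n, E (x n) = e := by
    intro n
    induction n with
    | zero => exact ha
    | succ n ih => exact (hstep n (x n) ih).2.2.2
  have hc : ∀ n, c (x n).1 (x (n + 1)).1 = e := fun n => (hstep n (x n) (hx n)).2.2.1
  refine ⟨fun n => (x n).1, e, strictMono_nat_of_lt_succ fun n => (hstep n (x n) (hx n)).1,
    fun n => (x n).2, fun y hy => ?_, hc⟩
  obtain ⟨n, hn⟩ := hg ⟨y, hy⟩
  refine ⟨n + 1, ?_⟩
  have := (hstep n (x n) (hx n)).2.1
  rw [hn] at this
  exact this

/-- The closure properties of a property of convex sets of positions of a word that make it hold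
for all of them. -/
structure ConvexInduction {M : Type u} (S : OMonoid M) {D : Type} [LinearOrder D] [Countable D]
    (l : D → M) (Q : Set D → Prop) : Prop where
  empty : Q ∅
  singleton : ∀ x, Q {x}
  union : ∀ s t : Set D, s.OrdConnected → t.OrdConnected → (s ∪ t).OrdConnected →
    (∀ x ∈ s, ∀ y ∈ t, x < y) → Q s → Q t → Q (s ∪ t)
  omega : ∀ s : Set D, s.OrdConnected → ∀ x : ℕ → D, StrictMono x → (∀ n, x n ∈ s) →
    (∀ y ∈ s, ∃ n, y < x n) → Q (s ∩ Set.Iio (x 0)) → (∀ n, Q (Set.Ico (x n) (x (n + 1)))) →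
    ∀ e, (∀ n, S.val l (Set.Ico (x n) (x (n + 1))) = e) → Q s
  omegaRev : ∀ s : Set D, s.OrdConnected → ∀ x : ℕ → D, StrictAnti x → (∀ n, x n ∈ s) →
    (∀ y ∈ s, ∃ n, x n < y) → Q (s ∩ Set.Ioi (x 0)) → (∀ n, Q (Set.Ioc (x (n + 1)) (x n))) →
    ∀ e, (∀ n, S.val l (Set.Ioc (x (n + 1)) (x n)) = e) → Q s
  shuffle : ∀ (I : Type) [LinearOrder I] [Countable I] (f : D → I), Monotone f →
    Function.Surjective f → ∀ J : Set I, J.OrdConnected → NoEnds J → ∀ P : Set M,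
    DenseOn P (fun i => S.val l (f ⁻¹' {i})) J → (∀ i ∈ J, Q (f ⁻¹' {i})) → Q (f ⁻¹' J)

namespace ConvexInduction

variable {M : Type u} {S : OMonoid M} {D : Type} [LinearOrder D] [Countable D] {l : D → M}
  {Q : Set D → Prop}

/-- All convex sets of positions between `x` and `y` have the property `Q`. -/
def Good (Q : Set D → Prop) (x y : D) : Prop :=
  ∀ t : Set D, t.OrdConnected → t ⊆ Set.uIcc x y → Q t

theorem Good.symm {x y : D} (h : Good Q x y) : Good Q y x := fun t ht hs =>
  h t ht (Set.uIcc_comm x y ▸ hs)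

theorem Good.mono {x y z w : D} (h : Good Q x y) (hz : z ∈ Set.uIcc x y) (hw : w ∈ Set.uIcc x y) :
    Good Q z w := fun t ht hs => h t ht (hs.trans (Set.uIcc_subset_uIcc hz hw))

theorem good_refl (H : ConvexInduction S l Q) (x : D) : Good Q x x := by
  intro t _ ht
  rw [Set.uIcc_self, Set.subset_singleton_iff_eq] at ht
  rcases ht with rfl | rfl
  · exact H.empty
  · exact H.singleton x

/-- A convex set between `x` and `z` is cut at `y`; wherever `y` lies, each piece is between `y` and
one of the ends. -/
theorem good_trans (H : ConvexInduction S l Q) {x y z : D} (hxy : Good Q x y) (hyz : Good Q y z) :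
    Good Q x z := by
  wlog hxz : x ≤ z generalizing x z
  · exact (this hyz.symm hxy.symm (le_of_not_ge hxz)).symm
  intro t ht hs
  rw [Set.uIcc_of_le hxz] at hs
  have h1 : t ∩ Set.Iio y ⊆ Set.uIcc x y := fun w hw =>
    Set.mem_uIcc.2 (Or.inl ⟨(hs hw.1).1, le_of_lt hw.2⟩)
  have h2 : t ∩ Set.Ici y ⊆ Set.uIcc y z := fun w hw =>
    Set.mem_uIcc.2 (Or.inl ⟨hw.2, (hs hw.1).2⟩)
  have h3 : t ∩ Set.Iio y ∪ t ∩ Set.Ici y = t := by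
    rw [← Set.inter_union_distrib_left, Set.Iio_union_Ici, Set.inter_univ]
  rw [← h3]
  refine H.union _ _ (ht.inter Set.ordConnected_Iio) (ht.inter Set.ordConnected_Ici)
    (by rw [h3]; exact ht)
    (fun a ha b hb => lt_of_lt_of_le ha.2 hb.2) (hxy _ (ht.inter Set.ordConnected_Iio) h1)
    (hyz _ (ht.inter Set.ordConnected_Ici) h2)

/-- The condensation of the order by the relation `Good`. -/
theorem exists_condensation (H : ConvexInduction S l Q) :
    ∃ (I : Type) (_ : LinearOrder I) (_ : Countable I) (f : D → I), Monotone f ∧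
      Function.Surjective f ∧ ∀ x y, f x = f y ↔ Good Q x y := by
  let r : Setoid D := ⟨Good Q, H.good_refl, Good.symm, H.good_trans⟩
  -- Classes are represented by chosen elements, so that the quotient inherits its linear order from
  -- `D`; that classes are convex becomes monotonicity of `rep`.
  let rep : D → D := fun x => (Quotient.mk r x).out
  have hrep : ∀ x, Good Q (rep x) x := fun x => Quotient.mk_out (s := r) x
  have hiff : ∀ x y, rep x = rep y ↔ Good Q x y := by
    intro x y
    refine ⟨fun h => H.good_trans (hrep x).symm (h ▸ hrep y), fun h => ?_⟩
    exact congrArg Quotient.out (Quotient.sound (s := r) h)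
  have hmono : Monotone rep := by
    intro x y hxy
    by_contra hlt
    push Not at hlt
    have h : Good Q x y := by
      rcases le_total y (rep x) with h | h
      · exact (hrep x).symm.mono Set.left_mem_uIcc (Set.mem_uIcc.2 (Or.inl ⟨hxy, h⟩))
      · have h2 : rep y ≤ rep x := hlt.le
        have h3 : Good Q (rep x) y := (hrep y).mono (Set.mem_uIcc.2 (Or.inl ⟨h2, h⟩))
          Set.right_mem_uIcc
        exact H.good_trans (hrep x).symm h3
    exact hlt.ne' ((hiff x y).2 h)
  have hidem : ∀ x, rep (rep x) = rep x := fun x => (hiff _ _).2 (hrep x)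
  refine ⟨{x : D // rep x = x}, inferInstance, inferInstance, fun x => ⟨rep x, hidem x⟩, ?_, ?_, ?_⟩
  · exact fun x y h => hmono h
  · exact fun x => ⟨x, Subtype.ext x.2⟩
  · intro x y
    rw [Subtype.mk.injEq, hiff]

variable [Finite M]

/-- If `v` is bounded above in `t`, it lies between two equivalent points. Otherwise it has a
cofinal sequence, which Ramsey thins out to blocks of equal value, and the rule `omega` applies. -/
theorem of_good_of_le (H : ConvexInduction S l Q) {t : Set D}
    (hg : ∀ x ∈ t, ∀ y ∈ t, Good Q x y) {v : Set D} (hv : v.OrdConnected) (hvt : v ⊆ t) {x : D}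
    (hx : x ∈ t) (hxv : ∀ y ∈ v, x ≤ y) : Q v := by
  by_cases hb : ∃ z ∈ t, ∀ y ∈ v, y ≤ z
  · obtain ⟨z, hz, hb⟩ := hb
    exact hg x hx z hz v hv fun y hy => Set.mem_uIcc.2 (Or.inl ⟨hxv y hy, hb y hy⟩)
  · push Not at hb
    obtain ⟨y, hy, -⟩ := hb x hx
    obtain ⟨s, e, hs, hsv, hcof, hse⟩ := exists_cofinal_seq_const
      (fun a b => S.val l (Set.Ico a b)) ⟨y, hy⟩ (fun z hz => hb z (hvt hz))
    refine H.omega v hv s hs hsv hcof ?_ ?_ e hse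
    · exact hg x hx (s 0) (hvt (hsv 0)) _ (hv.inter Set.ordConnected_Iio) fun y hy =>
        Set.mem_uIcc.2 (Or.inl ⟨hxv y hy.1, le_of_lt hy.2⟩)
    · intro n
      exact hg _ (hvt (hsv n)) _ (hvt (hsv (n + 1))) _ Set.ordConnected_Ico fun y hy =>
        Set.mem_uIcc.2 (Or.inl ⟨hy.1, hy.2.le⟩)

theorem of_good_of_ge (H : ConvexInduction S l Q) {t : Set D}
    (hg : ∀ x ∈ t, ∀ y ∈ t, Good Q x y) {v : Set D} (hv : v.OrdConnected) (hvt : v ⊆ t) {x : D}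
    (hx : x ∈ t) (hxv : ∀ y ∈ v, y ≤ x) : Q v := by
  by_cases hb : ∃ z ∈ t, ∀ y ∈ v, z ≤ y
  · obtain ⟨z, hz, hb⟩ := hb
    exact hg z hz x hx v hv fun y hy => Set.mem_uIcc.2 (Or.inl ⟨hb y hy, hxv y hy⟩)
  · push Not at hb
    obtain ⟨y, hy, -⟩ := hb x hx
    obtain ⟨s, e, hs, hsv, hcof, hse⟩ := exists_cofinal_seq_const (D := Dᵒᵈ)
      (fun a b => S.val l (Set.Ioc (OrderDual.ofDual b) (OrderDual.ofDual a)))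
      (v := OrderDual.ofDual ⁻¹' v) ⟨OrderDual.toDual y, hy⟩ (fun z hz => hb z (hvt hz))
    refine H.omegaRev v hv (fun n => OrderDual.ofDual (s n)) (fun m n h => hs h) hsv hcof ?_ ?_ e
      hse
    · exact hg (OrderDual.ofDual (s 0)) (hvt (hsv 0)) x hx _ (hv.inter Set.ordConnected_Ioi)
        fun y hy => Set.mem_uIcc.2 (Or.inl ⟨le_of_lt hy.2, hxv y hy.1⟩)
    · intro n
      exact hg _ (hvt (hsv (n + 1))) _ (hvt (hsv n)) _ Set.ordConnected_Ioc fun y hy =>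
        Set.mem_uIcc.2 (Or.inl ⟨hy.1.le, hy.2⟩)

theorem of_good (H : ConvexInduction S l Q) {t : Set D} (ht : t.OrdConnected)
    (hg : ∀ x ∈ t, ∀ y ∈ t, Good Q x y) : Q t := by
  rcases t.eq_empty_or_nonempty with rfl | ⟨x, hx⟩
  · exact H.empty
  have h3 : t ∩ Set.Iio x ∪ t ∩ Set.Ici x = t := by
    rw [← Set.inter_union_distrib_left, Set.Iio_union_Ici, Set.inter_univ]
  rw [← h3]
  exact H.union _ _ (ht.inter Set.ordConnected_Iio) (ht.inter Set.ordConnected_Ici)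
    (by rw [h3]; exact ht)
    (fun a ha b hb => lt_of_lt_of_le ha.2 hb.2)
    (H.of_good_of_ge hg (ht.inter Set.ordConnected_Iio) Set.inter_subset_left hx
      fun y hy => le_of_lt hy.2)
    (H.of_good_of_le hg (ht.inter Set.ordConnected_Ici) Set.inter_subset_left hx
      fun y hy => hy.2)

section condensation

variable {I : Type} [LinearOrder I] {f : D → I}

theorem lt_of_map_lt (hf : Monotone f) {x y : D} (h : f x < f y) : x < y :=
  lt_of_not_ge fun h' => not_le_of_gt h (hf h')

theorem fiber_property (H : ConvexInduction S l Q)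
    (hfg : ∀ x y, f x = f y ↔ Good Q x y) {t : Set D} (ht : t.OrdConnected)
    (h : ∀ x ∈ t, ∀ y ∈ t, f x = f y) : Q t :=
  H.of_good ht fun x hx y hy => (hfg x y).1 (h x hx y hy)

/-- Two adjacent classes would merge: a convex set between a point of one and a point of the other
is the union of a part of each class. -/
theorem exists_between_condensation (H : ConvexInduction S l Q) (hf : Monotone f)
    (hs : Function.Surjective f) (hfg : ∀ x y, f x = f y ↔ Good Q x y) (i j : I) (hij : i < j) :
    ∃ k, i < k ∧ k < j := by
  by_contra hno
  push Not at hno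
  obtain ⟨x, rfl⟩ := hs i
  obtain ⟨y, rfl⟩ := hs j
  refine hij.ne ((hfg x y).2 fun t ht hsub => ?_)
  rw [Set.uIcc_of_le (lt_of_map_lt hf hij).le] at hsub
  have h3 : t ∩ f ⁻¹' {f x} ∪ t ∩ f ⁻¹' {f y} = t := by
    rw [← Set.inter_union_distrib_left, Set.inter_eq_left]
    intro z hz
    have h1 : f x ≤ f z := hf (hsub hz).1
    have h2 : f z ≤ f y := hf (hsub hz).2
    rcases h1.lt_or_eq with h | h
    · exact Or.inr (le_antisymm h2 (hno _ h))
    · exact Or.inl h.symm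
  have hc : ∀ i, (t ∩ f ⁻¹' {i}).OrdConnected := fun i =>
    ht.inter (Set.ordConnected_singleton.preimage_mono hf)
  rw [← h3]
  refine H.union _ _ (hc _) (hc _) (by rw [h3]; exact ht) ?_ ?_ ?_
  · intro a ha b hb
    refine lt_of_map_lt hf ?_
    rw [show f a = f x from ha.2, show f b = f y from hb.2]
    exact hij
  · exact H.fiber_property hfg (hc _) fun a ha b hb => ha.2.trans hb.2.symm
  · exact H.fiber_property hfg (hc _) fun a ha b hb => ha.2.trans hb.2.symm

/-- If the condensation is a shuffle between `i` and `j`, then `Q` holds for all convex sets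
in between. -/
theorem property_between [Countable I] (H : ConvexInduction S l Q) (hf : Monotone f)
    (hs : Function.Surjective f) (hfg : ∀ x y, f x = f y ↔ Good Q x y) {i j : I} {P : Set M}
    (hP : DenseOn P (fun i => S.val l (f ⁻¹' {i})) (Set.Ioo i j)) {t : Set D}
    (ht : t.OrdConnected) (htij : t ⊆ f ⁻¹' Set.Ioo i j) : Q t := by
  have hdense := H.exists_between_condensation hf hs hfg
  -- The set `t` is cut into the part `t0` in its lowest class, the part `t2` in its highest class,
  -- if these exist and differ, and the rest `t1`. Only `t0` and `t2` can be incomplete parts of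
  -- classes, and `t1` is a union of full classes to which `shuffle` applies.
  let t0 : Set D := {w | w ∈ t ∧ ∀ a ∈ t, f w ≤ f a}
  let t12 : Set D := {w | w ∈ t ∧ ∃ a ∈ t, f a < f w}
  let t1 : Set D := {w | w ∈ t ∧ (∃ a ∈ t, f a < f w) ∧ ∃ b ∈ t, f w < f b}
  let t2 : Set D := {w | w ∈ t ∧ (∃ a ∈ t, f a < f w) ∧ ∀ b ∈ t, f b ≤ f w}
  let J : Set I := {k | (∃ a ∈ t, f a < k) ∧ ∃ b ∈ t, k < f b}
  have h1J : t1 = f ⁻¹' J := by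
    ext w
    refine ⟨fun h => h.2, fun h => ⟨?_, h⟩⟩
    obtain ⟨⟨a, ha, haw⟩, b, hb, hwb⟩ := h
    exact ht.out ha hb ⟨(lt_of_map_lt hf haw).le, (lt_of_map_lt hf hwb).le⟩
  have hJc : J.OrdConnected := by
    refine ⟨fun x hx y hy z hz => ⟨?_, ?_⟩⟩
    · obtain ⟨a, ha, h⟩ := hx.1
      exact ⟨a, ha, h.trans_le hz.1⟩
    · obtain ⟨b, hb, h⟩ := hy.2
      exact ⟨b, hb, hz.2.trans_lt h⟩
  have hJij : J ⊆ Set.Ioo i j := by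
    rintro k ⟨⟨a, ha, hak⟩, b, hb, hkb⟩
    exact ⟨(htij ha).1.trans hak, hkb.trans (htij hb).2⟩
  have hQ1 : Q t1 := by
    rw [h1J]
    rcases J.eq_empty_or_nonempty with hJ | hJ
    · rw [hJ, Set.preimage_empty]; exact H.empty
    refine H.shuffle I f hf hs J hJc ⟨hJ, ?_, ?_⟩ P (hP.mono hJc hJij) ?_
    · rintro k ⟨⟨a, ha, hak⟩, b, hb, hkb⟩
      obtain ⟨k', h1, h2⟩ := hdense _ _ hak
      exact ⟨k', ⟨⟨a, ha, h1⟩, b, hb, h2.trans hkb⟩, h2⟩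
    · rintro k ⟨⟨a, ha, hak⟩, b, hb, hkb⟩
      obtain ⟨k', h1, h2⟩ := hdense _ _ hkb
      exact ⟨k', ⟨⟨a, ha, hak.trans h1⟩, b, hb, h2⟩, h1⟩
    · intro k _
      exact H.fiber_property hfg (Set.ordConnected_singleton.preimage_mono hf)
        fun a ha b hb => Eq.trans ha (Eq.symm hb)
  have ht0 : t0.OrdConnected := ⟨fun x hx y hy z hz =>
    ⟨ht.out hx.1 hy.1 hz, fun a ha => (hf hz.2).trans (hy.2 a ha)⟩⟩
  have ht2 : t2.OrdConnected := by
    refine ⟨fun x hx y hy z hz => ⟨ht.out hx.1 hy.1 hz, ?_, ?_⟩⟩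
    · obtain ⟨a, ha, h⟩ := hx.2.1
      exact ⟨a, ha, h.trans_le (hf hz.1)⟩
    · exact fun b hb => (hx.2.2 b hb).trans (hf hz.1)
  have ht12 : t12.OrdConnected := by
    refine ⟨fun x hx y hy z hz => ⟨ht.out hx.1 hy.1 hz, ?_⟩⟩
    obtain ⟨a, ha, h⟩ := hx.2
    exact ⟨a, ha, h.trans_le (hf hz.1)⟩
  have e12 : t1 ∪ t2 = t12 := by
    ext w
    constructor
    · rintro (h | h)
      · exact ⟨h.1, h.2.1⟩
      · exact ⟨h.1, h.2.1⟩
    · intro h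
      by_cases hb : ∃ b ∈ t, f w < f b
      · exact Or.inl ⟨h.1, h.2, hb⟩
      · push Not at hb
        exact Or.inr ⟨h.1, h.2, hb⟩
  have e0 : t0 ∪ t12 = t := by
    ext w
    constructor
    · rintro (h | h)
      · exact h.1
      · exact h.1
    · intro h
      by_cases hb : ∃ b ∈ t, f b < f w
      · exact Or.inr ⟨h, hb⟩
      · push Not at hb
        exact Or.inl ⟨h, hb⟩
  have hQ0 : Q t0 := H.fiber_property hfg ht0 fun x hx y hy =>
    le_antisymm (hx.2 y hy.1) (hy.2 x hx.1)
  have hQ2 : Q t2 := H.fiber_property hfg ht2 fun x hx y hy =>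
    le_antisymm (hy.2.2 x hx.1) (hx.2.2 y hy.1)
  have hQ12 : Q t12 := by
    rw [← e12]
    refine H.union _ _ (h1J ▸ hJc.preimage_mono hf) ht2 (e12 ▸ ht12) ?_ hQ1 hQ2
    intro x hx y hy
    obtain ⟨b, hb, hxb⟩ := hx.2.2
    exact lt_of_map_lt hf (hxb.trans_le (hy.2.2 b hb))
  rw [← e0]
  refine H.union _ _ ht0 ht12 (e0 ▸ ht) ?_ hQ0 hQ12
  intro x hx y hy
  obtain ⟨a, ha, hay⟩ := hy.2
  exact lt_of_map_lt hf ((hx.2 a ha).trans_lt hay)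

end condensation

/-- Between some two elements of a dense order coloured by a finite set, all occurring colours are
dense. -/
theorem exists_denseOn_Ioo {I : Type} [LinearOrder I] (g : I → M) {i j : I} (hij : i < j) :
    ∃ i j : I, i < j ∧ DenseOn (g '' Set.Ioo i j) g (Set.Ioo i j) := by
  -- An interval with the least number of colours: each of its subintervals shows all of them.
  obtain ⟨p, hp, hmin⟩ := WellFounded.has_min
    (measure fun p : I × I => (g '' Set.Ioo p.1 p.2).ncard).wf {p | p.1 < p.2} ⟨(i, j), hij⟩
  refine ⟨p.1, p.2, hp, fun x hx => ⟨x, hx, rfl⟩, fun a ha x hx y hy hxy => ?_⟩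
  have hsub : g '' Set.Ioo x y ⊆ g '' Set.Ioo p.1 p.2 :=
    Set.image_mono (Set.Ioo_subset_Ioo hx.1.le hy.2.le)
  have heq := Set.eq_of_subset_of_ncard_le hsub (not_lt.1 (hmin (x, y) hxy)) (Set.toFinite _)
  rw [← heq] at ha
  obtain ⟨z, hz, rfl⟩ := ha
  exact ⟨z, ⟨hx.1.trans hz.1, hz.2.trans hy.2⟩, hz.1, hz.2, rfl⟩

/-- If there were two classes, some interval of classes would be a shuffle of their values, and
`property_between` would identify two distinct classes inside it. -/
theorem property_univ (H : ConvexInduction S l Q) : Q Set.univ := by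
  obtain ⟨I, _, _, f, hf, hs, hfg⟩ := H.exists_condensation
  by_cases hI : ∃ i j : I, i < j
  · exfalso
    obtain ⟨i, j, hij⟩ := hI
    obtain ⟨i, j, hij, hP⟩ := exists_denseOn_Ioo (fun i => S.val l (f ⁻¹' {i})) hij
    have hdense := H.exists_between_condensation hf hs hfg
    obtain ⟨k, hik, hkj⟩ := hdense i j hij
    obtain ⟨k', hkk, hkj'⟩ := hdense k j hkj
    obtain ⟨x, rfl⟩ := hs k
    obtain ⟨y, rfl⟩ := hs k'
    refine hkk.ne ((hfg x y).2 fun t ht hsub => H.property_between hf hs hfg hP ht ?_)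
    rw [Set.uIcc_of_le (lt_of_map_lt hf hkk).le] at hsub
    exact fun z hz => ⟨hik.trans_le (hf (hsub hz).1), (hf (hsub hz).2).trans_lt hkj'⟩
  · push Not at hI
    exact H.fiber_property hfg Set.ordConnected_univ fun x _ y _ =>
      le_antisymm (hI _ _) (hI _ _)

end ConvexInduction

end CountableWords

/-! ### Products along cofinal sequences. -/

namespace CountableWords

universe u v

namespace OMonoid

variable {M : Type u} (S : OMonoid M)

section sequences

variable {D : Type} [LinearOrder D] [Countable D]

theorem val_eq_op_val (l : D → M) (s : Set D) :
    S.val l s = S.op.val (fun x : Dᵒᵈ => l (OrderDual.ofDual x)) (OrderDual.ofDual ⁻¹' s) := by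
  rw [op_val]
  exact S.π_iso _ _ ⟨⟨⟨fun x => ⟨OrderDual.toDual (OrderDual.toDual x.1), x.2⟩,
    fun x => ⟨OrderDual.ofDual (OrderDual.ofDual x.1), x.2⟩, fun _ => rfl, fun _ => rfl⟩, Iff.rfl⟩,
    fun _ => rfl⟩

/-- Evaluation of a part of a word cut by a cofinal sequence into blocks of equal value. -/
theorem val_omega (l : D → M) {s : Set D} (hs : s.OrdConnected) {x : ℕ → D} (hx : StrictMono x)
    (hxs : ∀ n, x n ∈ s) (hcof : ∀ y ∈ s, ∃ n, y < x n) {e : M}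
    (he : ∀ n, S.val l (Set.Ico (x n) (x (n + 1))) = e) :
    S.val l s = S.mul (S.val l (s ∩ Set.Iio (x 0))) (S.tau e) := by
  have h3 : s ∩ Set.Iio (x 0) ∪ s ∩ Set.Ici (x 0) = s := by
    rw [← Set.inter_union_distrib_left, Set.Iio_union_Ici, Set.inter_univ]
  have h4 : S.val l (s ∩ Set.Ici (x 0)) = S.tau e := by
    have hne : ∀ y ∈ s, {n | y < x (n + 1)}.Nonempty := fun y hy => by
      obtain ⟨n, hn⟩ := hcof y hy
      exact ⟨n, hn.trans (hx (Nat.lt_succ_self n))⟩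
    -- A position from `x 0` on is sent to the number `n` of the block from `x n` to `x (n + 1)`
    -- that contains it.
    refine S.val_eq_tau l _ (fun y => sInf {n | y < x (n + 1)}) ?_ e fun n => ?_
    · intro y hy z hz hyz
      exact Nat.sInf_le (lt_of_le_of_lt hyz (Nat.sInf_mem (hne z hz.1)))
    · rw [← he n]
      congr 1
      ext y
      constructor
      · rintro ⟨⟨hys, hy0⟩, rfl⟩
        refine ⟨?_, Nat.sInf_mem (hne y hys)⟩
        change x (sInf {n | y < x (n + 1)}) ≤ y
        rcases Nat.eq_zero_or_pos (sInf {n | y < x (n + 1)}) with h0 | h0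
        · rw [h0]; exact hy0
        · have := Nat.notMem_of_lt_sInf (Nat.sub_lt h0 one_pos)
          rw [Set.mem_ofPred_eq, Nat.sub_one_add_one h0.ne', not_lt] at this
          exact this
      · rintro ⟨h1, h2⟩
        have hys : y ∈ s := hs.out (hxs n) (hxs (n + 1)) ⟨h1, h2.le⟩
        refine ⟨⟨hys, (hx.monotone (Nat.zero_le n)).trans h1⟩, ?_⟩
        refine le_antisymm (Nat.sInf_le h2) (le_of_not_gt fun hlt => ?_)
        have h := Nat.sInf_mem (hne y hys)
        exact absurd (lt_of_le_of_lt h1 h) (not_lt.2 (hx.monotone hlt))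
  rw [← h4, ← val_union, h3]
  exact fun a ha b hb => lt_of_lt_of_le ha.2 hb.2

theorem val_omegaRev (l : D → M) {s : Set D} (hs : s.OrdConnected) {x : ℕ → D} (hx : StrictAnti x)
    (hxs : ∀ n, x n ∈ s) (hcof : ∀ y ∈ s, ∃ n, x n < y) {e : M}
    (he : ∀ n, S.val l (Set.Ioc (x (n + 1)) (x n)) = e) :
    S.val l s = S.mul (S.tauRev e) (S.val l (s ∩ Set.Ioi (x 0))) := by
  rw [val_eq_op_val, val_eq_op_val S l (s ∩ _), ← op_tau, ← op_mul]
  refine S.op.val_omega _ hs.dual (x := fun n => OrderDual.toDual (x n)) (fun m n h => hx h) hxs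
    hcof fun n => ?_
  rw [← he n, val_eq_op_val]
  congr 1
  ext y
  exact and_comm

end sequences

/-! ### Generation and uniqueness -/

/-- A set closed under the induced operations contains all products of its elements. -/
theorem π_mem_of_closed [Finite M] {X : Set M} (h1 : S.one ∈ X)
    (hmul : ∀ a ∈ X, ∀ b ∈ X, S.mul a b ∈ X) (htau : ∀ a ∈ X, S.tau a ∈ X)
    (htauRev : ∀ a ∈ X, S.tauRev a ∈ X) (hkappa : ∀ P ⊆ X, P.Nonempty → S.kappa P ∈ X)
    {w : CWord M} (hw : ∀ x, w.label x ∈ X) : S.π w ∈ X := by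
  rw [π_eq_val]
  refine ConvexInduction.property_univ (S := S) (l := w.label)
    (Q := fun s => S.val w.label s ∈ X) ⟨?_, ?_, ?_, ?_, ?_, ?_⟩
  · rw [val_empty]; exact h1
  · intro x; rw [val_singleton]; exact hw x
  · intro s t _ _ _ hst hs ht
    rw [S.val_union _ hst]
    exact hmul _ hs _ ht
  · intro s hs x hx hxs hcof h0 hn e he
    rw [S.val_omega _ hs hx hxs hcof he]
    exact hmul _ h0 _ (htau _ (he 0 ▸ hn 0))
  · intro s hs x hx hxs hcof h0 hn e he
    rw [S.val_omegaRev _ hs hx hxs hcof he]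
    exact hmul _ (htauRev _ (he 0 ▸ hn 0)) _ h0
  · intro I _ _ f hf hsurj J hJ hJe P hP hQ
    rw [val_preimage S _ f hf, S.val_eq_kappa hP hJe]
    obtain ⟨w', hw'⟩ : ∃ w : CWord M, w.IsShuffle P := ⟨_, hP.isShuffle hJe⟩
    refine hkappa P (fun a ha => ?_) hw'.nonempty
    obtain ⟨i, hi⟩ := hJe.1
    obtain ⟨j, hj, hij⟩ := hJe.2.2 i hi
    obtain ⟨z, hz, -, -, rfl⟩ := hP.2 a ha i hi j hj hij
    exact hQ z hz

section prod

variable {N : Type v} (T : OMonoid N)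

theorem prod_val {D : Type} [LinearOrder D] [Countable D] (l : D → M × N) (s : Set D) :
    (S.prod T).val l s = (S.val (fun x => (l x).1) s, T.val (fun x => (l x).2) s) := rfl

theorem prod_one : (S.prod T).one = (S.one, T.one) := by
  rw [← val_empty _ (fun _ : ℕ => (S.one, T.one)), prod_val, val_empty, val_empty]

theorem prod_mul (a b : M × N) : (S.prod T).mul a b = (S.mul a.1 b.1, T.mul a.2 b.2) := by
  let l : ℕ → M × N := fun n => if n = 0 then a else b
  have h : (S.prod T).val l ({0} ∪ {1}) = (S.prod T).mul a b := by
    rw [val_union, val_singleton, val_singleton] <;> simp [l]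
  rw [← h, prod_val, val_union, val_union]
  · simp only [val_singleton]; rfl
  · simp
  · simp

theorem _root_.CountableWords.CWord.IsShuffle.map {A : Type u} {B : Type v} {P : Set A}
    {w : CWord A} (h : w.IsShuffle P) (f : A → B) : (w.map f).IsShuffle (f '' P) := by
  refine ⟨h.1, fun x => ⟨_, h.2.1 x, rfl⟩, ?_⟩
  rintro _ ⟨a, ha, rfl⟩ x y hxy
  obtain ⟨z, h1, h2, rfl⟩ := h.2.2 a ha x y hxy
  exact ⟨z, h1, h2, rfl⟩

theorem prod_kappa [Countable M] [Countable N] {P : Set (M × N)} (hP : P.Nonempty) :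
    (S.prod T).kappa P = (S.kappa (Prod.fst '' P), T.kappa (Prod.snd '' P)) := by
  obtain ⟨w, hw⟩ := CWord.exists_isShuffle hP P.to_countable
  rw [kappa_eq_π _ hw, kappa_eq_π _ (hw.map Prod.fst), kappa_eq_π _ (hw.map Prod.snd)]
  rfl

end prod

/-- A ⊛-monoid on a finite set is determined by the operations that it induces. -/
theorem eq_of_induces [Finite M] {T : OMonoid M} (h : T.Induces S.alg) : T = S := by
  obtain ⟨h1, hmul, htau, htauRev, hkappa⟩ := h
  refine π_ext fun w => ?_
  -- The diagonal is closed under the operations of the product because both factors induce the same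
  -- ones. Hence the word with equal components has a value with equal components.
  have key : (T.prod S).π (w.map fun a => (a, a)) ∈ Set.range fun a : M => (a, a) := by
    refine π_mem_of_closed _ ?_ ?_ ?_ ?_ ?_ ?_
    · rw [prod_one]
      exact ⟨S.one, Prod.ext h1 rfl⟩
    · rintro _ ⟨a, rfl⟩ _ ⟨b, rfl⟩
      rw [prod_mul]
      exact ⟨S.mul a b, Prod.ext (hmul a b) rfl⟩
    · rintro _ ⟨a, rfl⟩
      exact ⟨S.tau a, Prod.ext (htau a) rfl⟩
    · rintro _ ⟨a, rfl⟩
      exact ⟨S.tauRev a, Prod.ext (htauRev a) rfl⟩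
    · intro P hP hne
      rw [prod_kappa _ _ hne]
      have : Prod.fst '' P = Prod.snd '' P := Set.image_congr fun p hp => by
        obtain ⟨a, rfl⟩ := hP hp
        rfl
      obtain ⟨w, hw⟩ := CWord.exists_isShuffle (hne.image Prod.snd) (Prod.snd '' P).to_countable
      rw [this, T.kappa_eq_π hw]
      exact ⟨S.kappa (Prod.snd '' P), Prod.ext (hkappa _ (hne.image _) w hw) rfl⟩
    · exact fun x => ⟨w.label x, rfl⟩
  obtain ⟨a, ha⟩ := key
  exact (congrArg Prod.fst ha).symm.trans (congrArg Prod.snd ha)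

end OMonoid

end CountableWords

namespace CountableWords

universe u v

namespace OMonoid

variable {M : Type u} (S : OMonoid M)

/-! ### The operations of the powerset -/

theorem mem_pow_val {D : Type} [LinearOrder D] [Countable D] (L : D → Set M) (s : Set D) (m : M) :
    m ∈ S.pow.val L s ↔ ∃ l : D → M, (∀ x ∈ s, l x ∈ L x) ∧ S.val l s = m := by
  classical
  constructor
  · rintro ⟨l, hl, rfl⟩
    let l' : D → M := fun x => if h : x ∈ s then l ⟨x, h⟩ else S.one
    have hl' : ∀ x : s, l' x = l x := fun x => dif_pos x.2
    refine ⟨l', fun x hx => ?_, S.π_iso _ _ ⟨OrderIso.refl s, fun x => (hl' x).symm⟩⟩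
    exact Set.mem_of_eq_of_mem (hl' ⟨x, hx⟩) (hl ⟨x, hx⟩)
  · rintro ⟨l, hl, rfl⟩
    exact ⟨fun x => l x.1, fun x => hl x.1 x.2, rfl⟩

theorem pow_one : S.pow.one = {S.one} := by
  ext m
  rw [← val_empty _ (fun _ : ℕ => (∅ : Set M)), mem_pow_val, Set.mem_singleton_iff]
  constructor
  · rintro ⟨l, -, rfl⟩
    exact S.val_empty l
  · rintro rfl
    exact ⟨fun _ => S.one, fun x hx => hx.elim, S.val_empty _⟩

theorem mem_pow_mul (A B : Set M) (m : M) :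
    m ∈ S.pow.mul A B ↔ ∃ a ∈ A, ∃ b ∈ B, S.mul a b = m := by
  let L : ℕ → Set M := fun n => if n = 0 then A else B
  have h : S.pow.val L ({0} ∪ {1}) = S.pow.mul A B := by
    rw [val_union, val_singleton, val_singleton] <;> simp [L]
  rw [← h, mem_pow_val]
  constructor
  · rintro ⟨l, hl, rfl⟩
    refine ⟨l 0, hl 0 (by simp), l 1, hl 1 (by simp), ?_⟩
    rw [val_union, val_singleton, val_singleton]
    simp
  · rintro ⟨a, ha, b, hb, rfl⟩
    refine ⟨fun n => if n = 0 then a else b, ?_, ?_⟩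
    · rintro x (rfl | rfl)
      · simpa [L] using ha
      · simpa [L] using hb
    · rw [val_union, val_singleton, val_singleton] <;> simp

theorem mem_pow_tau_iff (A : Set M) (m : M) :
    m ∈ S.pow.tau A ↔ ∃ l : ℕ → M, (∀ n, l n ∈ A) ∧ S.val l Set.univ = m := by
  rw [← val_nat, mem_pow_val]
  simp

theorem op_pow : S.op.pow = S.pow.op :=
  π_ext fun _ => Set.ext fun _ => Iff.rfl

/-- The subsemigroup generated by `A`. -/
def gen (A : Set M) : Set M := {m | ∃ n, m ∈ powSucc S.pow.mul A n}

/-- Being an intersection over all subsets, this form can be tested on a finite carrier by a bounded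
search, without a bound on the exponent. -/
theorem mem_gen_iff (A : Set M) (m : M) :
    m ∈ S.gen A ↔ ∀ C : Set M, (∀ a ∈ A, a ∈ C ∧ ∀ c ∈ C, S.mul c a ∈ C) → m ∈ C := by
  constructor
  · rintro ⟨n, hn⟩ C hC
    induction n generalizing m with
    | zero => exact (hC m hn).1
    | succ n ih =>
      rw [powSucc, mem_pow_mul] at hn
      obtain ⟨x, hx, a, ha, rfl⟩ := hn
      exact (hC a ha).2 x (ih x hx)
  · intro h
    refine h (S.gen A) fun a ha => ⟨⟨0, ha⟩, ?_⟩
    rintro c ⟨n, hn⟩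
    exact ⟨n + 1, (S.mem_pow_mul _ _ _).2 ⟨c, hn, a, ha, rfl⟩⟩

theorem op_gen (A : Set M) : S.op.gen A = S.gen A := by
  have : S.op.pow.mul = fun x y => S.pow.mul y x := by
    funext x y
    rw [op_pow, op_mul]
  simp only [gen, this, powSucc_swap]

theorem val_Ico_mem_gen {A : Set M} {l : ℕ → M} (hl : ∀ n, l n ∈ A) {i j : ℕ} (hij : i < j) :
    S.val l (Set.Ico i j) ∈ S.gen A := by
  obtain ⟨n, rfl⟩ := Nat.exists_eq_add_of_lt hij
  refine ⟨n, ?_⟩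
  rw [← val_Ico_const, mem_pow_val]
  exact ⟨l, fun x _ => hl x, rfl⟩

variable [Finite M]

/-- By Ramsey, an `ω`-word of letters from `A` is a prefix followed by blocks of one value `e`.
Conversely, `e^τ` belongs to the `τ` of a power of `A`, which is the `τ` of `A`, and this absorbs
powers of `A` on the left. -/
theorem mem_pow_tau (A : Set M) (m : M) :
    m ∈ S.pow.tau A ↔ ∃ s ∈ S.gen A, ∃ e ∈ S.gen A, S.mul s (S.tau e) = m := by
  constructor
  · rw [mem_pow_tau_iff]
    rintro ⟨l, hl, rfl⟩
    obtain ⟨x, e, hx, hxv, hcof, he⟩ := exists_cofinal_seq_const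
      (fun a b : ℕ => S.val l (Set.Ico a b)) Set.univ_nonempty
      (fun x _ => ⟨x + 1, trivial, Nat.lt_succ_self x⟩)
    -- The prefix ends at `x 1` and not at `x 0`, which may be `0`: it must be nonempty to belong to
    -- `gen`.
    refine ⟨S.val l (Set.Ico 0 (x 1)), S.val_Ico_mem_gen hl (Nat.zero_lt_of_lt (hx one_pos)),
      e, he 0 ▸ S.val_Ico_mem_gen hl (hx one_pos), ?_⟩
    have hset : Set.univ ∩ Set.Iio (x 1) = Set.Ico 0 (x 1) := by ext; simp
    rw [S.val_omega l Set.ordConnected_univ (x := fun n => x (n + 1))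
      (fun a b h => hx (Nat.succ_lt_succ h)) (fun _ => trivial) ?_ (e := e) fun n => he (n + 1),
      hset]
    intro y hy
    obtain ⟨n, hn⟩ := hcof y hy
    exact ⟨n, hn.trans (hx (Nat.lt_succ_self n))⟩
  · rintro ⟨s, ⟨i, hs⟩, e, ⟨j, he⟩, rfl⟩
    have hτ : S.tau e ∈ S.pow.tau A := by
      rw [← S.pow.tau_pow' A j, mem_pow_tau_iff]
      exact ⟨fun _ => e, fun _ => he, S.val_nat e⟩
    have hA : S.pow.mul A (S.pow.tau A) = S.pow.tau A := by
      have := S.pow.tau_mul' A S.pow.one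
      rw [mul_one', one_mul'] at this
      exact this.symm
    have habs : S.pow.mul (powSucc S.pow.mul A i) (S.pow.tau A) = S.pow.tau A := by
      clear hs
      induction i with
      | zero => exact hA
      | succ i ih => rw [powSucc, ← mul_assoc', hA, ih]
    rw [← habs, mem_pow_mul]
    exact ⟨s, hs, _, hτ, rfl⟩

theorem mem_pow_tauRev (A : Set M) (m : M) :
    m ∈ S.pow.tauRev A ↔ ∃ s ∈ S.gen A, ∃ e ∈ S.gen A, S.mul (S.tauRev e) s = m := by
  rw [← op_tau, ← op_pow, mem_pow_tau, op_gen]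
  simp only [op_mul, op_tau]

/-- The products `a x b` with `x` in `C` and `a`, `b` in `U` or absent. -/
def ext (U C : Set M) : Set M :=
  {q | ∃ a, (a ∈ U ∨ a = S.one) ∧ ∃ x ∈ C, ∃ b, (b ∈ U ∨ b = S.one) ∧ S.mul (S.mul a x) b = q}

/-- The closure properties of which the `κ`-value of `P` in the powerset is the least solution. -/
structure ShuffleClosed (P : Set (Set M)) (C : Set M) : Prop where
  base : ∀ Q : Set M, Q ⊆ ⋃₀ P → (∀ A ∈ P, (A ∩ Q).Nonempty) → S.kappa Q ∈ C
  mul : ∀ x ∈ C, ∀ y ∈ C, S.mul x y ∈ C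
  mul_mul : ∀ x ∈ C, ∀ a ∈ ⋃₀ P, ∀ y ∈ C, S.mul (S.mul x a) y ∈ C
  tau : ∀ x ∈ C, ∀ a ∈ ⋃₀ P, S.tau (S.mul x a) ∈ C
  tauRev : ∀ x ∈ C, ∀ a ∈ ⋃₀ P, S.tauRev (S.mul a x) ∈ C
  -- Unlike in `base`, `Q` need not meet every member of `P`: elements of `C` stand for products
  -- over pieces in which all members already occur.
  shuffle : ∀ Q : Set M, Q ⊆ ⋃₀ P ∪ S.ext (⋃₀ P) C → (Q ∩ S.ext (⋃₀ P) C).Nonempty →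
    S.kappa Q ∈ C

/-- A shuffle of the pairs `(A, a)` with `a ∈ A ∩ Q` projects to a shuffle of `P` and, on the same
positions, to a shuffle of `Q`. -/
theorem kappa_mem_pow_kappa {P : Set (Set M)} (hP : P.Nonempty) {Q : Set M} (hQ : Q ⊆ ⋃₀ P)
    (hPQ : ∀ A ∈ P, (A ∩ Q).Nonempty) : S.kappa Q ∈ S.pow.kappa P := by
  let T : Set (Set M × M) := {p | p.1 ∈ P ∧ p.2 ∈ p.1 ∧ p.2 ∈ Q}
  have h1 : Prod.fst '' T = P := by
    ext A
    constructor
    · rintro ⟨p, hp, rfl⟩; exact hp.1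
    · intro hA
      obtain ⟨a, ha⟩ := hPQ A hA
      exact ⟨(A, a), ⟨hA, ha.1, ha.2⟩, rfl⟩
  have h2 : Prod.snd '' T = Q := by
    ext a
    constructor
    · rintro ⟨p, hp, rfl⟩; exact hp.2.2
    · intro ha
      obtain ⟨A, hA, haA⟩ := hQ ha
      exact ⟨(A, a), ⟨hA, haA, ha⟩, rfl⟩
  have hT : T.Nonempty := by rw [← Set.image_nonempty (f := Prod.fst), h1]; exact hP
  obtain ⟨v, hv⟩ := CWord.exists_isShuffle hT T.to_countable
  have hv1 := hv.map Prod.fst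
  have hv2 := hv.map Prod.snd
  rw [h1] at hv1
  rw [h2] at hv2
  rw [S.kappa_eq_π hv2, S.pow.kappa_eq_π hv1]
  exact ⟨fun x => (v.label x).2, fun x => (hv.2.1 x).2.1, rfl⟩

/-- Each rule is read off from the identities of `κ` in the ⊛-algebra of the powerset. -/
theorem shuffleClosed_pow_kappa {P : Set (Set M)} (hP : P.Nonempty) :
    S.ShuffleClosed P (S.pow.kappa P) where
  base _ := S.kappa_mem_pow_kappa hP
  mul x hx y hy := by
    rw [S.pow.kappa_mul_kappa' hP, mem_pow_mul]
    exact ⟨x, hx, y, hy, rfl⟩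
  mul_mul x hx a ha y hy := by
    obtain ⟨A, hA, haA⟩ := ha
    rw [S.pow.kappa_mul_mul_kappa' hA, mem_pow_mul]
    exact ⟨_, (S.mem_pow_mul _ _ _).2 ⟨x, hx, a, haA, rfl⟩, y, hy, rfl⟩
  tau x hx a ha := by
    obtain ⟨A, hA, haA⟩ := ha
    rw [S.pow.kappa_mul_tau' hA, mem_pow_tau_iff]
    exact ⟨fun _ => S.mul x a, fun _ => (S.mem_pow_mul _ _ _).2 ⟨x, hx, a, haA, rfl⟩,
      S.val_nat _⟩
  tauRev x hx a ha := by
    obtain ⟨A, hA, haA⟩ := ha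
    rw [S.pow.mul_kappa_tauRev' hA, ← op_tau, ← op_tau, ← op_pow, mem_pow_tau_iff]
    exact ⟨fun _ => S.mul a x, fun _ => (S.mem_pow_mul _ _ _).2 ⟨a, haA, x, hx, rfl⟩,
      S.op.val_nat _⟩
  shuffle Q hQ hne := by
    let E : Set (Set M) := {B | B = S.pow.kappa P ∨ (∃ a ∈ P, B = S.pow.mul a (S.pow.kappa P)) ∨
      (∃ b ∈ P, B = S.pow.mul (S.pow.kappa P) b) ∨
      ∃ a ∈ P, ∃ b ∈ P, B = S.pow.mul (S.pow.mul a (S.pow.kappa P)) b}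
    have hext : ∀ q ∈ S.ext (⋃₀ P) (S.pow.kappa P), ∃ B ∈ E, q ∈ B := by
      rintro q ⟨a, ha, x, hx, b, hb, rfl⟩
      rcases ha with ⟨A, hA, ha⟩ | rfl <;> rcases hb with ⟨B, hB, hb⟩ | rfl
      · exact ⟨_, Or.inr (Or.inr (Or.inr ⟨A, hA, B, hB, rfl⟩)), (S.mem_pow_mul _ _ _).2
          ⟨_, (S.mem_pow_mul _ _ _).2 ⟨a, ha, x, hx, rfl⟩, b, hb, rfl⟩⟩
      · rw [mul_one']
        exact ⟨_, Or.inr (Or.inl ⟨A, hA, rfl⟩), (S.mem_pow_mul _ _ _).2 ⟨a, ha, x, hx, rfl⟩⟩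
      · rw [one_mul']
        exact ⟨_, Or.inr (Or.inr (Or.inl ⟨B, hB, rfl⟩)),
          (S.mem_pow_mul _ _ _).2 ⟨x, hx, b, hb, rfl⟩⟩
      · rw [one_mul', mul_one']
        exact ⟨_, Or.inl rfl, hx⟩
    obtain ⟨q, hq, hqe⟩ := hne
    obtain ⟨B, hB, hqB⟩ := hext q hqe
    have hE : {B | B ∈ E ∧ (B ∩ Q).Nonempty}.Nonempty := ⟨B, hB, q, hqB, hq⟩
    -- The union identity replaces `P` by those of its members and of the derived sets in `E` that
    -- meet `Q`, so that `kappa_mem_pow_kappa` applies.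
    rw [S.pow.kappa_union' hP (P' := {A | A ∈ P ∧ (A ∩ Q).Nonempty}) (fun A hA => hA.1) hE
      (fun B hB => hB.1)]
    refine S.kappa_mem_pow_kappa (hE.mono Set.subset_union_right) ?_ ?_
    · intro x hx
      rcases hQ hx with ⟨A, hA, hxA⟩ | h
      · exact ⟨A, Or.inl ⟨hA, x, hxA, hx⟩, hxA⟩
      · obtain ⟨B, hB, hxB⟩ := hext x h
        exact ⟨B, Or.inr ⟨hB, x, hxB, hx⟩, hxB⟩
    · rintro A (h | h)
      · exact h.2
      · exact h.2

end OMonoid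

/-! ### Labels at the ends of a convex set -/

section ends

variable {M : Type u} (S : OMonoid M) {D : Type} [LinearOrder D] (l : D → M)

/-- `a` is the label of the least element of `s` if there is one, and `1` otherwise. -/
def IsLeftLabel (s : Set D) (a : M) : Prop :=
  (∃ p, IsLeast s p ∧ a = l p) ∨ (∀ p, ¬ IsLeast s p) ∧ a = S.one

/-- `b` is the label of the greatest element of `s` if there is one, and `1` otherwise. -/
def IsRightLabel (s : Set D) (b : M) : Prop :=
  (∃ p, IsGreatest s p ∧ b = l p) ∨ (∀ p, ¬ IsGreatest s p) ∧ b = S.one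

variable {S l}

theorem isLeast_union_iff {s t : Set D} (hs : s.Nonempty) (h : ∀ x ∈ s, ∀ y ∈ t, x < y) (p : D) :
    IsLeast (s ∪ t) p ↔ IsLeast s p := by
  obtain ⟨x, hx⟩ := hs
  constructor
  · rintro ⟨hp | hp, hl⟩
    · exact ⟨hp, fun y hy => hl (Or.inl hy)⟩
    · exact absurd (h x hx p hp) (not_lt.2 (hl (Or.inl hx)))
  · rintro ⟨hp, hl⟩
    exact ⟨Or.inl hp, fun y hy => hy.elim (fun hy => hl hy) fun hy => (h p hp y hy).le⟩

theorem isGreatest_union_iff {s t : Set D} (ht : t.Nonempty) (h : ∀ x ∈ s, ∀ y ∈ t, x < y)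
    (p : D) : IsGreatest (s ∪ t) p ↔ IsGreatest t p := by
  obtain ⟨x, hx⟩ := ht
  constructor
  · rintro ⟨hp | hp, hl⟩
    · exact absurd (h p hp x hx) (not_lt.2 (hl (Or.inr hx)))
    · exact ⟨hp, fun y hy => hl (Or.inr hy)⟩
  · rintro ⟨hp, hl⟩
    exact ⟨Or.inr hp, fun y hy => hy.elim (fun hy => (h y hy p hp).le) fun hy => hl hy⟩

theorem IsLeftLabel.union {s t : Set D} {a : M} (ha : IsLeftLabel S l s a) (hs : s.Nonempty)
    (h : ∀ x ∈ s, ∀ y ∈ t, x < y) : IsLeftLabel S l (s ∪ t) a := by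
  simpa only [IsLeftLabel, isLeast_union_iff hs h] using ha

theorem IsRightLabel.union {s t : Set D} {a : M} (ha : IsRightLabel S l t a) (ht : t.Nonempty)
    (h : ∀ x ∈ s, ∀ y ∈ t, x < y) : IsRightLabel S l (s ∪ t) a := by
  simpa only [IsRightLabel, isGreatest_union_iff ht h] using ha

theorem IsLeftLabel.eq {s : Set D} {a : M} (ha : IsLeftLabel S l s a) {p : D} (hp : IsLeast s p) :
    a = l p := by
  rcases ha with ⟨q, hq, rfl⟩ | ⟨h, -⟩
  · rw [hq.unique hp]
  · exact absurd hp (h p)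

theorem IsLeftLabel.eq_one {s : Set D} {a : M} (ha : IsLeftLabel S l s a)
    (h : ∀ p, ¬ IsLeast s p) : a = S.one := by
  rcases ha with ⟨q, hq, -⟩ | ⟨-, h⟩
  · exact absurd hq (h q)
  · exact h

theorem IsRightLabel.eq {s : Set D} {a : M} (ha : IsRightLabel S l s a) {p : D}
    (hp : IsGreatest s p) : a = l p := by
  rcases ha with ⟨q, hq, rfl⟩ | ⟨h, -⟩
  · rw [hq.unique hp]
  · exact absurd hp (h p)

theorem IsRightLabel.eq_one {s : Set D} {a : M} (ha : IsRightLabel S l s a)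
    (h : ∀ p, ¬ IsGreatest s p) : a = S.one := by
  rcases ha with ⟨q, hq, -⟩ | ⟨-, h⟩
  · exact absurd hq (h q)
  · exact h

/-- In a dense order a cut has no two sides. -/
theorem not_isGreatest_isLeast [DenselyOrdered D] {s t : Set D} (hst : (s ∪ t).OrdConnected)
    (h : ∀ x ∈ s, ∀ y ∈ t, x < y) {p q : D} (hp : IsGreatest s p) (hq : IsLeast t q) : False := by
  obtain ⟨z, hz⟩ := exists_between (h p hp.1 q hq.1)
  rcases hst.out (Or.inl hp.1) (Or.inr hq.1) ⟨hz.1.le, hz.2.le⟩ with h | h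
  · exact absurd hz.1 (not_lt.2 (hp.2 h))
  · exact absurd hz.2 (not_lt.2 (hq.2 h))

end ends

/-! ### Minimality of the `κ`-value in the powerset. -/

namespace OMonoid.ShuffleClosed

variable {M : Type u} {S : OMonoid M} {P : Set (Set M)} {C : Set M}
  {D : Type} [LinearOrder D] [Countable D] {l : D → M}

variable (S C l) in
/-- The value of `s` is `a x b` with `x` in `C` and with `a`, `b` the labels at the ends. -/
def Inner (s : Set D) : Prop :=
  s.Nontrivial → ∃ a, IsLeftLabel S l s a ∧ ∃ x ∈ C, ∃ b, IsRightLabel S l s b ∧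
    S.val l s = S.mul (S.mul a x) b

/-- At a cut of a dense order at most one side has an end. Hence at most one letter stands between
the two middle factors, and `mul` or `mul_mul` keeps the result in `C`. Single positions have no
middle factor and are treated apart. -/
theorem inner_union (hC : S.ShuffleClosed P C) [DenselyOrdered D] (hl : ∀ x, l x ∈ ⋃₀ P)
    {s t : Set D} (hst : (s ∪ t).OrdConnected) (h : ∀ x ∈ s, ∀ y ∈ t, x < y)
    (hs : Inner S C l s) (ht : Inner S C l t) : Inner S C l (s ∪ t) := by
  rcases s.eq_empty_or_nonempty with rfl | hsne
  · rwa [Set.empty_union]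
  rcases t.eq_empty_or_nonempty with rfl | htne
  · rwa [Set.union_empty]
  intro _
  rw [S.val_union l h]
  rcases hsne.exists_eq_singleton_or_nontrivial with ⟨p, rfl⟩ | hs2
  · have hno : ∀ q, ¬ IsLeast t q := fun q hq =>
      not_isGreatest_isLeast hst h (isGreatest_singleton (a := p)) hq
    rcases htne.exists_eq_singleton_or_nontrivial with ⟨q, rfl⟩ | ht2
    · exact absurd isLeast_singleton (hno q)
    obtain ⟨a, ha, x, hx, b, hb, hv⟩ := ht ht2
    refine ⟨l p, Or.inl ⟨p, (isLeast_union_iff hsne h p).2 isLeast_singleton, rfl⟩, x, hx, b,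
      hb.union htne h, ?_⟩
    rw [hv, S.val_singleton, ha.eq_one hno, one_mul', mul_assoc']
  · obtain ⟨a, ha, x, hx, b, hb, hv⟩ := hs hs2
    rcases htne.exists_eq_singleton_or_nontrivial with ⟨q, rfl⟩ | ht2
    · have hno : ∀ p, ¬ IsGreatest s p := fun p hp =>
        not_isGreatest_isLeast hst h hp (isLeast_singleton (a := q))
      refine ⟨a, ha.union hsne h, x, hx, l q,
        Or.inl ⟨q, (isGreatest_union_iff htne h q).2 isGreatest_singleton, rfl⟩, ?_⟩
      rw [hv, S.val_singleton, hb.eq_one hno, mul_one']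
    · obtain ⟨a', ha', y, hy, b', hb', hv'⟩ := ht ht2
      have key : S.mul (S.mul (S.mul x b) a') y ∈ C := by
        rcases hb with ⟨p, hp, rfl⟩ | ⟨-, rfl⟩
        · rw [ha'.eq_one fun q hq => not_isGreatest_isLeast hst h hp hq, mul_one']
          exact hC.mul_mul x hx _ (hl p) y hy
        · rcases ha' with ⟨q, hq, rfl⟩ | ⟨-, rfl⟩
          · rw [mul_one']
            exact hC.mul_mul x hx _ (hl q) y hy
          · rw [mul_one', mul_one']
            exact hC.mul x hx y hy
      refine ⟨a, ha.union hsne h, _, key, b', hb'.union htne h, ?_⟩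
      rw [hv, hv']
      simp only [mul_assoc']

/-- A block has a first but no last position, so its value is `a y` with `a` a letter and `y ∈ C`.
The identity `(a y)^τ = a (y a)^τ` moves the letter to the front and leaves an element of `C` by the
rule `tau`. -/
theorem inner_omega (hC : S.ShuffleClosed P C) [DenselyOrdered D] (hl : ∀ x, l x ∈ ⋃₀ P)
    {s : Set D} (hs : s.OrdConnected) {x : ℕ → D} (hx : StrictMono x) (hxs : ∀ n, x n ∈ s)
    (hcof : ∀ y ∈ s, ∃ n, y < x n) (h0 : Inner S C l (s ∩ Set.Iio (x 0)))
    (hn : Inner S C l (Set.Ico (x 0) (x 1))) {e : M}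
    (he : ∀ n, S.val l (Set.Ico (x n) (x (n + 1))) = e) : Inner S C l s := by
  intro _
  have h01 : x 0 < x 1 := hx one_pos
  obtain ⟨z, hz⟩ := exists_between h01
  obtain ⟨a, ha, y, hy, b, hb, hv⟩ :=
    hn ⟨x 0, ⟨le_rfl, h01⟩, z, ⟨hz.1.le, hz.2⟩, hz.1.ne⟩
  have hb1 : b = S.one := hb.eq_one fun p hp => by
    obtain ⟨q, hq⟩ := exists_between hp.1.2
    exact absurd (hp.2 ⟨hp.1.1.trans hq.1.le, hq.2⟩) (not_le.2 hq.1)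
  have ha1 : a = l (x 0) := ha.eq ⟨⟨le_rfl, h01⟩, fun q hq => hq.1⟩
  have hτ : S.tau e = S.mul (l (x 0)) (S.tau (S.mul y (l (x 0)))) := by
    rw [← he 0, hv, hb1, mul_one', ha1, tau_mul']
  have hzC := hC.tau y hy _ (hl (x 0))
  have hright : IsRightLabel S l s S.one := Or.inr ⟨fun p hp => by
    obtain ⟨n, hn⟩ := hcof p hp.1
    exact absurd (hp.2 (hxs n)) (not_le.2 hn), rfl⟩
  rw [S.val_omega l hs hx hxs hcof he, hτ]
  rcases (s ∩ Set.Iio (x 0)).eq_empty_or_nonempty with hempty | hne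
  · refine ⟨l (x 0), Or.inl ⟨x 0, ⟨hxs 0, fun p hp => ?_⟩, rfl⟩, _, hzC, S.one, hright, ?_⟩
    · by_contra hlt
      exact Set.notMem_empty p (hempty ▸ ⟨hp, not_le.1 hlt⟩)
    · rw [hempty, val_empty, one_mul', mul_one']
  · have hbetween : ∀ p ∈ s ∩ Set.Iio (x 0), ∃ q ∈ s ∩ Set.Iio (x 0), p < q := by
      intro p hp
      obtain ⟨q, hq⟩ := exists_between (Set.mem_Iio.1 hp.2)
      exact ⟨q, ⟨hs.out hp.1 (hxs 0) ⟨hq.1.le, hq.2.le⟩, hq.2⟩, hq.1⟩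
    obtain ⟨p, hp⟩ := hne
    obtain ⟨q, hq, hpq⟩ := hbetween p hp
    obtain ⟨a', ha', x', hx', b', hb', hv'⟩ := h0 ⟨p, hp, q, hq, hpq.ne⟩
    have hb'1 : b' = S.one := hb'.eq_one fun p hp => by
      obtain ⟨q, hq, hpq⟩ := hbetween p hp.1
      exact absurd (hp.2 hq) (not_le.2 hpq)
    refine ⟨a', ?_, _, hC.mul_mul x' hx' _ (hl (x 0)) _ hzC, S.one, hright, ?_⟩
    · have := ha'.union ⟨p, hp⟩ (t := s ∩ Set.Ici (x 0)) fun a ha b hb => lt_of_lt_of_le ha.2 hb.2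
      rwa [← Set.inter_union_distrib_left, Set.Iio_union_Ici, Set.inter_univ] at this
    · rw [hv', hb'1]
      simp only [mul_assoc', mul_one']

theorem inner_omegaRev (hC : S.ShuffleClosed P C) [DenselyOrdered D] (hl : ∀ x, l x ∈ ⋃₀ P)
    {s : Set D} (hs : s.OrdConnected) {x : ℕ → D} (hx : StrictAnti x) (hxs : ∀ n, x n ∈ s)
    (hcof : ∀ y ∈ s, ∃ n, x n < y) (h0 : Inner S C l (s ∩ Set.Ioi (x 0)))
    (hn : Inner S C l (Set.Ioc (x 1) (x 0))) {e : M}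
    (he : ∀ n, S.val l (Set.Ioc (x (n + 1)) (x n)) = e) : Inner S C l s := by
  intro _
  have h01 : x 1 < x 0 := hx one_pos
  obtain ⟨z, hz⟩ := exists_between h01
  obtain ⟨a, ha, y, hy, b, hb, hv⟩ :=
    hn ⟨x 0, ⟨h01, le_rfl⟩, z, ⟨hz.1, hz.2.le⟩, hz.2.ne'⟩
  have ha1 : a = S.one := ha.eq_one fun p hp => by
    obtain ⟨q, hq⟩ := exists_between hp.1.1
    exact absurd (hp.2 ⟨hq.1, hq.2.le.trans hp.1.2⟩) (not_le.2 hq.2)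
  have hb1 : b = l (x 0) := hb.eq ⟨⟨h01, le_rfl⟩, fun q hq => hq.2⟩
  have hτ : S.tauRev e = S.mul (S.tauRev (S.mul (l (x 0)) y)) (l (x 0)) := by
    rw [← he 0, hv, ha1, one_mul', hb1, tauRev_mul']
  have hzC := hC.tauRev y hy _ (hl (x 0))
  have hleft : IsLeftLabel S l s S.one := Or.inr ⟨fun p hp => by
    obtain ⟨n, hn⟩ := hcof p hp.1
    exact absurd (hp.2 (hxs n)) (not_le.2 hn), rfl⟩
  rw [S.val_omegaRev l hs hx hxs hcof he, hτ]
  rcases (s ∩ Set.Ioi (x 0)).eq_empty_or_nonempty with hempty | hne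
  · refine ⟨S.one, hleft, _, hzC, l (x 0), Or.inl ⟨x 0, ⟨hxs 0, fun p hp => ?_⟩, rfl⟩, ?_⟩
    · by_contra hlt
      exact Set.notMem_empty p (hempty ▸ ⟨hp, not_le.1 hlt⟩)
    · rw [hempty, val_empty, one_mul', mul_one']
  · have hbetween : ∀ p ∈ s ∩ Set.Ioi (x 0), ∃ q ∈ s ∩ Set.Ioi (x 0), q < p := by
      intro p hp
      obtain ⟨q, hq⟩ := exists_between (Set.mem_Ioi.1 hp.2)
      exact ⟨q, ⟨hs.out (hxs 0) hp.1 ⟨hq.1.le, hq.2.le⟩, hq.1⟩, hq.2⟩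
    obtain ⟨p, hp⟩ := hne
    obtain ⟨q, hq, hpq⟩ := hbetween p hp
    obtain ⟨a', ha', x', hx', b', hb', hv'⟩ := h0 ⟨p, hp, q, hq, hpq.ne'⟩
    have ha'1 : a' = S.one := ha'.eq_one fun p hp => by
      obtain ⟨q, hq, hpq⟩ := hbetween p hp.1
      exact absurd (hp.2 hq) (not_le.2 hpq)
    refine ⟨S.one, hleft, _, hC.mul_mul _ hzC _ (hl (x 0)) x' hx', b', ?_, ?_⟩
    · have := hb'.union (s := s ∩ Set.Iic (x 0)) ⟨p, hp⟩ fun a ha b hb => lt_of_le_of_lt ha.2 hb.2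
      rwa [← Set.inter_union_distrib_left, Set.Iic_union_Ioi, Set.inter_univ] at this
    · rw [hv', ha'1]
      simp only [mul_assoc', one_mul']

theorem _root_.CountableWords.DenseOn.exists_of_mem {A : Type u} {I : Type} [LinearOrder I]
    {R : Set A} {g : I → A} {J : Set I} (h : DenseOn R g J) (hJ : NoEnds J) {a : A} (ha : a ∈ R) :
    ∃ i ∈ J, g i = a := by
  obtain ⟨i, hi⟩ := hJ.1
  obtain ⟨j, hj, hij⟩ := hJ.2.2 i hi
  obtain ⟨z, hz, -, -, h⟩ := h.2 a ha i hi j hj hij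
  exact ⟨z, hz, h⟩

/-- If the value of some fiber lies in `ext`, the rule `shuffle` applies. Otherwise all fibers over
`J` are single positions; then each member of `P`, being dense, contributes one of its letters to
`R`, and the rule `base` applies. -/
theorem inner_shuffle (hC : S.ShuffleClosed P C) {L : D → Set M} (hL : ∀ x, l x ∈ L x)
    (hP : DenseOn P L Set.univ) {I : Type} [LinearOrder I] [Countable I] {f : D → I}
    (hf : Monotone f) (hs : Function.Surjective f) {J : Set I} (hJ : J.OrdConnected)
    (hJe : NoEnds J) {R : Set M} (hR : DenseOn R (fun i => S.val l (f ⁻¹' {i})) J)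
    (hQ : ∀ i ∈ J, Inner S C l (f ⁻¹' {i})) : Inner S C l (f ⁻¹' J) := by
  intro _
  have hl : ∀ x, l x ∈ ⋃₀ P := fun x => ⟨L x, hP.1 x trivial, hL x⟩
  have hlt : ∀ {x y}, f x < f y → x < y := fun h => lt_of_not_ge fun h' => not_le_of_gt h (hf h')
  refine ⟨S.one, Or.inr ⟨fun p hp => ?_, rfl⟩, S.kappa R, ?_, S.one, Or.inr ⟨fun p hp => ?_, rfl⟩,
    ?_⟩
  · obtain ⟨j, hj, hjp⟩ := hJe.2.1 _ hp.1
    obtain ⟨q, rfl⟩ := hs j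
    exact absurd (hp.2 hj) (not_le.2 (hlt hjp))
  · have hfib : ∀ i ∈ J, (∃ x, f ⁻¹' {i} = {x}) ∨
        S.val l (f ⁻¹' {i}) ∈ S.ext (⋃₀ P) C := by
      intro i hi
      have hne : (f ⁻¹' {i}).Nonempty := hs i
      rcases hne.exists_eq_singleton_or_nontrivial with h | h
      · exact Or.inl h
      · right
        obtain ⟨a, ha, x, hx, b, hb, hv⟩ := hQ i hi h
        refine ⟨a, ?_, x, hx, b, ?_, hv.symm⟩
        · rcases ha with ⟨p, -, rfl⟩ | ⟨-, h⟩
          · exact Or.inl (hl p)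
          · exact Or.inr h
        · rcases hb with ⟨p, -, rfl⟩ | ⟨-, h⟩
          · exact Or.inl (hl p)
          · exact Or.inr h
    by_cases hbig : ∃ i ∈ J, S.val l (f ⁻¹' {i}) ∈ S.ext (⋃₀ P) C
    · obtain ⟨i, hi, hext⟩ := hbig
      refine hC.shuffle R (fun r hr => ?_) ⟨_, hR.1 i hi, hext⟩
      obtain ⟨j, hj, rfl⟩ := hR.exists_of_mem hJe hr
      rcases hfib j hj with ⟨x, hx⟩ | h
      · left
        simp only [hx, val_singleton]
        exact hl x
      · exact Or.inr h
    · push Not at hbig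
      have hsing : ∀ i ∈ J, ∃ x, f ⁻¹' {i} = {x} := fun i hi =>
        (hfib i hi).resolve_right (hbig i hi)
      refine hC.base R (fun r hr => ?_) fun A hA => ?_
      · obtain ⟨j, hj, rfl⟩ := hR.exists_of_mem hJe hr
        obtain ⟨x, hx⟩ := hsing j hj
        simp only [hx, val_singleton]
        exact hl x
      · obtain ⟨i, hi⟩ := hJe.1
        obtain ⟨j, hj, hij⟩ := hJe.2.2 i hi
        obtain ⟨x, rfl⟩ := hs i
        obtain ⟨y, rfl⟩ := hs j
        obtain ⟨z, -, h1, h2, rfl⟩ := hP.2 A hA x trivial y trivial (hlt hij)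
        have hz : f z ∈ J := hJ.out hi hj ⟨hf h1.le, hf h2.le⟩
        obtain ⟨z', hz'⟩ := hsing (f z) hz
        have hzz : z = z' := by
          have : z ∈ f ⁻¹' {f z} := rfl
          rw [hz'] at this
          exact this
        refine ⟨l z, hL z, ?_⟩
        have := hR.1 _ hz
        simp only [hz', val_singleton] at this
        rwa [hzz]
  · obtain ⟨j, hj, hjp⟩ := hJe.2.2 _ hp.1
    obtain ⟨q, rfl⟩ := hs j
    exact absurd (hp.2 hj) (not_le.2 (hlt hjp))
  · rw [S.val_preimage l f hf, S.val_eq_kappa hR hJe, one_mul', mul_one']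

/-- The convex induction runs on the word of chosen letters over a shuffle of `P`. Its domain has no
ends, so both end labels are `1` and the middle factor is the whole product. -/
theorem mem_of_mem_pow_kappa [Finite M] (hC : S.ShuffleClosed P C) (hP : P.Nonempty) {m : M}
    (hm : m ∈ S.pow.kappa P) : m ∈ C := by
  obtain ⟨W, hW⟩ := CWord.exists_isShuffle hP P.to_countable
  rw [S.pow.kappa_eq_π hW] at hm
  obtain ⟨l, hL, rfl⟩ := hm
  have := hW.denselyOrdered
  have := hW.noMinOrder
  have := hW.noMaxOrder
  have hl : ∀ x, l x ∈ ⋃₀ P := fun x => ⟨W.label x, hW.2.1 x, hL x⟩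
  have key : Inner S C l Set.univ := by
    refine ConvexInduction.property_univ (S := S) (l := l) ⟨?_, ?_, ?_, ?_, ?_, ?_⟩
    · exact fun h => absurd h Set.not_nontrivial_empty
    · exact fun x h => absurd h Set.not_nontrivial_singleton
    · exact fun s t _ _ hst h hs ht => hC.inner_union hl hst h hs ht
    · exact fun s hs x hx hxs hcof h0 hn e he => hC.inner_omega hl hs hx hxs hcof h0 (hn 0) he
    · exact fun s hs x hx hxs hcof h0 hn e he => hC.inner_omegaRev hl hs hx hxs hcof h0 (hn 0) he
    · exact fun I _ _ f hf hs J hJ hJe R hR hQ =>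
        hC.inner_shuffle hL hW.denseOn hf hs hJ hJe hR hQ
  obtain ⟨p⟩ := hW.domNonempty
  obtain ⟨q, hq⟩ := exists_gt p
  obtain ⟨a, ha, x, hx, b, hb, hv⟩ := key ⟨p, trivial, q, trivial, hq.ne⟩
  have ha1 : a = S.one := ha.eq_one fun p hp => by
    obtain ⟨q, hq⟩ := exists_lt p
    exact absurd (hp.2 (Set.mem_univ q)) (not_le.2 hq)
  have hb1 : b = S.one := hb.eq_one fun p hp => by
    obtain ⟨q, hq⟩ := exists_gt p
    exact absurd (hp.2 (Set.mem_univ q)) (not_le.2 hq)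
  rw [val_univ, ha1, hb1, one_mul', mul_one'] at hv
  rw [hv]
  exact hx

end OMonoid.ShuffleClosed

theorem OMonoid.mem_pow_kappa {M : Type u} [Finite M] (S : OMonoid M) {P : Set (Set M)}
    (hP : P.Nonempty) (m : M) :
    m ∈ S.pow.kappa P ↔ ∀ C, S.ShuffleClosed P C → m ∈ C :=
  ⟨fun hm _ hC => hC.mem_of_mem_pow_kappa hP hm, fun h => h _ (S.shuffleClosed_pow_kappa hP)⟩

end CountableWords

namespace CountableWords

universe u v

namespace OMonoid

/-! ### Transport to initial segments of the natural numbers -/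

section transport

variable {M : Type u} {N : Type v} (S : OMonoid M) (e : M ≃ N)

theorem transport_val {D : Type} [LinearOrder D] [Countable D] (l : D → N) (s : Set D) :
    (S.transport e).val l s = e (S.val (fun x => e.symm (l x)) s) := rfl

theorem transport_one : (S.transport e).one = e S.one := by
  rw [← val_empty _ (fun _ : ℕ => e S.one), transport_val, val_empty]

theorem transport_mul (a b : N) :
    (S.transport e).mul a b = e (S.mul (e.symm a) (e.symm b)) := by
  let l : ℕ → N := fun n => if n = 0 then a else b
  have h : (S.transport e).val l ({0} ∪ {1}) = (S.transport e).mul a b := by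
    rw [val_union, val_singleton, val_singleton] <;> simp [l]
  rw [← h, transport_val, val_union, val_singleton, val_singleton]
  · rfl
  · simp

theorem transport_tau (a : N) : (S.transport e).tau a = e (S.tau (e.symm a)) := rfl

theorem transport_tauRev (a : N) : (S.transport e).tauRev a = e (S.tauRev (e.symm a)) := rfl

theorem transport_kappa [Countable N] {P : Set N} (hP : P.Nonempty) :
    (S.transport e).kappa P = e (S.kappa (e.symm '' P)) := by
  obtain ⟨w, hw⟩ := CWord.exists_isShuffle hP P.to_countable
  rw [kappa_eq_π _ hw, kappa_eq_π _ (hw.map e.symm)]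
  rfl

end transport

end OMonoid

/-! ### Sets of small numbers as binary expansions -/

/-- The number below `2 ^ n` whose binary expansion is given by `p`. -/
def mask (p : ℕ → Bool) : ℕ → ℕ
  | 0 => 0
  | n + 1 => mask p n + bif p n then 2 ^ n else 0

theorem mask_lt (p : ℕ → Bool) (n : ℕ) : mask p n < 2 ^ n := by
  induction n with
  | zero => simp [mask]
  | succ n ih =>
    rw [mask, pow_succ]
    cases p n <;> simp <;> omega

theorem testBit_mask (p : ℕ → Bool) (n i : ℕ) (hi : i < n) : (mask p n).testBit i = p i := by
  induction n with
  | zero => omega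
  | succ n ih =>
    rw [mask]
    rcases Nat.lt_succ_iff_lt_or_eq.1 hi with h | rfl
    · rw [← ih h]
      cases p n
      · simp
      · rw [cond_true, add_comm, Nat.testBit_two_pow_add_gt h]
    · cases hp : p i
      · simp [Nat.testBit_lt_two_pow (mask_lt p i)]
      · rw [cond_true, add_comm, Nat.testBit_two_pow_add_eq,
          Nat.testBit_lt_two_pow (mask_lt p i)]
        rfl

theorem mask_testBit (m n : ℕ) (hm : m < 2 ^ n) : mask m.testBit n = m := by
  refine Nat.eq_of_testBit_eq fun i => ?_
  rcases lt_or_ge i n with h | h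
  · rw [testBit_mask _ _ _ h]
  · rw [Nat.testBit_lt_two_pow ((mask_lt _ n).trans_le (Nat.pow_le_pow_right two_pos h)),
      Nat.testBit_lt_two_pow (hm.trans_le (Nat.pow_le_pow_right two_pos h))]

/-- The subset of `{0, …, n-1}` with the given binary expansion. -/
def bits (n m : ℕ) : Set (Fin n) := {i | m.testBit i = true}

theorem mem_bits {n m : ℕ} {i : Fin n} : i ∈ bits n m ↔ m.testBit i = true := Iff.rfl

open Classical in
/-- Subsets of `{0, …, n-1}` as numbers below `2 ^ n`. -/
noncomputable def bitsEquiv (n : ℕ) : Set (Fin n) ≃ Fin (2 ^ n) where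
  toFun A := ⟨mask (fun i => decide (∃ h : i < n, (⟨i, h⟩ : Fin n) ∈ A)) n, mask_lt _ _⟩
  invFun m := bits n m
  left_inv A := by
    ext i
    rw [mem_bits]
    simp [testBit_mask _ _ _ i.2]
  right_inv m := by
    ext
    refine Eq.trans ?_ (mask_testBit m n m.2)
    refine Nat.eq_of_testBit_eq fun i => ?_
    rcases lt_or_ge i n with h | h
    · rw [testBit_mask _ _ _ h, testBit_mask _ _ _ h]
      simp [mem_bits, h]
    · rw [Nat.testBit_lt_two_pow ((mask_lt _ n).trans_le (Nat.pow_le_pow_right two_pos h)),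
        Nat.testBit_lt_two_pow ((mask_lt _ n).trans_le (Nat.pow_le_pow_right two_pos h))]

theorem bitsEquiv_symm (n : ℕ) (m : Fin (2 ^ n)) : (bitsEquiv n).symm m = bits n m := rfl

theorem eq_bitsEquiv_iff {n : ℕ} {A : Set (Fin n)} {m : ℕ} (hm : m < 2 ^ n) :
    m = bitsEquiv n A ↔ ∀ i : Fin n, m.testBit i = true ↔ i ∈ A := by
  have h : m = bitsEquiv n A ↔ bits n m = A := by
    have : (⟨m, hm⟩ : Fin (2 ^ n)) = bitsEquiv n A ↔ (bitsEquiv n).symm ⟨m, hm⟩ = A := by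
      rw [Equiv.symm_apply_eq]
    rw [← bitsEquiv_symm n ⟨m, hm⟩, ← this, Fin.ext_iff]
  rw [h, Set.ext_iff]
  rfl

theorem mask_eq_bitsEquiv {n : ℕ} {A : Set (Fin n)} {p : ℕ → Bool}
    (h : ∀ i : Fin n, p i = true ↔ i ∈ A) : mask p n = bitsEquiv n A := by
  rw [eq_bitsEquiv_iff (mask_lt p n)]
  intro i
  rw [testBit_mask _ _ _ i.2, h]

theorem bits_bitsEquiv {n : ℕ} (A : Set (Fin n)) : bits n (bitsEquiv n A) = A :=
  (bitsEquiv n).symm_apply_apply A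

theorem bits_nonempty {n m : ℕ} (hm : m < 2 ^ n) (h0 : m ≠ 0) : (bits n m).Nonempty := by
  obtain ⟨i, hi⟩ := Nat.exists_testBit_of_ne_zero h0
  have : i < n := by
    by_contra h
    rw [Nat.testBit_lt_two_pow (hm.trans_le (Nat.pow_le_pow_right two_pos (not_lt.1 h)))] at hi
    exact Bool.noConfusion hi
  exact ⟨⟨i, this⟩, hi⟩

theorem bits_zero (n : ℕ) : bits n 0 = ∅ := by
  ext i; simp [mem_bits]

/-! ### A ⊛-monoid for the order of occurrences -/

/-- In a word of triples `(s, t, r)`, the product records whether `s` occurs, whether `t` occurs,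
and whether `r` occurs or an occurrence of `s` precedes one of `t`. -/
def occMonoid : OMonoid (Prop × Prop × Prop) where
  π w := (∃ x, (w.label x).1, ∃ x, (w.label x).2.1,
    (∃ x, (w.label x).2.2) ∨ ∃ x y, x < y ∧ (w.label x).1 ∧ (w.label y).2.1)
  π_iso w w' h := by
    obtain ⟨e, he⟩ := h
    simp only [Prod.mk.injEq, eq_iff_iff]
    refine ⟨?_, ?_, or_congr ?_ ?_⟩
    · rw [e.surjective.exists]; simp only [he]
    · rw [e.surjective.exists]; simp only [he]
    · rw [e.surjective.exists]; simp only [he]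
    · rw [e.surjective.exists]
      refine exists_congr fun x => ?_
      rw [e.surjective.exists]
      simp only [he, e.lt_iff_lt]
  π_single a := by
    have h : ∀ x : (CWord.single a).Dom, (CWord.single a).label x = a := fun x => by
      have : x = (0 : Fin 1) := Subsingleton.elim (α := Fin 1) _ _
      subst this; rfl
    have : Nonempty (CWord.single a).Dom := ⟨(0 : Fin 1)⟩
    have hlt : ∀ x y : (CWord.single a).Dom, ¬ x < y := fun x y hxy =>
      hxy.ne (Subsingleton.elim (α := Fin 1) _ _)
    simp [h, hlt]
  π_assoc W := by
    simp only [Prod.mk.injEq, eq_iff_iff]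
    have hex : ∀ p : (i : W.Dom) → (W.label i).Dom → Prop,
        (∃ i, ∃ x, p i x) ↔ ∃ q : W.concat.Dom, p (ofLex q).1 (ofLex q).2 := fun p =>
      ⟨fun ⟨i, x, h⟩ => ⟨toLex ⟨i, x⟩, h⟩, fun ⟨q, h⟩ => ⟨_, _, h⟩⟩
    refine ⟨hex fun i x => ((W.label i).label x).1, hex fun i x => ((W.label i).label x).2.1, ?_⟩
    constructor
    · rintro (⟨i, ⟨x, h⟩ | ⟨x, y, hxy, hx, hy⟩⟩ | ⟨i, j, hij, ⟨x, hx⟩, y, hy⟩)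
      · exact Or.inl ⟨toLex ⟨i, x⟩, h⟩
      · exact Or.inr ⟨toLex ⟨i, x⟩, toLex ⟨i, y⟩, Sigma.Lex.right _ _ hxy, hx, hy⟩
      · exact Or.inr ⟨toLex ⟨i, x⟩, toLex ⟨j, y⟩, Sigma.Lex.left _ _ hij, hx, hy⟩
    · rintro (⟨⟨i, x⟩, h⟩ | ⟨p, q, hpq, hx, hy⟩)
      · exact Or.inl ⟨i, Or.inl ⟨x, h⟩⟩
      · cases hpq with
        | @left i j x y hij => exact Or.inr ⟨i, j, hij, ⟨x, hx⟩, y, hy⟩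
        | @right i x y hxy => exact Or.inl ⟨i, Or.inr ⟨x, y, hxy, hx, hy⟩⟩

/-- The number of elements of `occMonoid`. -/
noncomputable def occCard : ℕ := Nat.card (Prop × Prop × Prop)

noncomputable def occEquiv : Prop × Prop × Prop ≃ Fin occCard := Finite.equivFin _

/-- The monoid `occMonoid` on an initial segment of the natural numbers. -/
noncomputable def occFin : OMonoid (Fin occCard) := occMonoid.transport occEquiv

end CountableWords

namespace CountableWords

/-! ### Bounded quantifiers -/

/-- Bounded universal quantification. -/
def allB (p : ℕ → Bool) : ℕ → Bool
  | 0 => true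
  | n + 1 => p n && allB p n

/-- Bounded existential quantification. -/
def anyB (p : ℕ → Bool) : ℕ → Bool
  | 0 => false
  | n + 1 => p n || anyB p n

def impB (a b : Bool) : Bool := !a || b

theorem impB_iff (a b : Bool) : impB a b = true ↔ (a = true → b = true) := by
  cases a <;> cases b <;> simp [impB]

theorem allB_iff (p : ℕ → Bool) (n : ℕ) : allB p n = true ↔ ∀ i : Fin n, p i = true := by
  induction n with
  | zero => simp [allB]
  | succ n ih => rw [allB, Bool.and_eq_true, ih, Fin.forall_fin_succ']; simp [and_comm]

theorem anyB_iff (p : ℕ → Bool) (n : ℕ) : anyB p n = true ↔ ∃ i : Fin n, p i = true := by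
  induction n with
  | zero => simp [anyB]
  | succ n ih => rw [anyB, Bool.or_eq_true, ih, Fin.exists_fin_succ']; simp [or_comm]

/-- Quantifiers over subsets become bounded quantifiers over numbers, which are primitive recursive.
-/
theorem allB_pow_iff (p : ℕ → Bool) (n : ℕ) :
    allB p (2 ^ n) = true ↔ ∀ C : Set (Fin n), p (bitsEquiv n C) = true := by
  rw [allB_iff, (bitsEquiv n).surjective.forall]

theorem anyB_pow_iff (p : ℕ → Bool) (n : ℕ) :
    anyB p (2 ^ n) = true ↔ ∃ C : Set (Fin n), p (bitsEquiv n C) = true := by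
  rw [anyB_iff, (bitsEquiv n).surjective.exists]

theorem testBit_bitsEquiv {n : ℕ} (A : Set (Fin n)) (i : Fin n) :
    ((bitsEquiv n A : Fin (2 ^ n)) : ℕ).testBit i = true ↔ i ∈ A := by
  rw [← mem_bits, bits_bitsEquiv]

/-! ### Tables -/

namespace Table

def size (t : Table) : ℕ := t.1

def one (t : Table) : ℕ := t.2.1

/-- The default values of `getD` only make the accessors total; their specifications under
`Describes` concern indices in range. -/
def mul (t : Table) (i j : ℕ) : ℕ := (t.2.2.1.getD i []).getD j 0

def tau (t : Table) (i : ℕ) : ℕ := t.2.2.2.1.getD i 0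

def tauRev (t : Table) (i : ℕ) : ℕ := t.2.2.2.2.1.getD i 0

def kappa (t : Table) (m : ℕ) : ℕ := t.2.2.2.2.2.1.getD m 0

def letter (t : Table) (c : ℕ) : ℕ := t.2.2.2.2.2.2.1.getD c 0

def accept (t : Table) (i : ℕ) : Bool := t.2.2.2.2.2.2.2.getD i false

/-- The table with the given entries. -/
def build (n one K : ℕ) (mul : ℕ → ℕ → ℕ) (tau tauRev kappa letter : ℕ → ℕ)
    (accept : ℕ → Bool) : Table :=
  (n, one, (List.range n).map fun i => (List.range n).map fun j => mul i j,
    (List.range n).map tau, (List.range n).map tauRev, (List.range (2 ^ n)).map kappa,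
    (List.range K).map letter, (List.range n).map accept)

end Table

theorem map_range_eq_ofFn {α : Type*} {n : ℕ} {f : ℕ → α} {g : Fin n → α}
    (h : ∀ i : Fin n, f i = g i) :
    (List.range n).map f = List.ofFn g := by
  apply List.ext_getElem
  · simp
  · intro i h1 h2
    simp only [List.getElem_map, List.getElem_range, List.getElem_ofFn]
    exact h ⟨i, by simpa using h1⟩

theorem getD_ofFn {α : Type*} {n : ℕ} (g : Fin n → α) (i : Fin n) (d : α) :
    (List.ofFn g).getD i d = g i := by
  rw [List.getD_eq_getElem _ _ (by simp), List.getElem_ofFn]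

/-- The recognizer with the ⊛-algebra induced by `S`. -/
noncomputable def OMonoid.recognizer {n K : ℕ} (S : OMonoid (Fin n)) (h : Fin K → Fin n)
    (F : Finset (Fin n)) : Recognizer K := ⟨n, S.alg, h, F⟩

/-- The table `t` describes the ⊛-monoid `S`, the map `h` and the accepting set `F`. -/
def Describes {n K : ℕ} (t : Table) (S : OMonoid (Fin n)) (h : Fin K → Fin n)
    (F : Finset (Fin n)) : Prop := t = (S.recognizer h F).table

namespace Describes

section access

variable {n K : ℕ} {t : Table} {S : OMonoid (Fin n)} {h : Fin K → Fin n} {F : Finset (Fin n)}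

theorem size (H : Describes t S h F) : t.size = n := by rw [H]; rfl

theorem one (H : Describes t S h F) : t.one = S.one := by rw [H]; rfl

theorem mul (H : Describes t S h F) (i j : Fin n) : t.mul i j = S.mul i j := by
  rw [H]
  change ((List.ofFn fun i : Fin n => List.ofFn fun j : Fin n => (S.mul i j : ℕ)).getD i []).getD
    j 0 = _
  rw [getD_ofFn, getD_ofFn]

theorem tau (H : Describes t S h F) (i : Fin n) : t.tau i = S.tau i := by
  rw [H]
  exact getD_ofFn (n := n) _ i _

theorem tauRev (H : Describes t S h F) (i : Fin n) : t.tauRev i = S.tauRev i := by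
  rw [H]
  exact getD_ofFn (n := n) _ i _

theorem kappa (H : Describes t S h F) (A : Set (Fin n)) : t.kappa (bitsEquiv n A) = S.kappa A := by
  rw [H]
  refine (getD_ofFn (n := 2 ^ n) _ (bitsEquiv n A) _).trans ?_
  change (S.kappa (bits n (bitsEquiv n A)) : ℕ) = _
  rw [bits_bitsEquiv]

theorem letter (H : Describes t S h F) (c : Fin K) : t.letter c = h c := by
  rw [H]
  exact getD_ofFn (n := K) _ c _

theorem accept (H : Describes t S h F) (i : Fin n) : t.accept i = true ↔ i ∈ F := by
  rw [H]
  change (List.ofFn fun i : Fin n => decide (i ∈ F)).getD i false = true ↔ _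
  rw [getD_ofFn, decide_eq_true_iff]

end access

/-- Entry `0` of the table of `kappa` belongs to the empty set, where `OMonoid.kappa` has the
conventional value `1`; hence the separate condition `hkappa0`. -/
theorem of_build {n K : ℕ} {S : OMonoid (Fin n)} {h : Fin K → Fin n} {F : Finset (Fin n)}
    {one : ℕ} {mul : ℕ → ℕ → ℕ} {tau tauRev kappa letter : ℕ → ℕ} {accept : ℕ → Bool}
    (h1 : one = S.one) (hmul : ∀ i j : Fin n, mul i j = S.mul i j)
    (htau : ∀ i : Fin n, tau i = S.tau i) (htauRev : ∀ i : Fin n, tauRev i = S.tauRev i)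
    (hkappa : ∀ P : Set (Fin n), P.Nonempty → kappa (bitsEquiv n P) = S.kappa P)
    (hkappa0 : kappa 0 = S.one) (hletter : ∀ c : Fin K, letter c = h c)
    (haccept : ∀ i : Fin n, accept i = true ↔ i ∈ F) :
    Describes (Table.build n one K mul tau tauRev kappa letter accept) S h F := by
  refine Prod.ext rfl (Prod.ext h1 (Prod.ext ?_ (Prod.ext ?_ (Prod.ext ?_ (Prod.ext ?_
    (Prod.ext ?_ ?_))))))
  · exact map_range_eq_ofFn (n := n) fun i => map_range_eq_ofFn (n := n) fun j => hmul i j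
  · exact map_range_eq_ofFn htau
  · exact map_range_eq_ofFn htauRev
  · refine map_range_eq_ofFn (n := 2 ^ n) fun m => ?_
    change _ = ((S.kappa (bits n m) : Fin n) : ℕ)
    by_cases hm : (m : ℕ) = 0
    · rw [hm, bits_zero, S.kappa_empty, hkappa0]
    · rw [← hkappa _ (bits_nonempty m.2 hm), ← bitsEquiv_symm, Equiv.apply_symm_apply]
  · exact map_range_eq_ofFn hletter
  · refine map_range_eq_ofFn (n := n) fun i => ?_
    change _ = decide (i ∈ F)
    rw [Bool.eq_iff_iff, haccept, decide_eq_true_iff]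

end Describes

namespace Table

/-! ### The table of a product -/

/-- Agrees with `finProdFinEquiv`, so that quotient and remainder by the second size recover the
components. -/
def pairing (u : Table) (a b : ℕ) : ℕ := b + u.size * a

/-- The two masks code the projections of the set coded by `m`; compare `OMonoid.prod_kappa`. -/
def prodKappa (t u : Table) (m : ℕ) : ℕ :=
  pairing u
    (t.kappa (mask (fun a => anyB (fun i => m.testBit i && i / u.size == a)
      (t.size * u.size)) t.size))
    (u.kappa (mask (fun b => anyB (fun i => m.testBit i && i % u.size == b)
      (t.size * u.size)) u.size))

/-- The table of the product, with the intersection of the accepting conditions. -/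
def prod (K : ℕ) (t u : Table) : Table :=
  build (t.size * u.size) (pairing u t.one u.one) K
    (fun i j => pairing u (t.mul (i / u.size) (j / u.size)) (u.mul (i % u.size) (j % u.size)))
    (fun i => pairing u (t.tau (i / u.size)) (u.tau (i % u.size)))
    (fun i => pairing u (t.tauRev (i / u.size)) (u.tauRev (i % u.size)))
    (fun m => bif m == 0 then pairing u t.one u.one else prodKappa t u m)
    (fun c => pairing u (t.letter c) (u.letter c))
    (fun i => t.accept (i / u.size) && u.accept (i % u.size))

end Table

theorem bitsEquiv_ne_zero {n : ℕ} {P : Set (Fin n)} (hP : P.Nonempty) :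
    ((bitsEquiv n P : Fin (2 ^ n)) : ℕ) ≠ 0 := by
  obtain ⟨i, hi⟩ := hP
  intro h
  rw [← testBit_bitsEquiv, h, Nat.zero_testBit] at hi
  exact Bool.noConfusion hi

/-- The product of two ⊛-monoids on initial segments of the natural numbers. -/
def OMonoid.prodFin {m n : ℕ} (S : OMonoid (Fin m)) (T : OMonoid (Fin n)) :
    OMonoid (Fin (m * n)) := (S.prod T).transport finProdFinEquiv

theorem Describes.prod {m n K : ℕ} {t u : Table} {S : OMonoid (Fin m)} {T : OMonoid (Fin n)}
    {h : Fin K → Fin m} {g : Fin K → Fin n} {F : Finset (Fin m)} {G : Finset (Fin n)}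
    (H : Describes t S h F) (J : Describes u T g G) :
    Describes (Table.prod K t u) (S.prodFin T) (fun c => finProdFinEquiv (h c, g c))
      (Finset.univ.filter fun i => i.divNat ∈ F ∧ i.modNat ∈ G) := by
  have hp : ∀ (a : Fin m) (b : Fin n), Table.pairing u a b = finProdFinEquiv (a, b) := by
    intro a b
    rw [Table.pairing, J.size]
    rfl
  have hdiv : ∀ i : Fin (m * n), (i : ℕ) / u.size = i.divNat := fun i => by rw [J.size]; rfl
  have hmod : ∀ i : Fin (m * n), (i : ℕ) % u.size = i.modNat := fun i => by rw [J.size]; rfl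
  have hone : Table.pairing u t.one u.one = (S.prodFin T).one := by
    rw [H.one, J.one, hp, OMonoid.prodFin, OMonoid.transport_one, OMonoid.prod_one]
  have hsize : t.size * u.size = m * n := by rw [H.size, J.size]
  rw [Table.prod, hsize]
  refine of_build hone ?_ ?_ ?_ ?_ ?_ ?_ ?_
  · intro i j
    simp only [hdiv, hmod, H.mul, J.mul, hp]
    rw [OMonoid.prodFin, OMonoid.transport_mul, OMonoid.prod_mul]
    rfl
  · intro i
    simp only [hdiv, hmod, H.tau, J.tau, hp]
    rfl
  · intro i
    simp only [hdiv, hmod, H.tauRev, J.tauRev, hp]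
    rfl
  · intro P hP
    have hne : (((bitsEquiv (m * n) P : Fin (2 ^ (m * n))) : ℕ) == 0) = false :=
      beq_eq_false_iff_ne.2 (bitsEquiv_ne_zero hP)
    rw [hne, cond_false, OMonoid.prodFin, OMonoid.transport_kappa _ _ hP,
      OMonoid.prod_kappa _ _ (hP.image _), Table.prodKappa, hsize]
    have h1 : mask (fun a => anyB (fun i =>
        ((bitsEquiv (m * n) P : Fin (2 ^ (m * n))) : ℕ).testBit i
        && i / u.size == a) (m * n)) t.size =
        bitsEquiv m (Prod.fst '' (finProdFinEquiv.symm '' P)) := by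
      rw [H.size]
      refine mask_eq_bitsEquiv fun a => ?_
      simp only [anyB_iff, Bool.and_eq_true, beq_iff_eq, testBit_bitsEquiv, hdiv]
      simp [Fin.ext_iff]
    have h2 : mask (fun b => anyB (fun i =>
        ((bitsEquiv (m * n) P : Fin (2 ^ (m * n))) : ℕ).testBit i
        && i % u.size == b) (m * n)) u.size =
        bitsEquiv n (Prod.snd '' (finProdFinEquiv.symm '' P)) := by
      rw [J.size]
      refine mask_eq_bitsEquiv fun a => ?_
      simp only [anyB_iff, Bool.and_eq_true, beq_iff_eq, testBit_bitsEquiv]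
      simp [Fin.ext_iff]
    rw [h1, h2, H.kappa, J.kappa, hp]
  · exact hone
  · intro c
    rw [H.letter, J.letter, hp]
  · intro i
    rw [hdiv, hmod, Bool.and_eq_true, H.accept, J.accept]
    simp

namespace Table

/-! ### The table of a powerset -/

def powOne (t : Table) : ℕ := mask (fun c => c == t.one) t.size

def powMul (t : Table) (A B : ℕ) : ℕ :=
  mask (fun c => anyB (fun a => A.testBit a && anyB (fun b => B.testBit b && t.mul a b == c)
    t.size) t.size) t.size

def gen (t : Table) (A s : ℕ) : Bool :=
  allB (fun C => impB (allB (fun a => impB (A.testBit a) (C.testBit a &&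
    allB (fun c => impB (C.testBit c) (C.testBit (t.mul c a))) t.size)) t.size)
    (C.testBit s)) (2 ^ t.size)

def powTau (t : Table) (A : ℕ) : ℕ :=
  mask (fun c => anyB (fun s => gen t A s && anyB (fun e => gen t A e &&
    t.mul s (t.tau e) == c) t.size) t.size) t.size

def powTauRev (t : Table) (A : ℕ) : ℕ :=
  mask (fun c => anyB (fun s => gen t A s && anyB (fun e => gen t A e &&
    t.mul (t.tauRev e) s == c) t.size) t.size) t.size

def inUnion (t : Table) (P a : ℕ) : Bool :=
  anyB (fun A => P.testBit A && A.testBit a) (2 ^ t.size)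

def inExt (t : Table) (P C q : ℕ) : Bool :=
  anyB (fun a => (inUnion t P a || a == t.one) && anyB (fun x => C.testBit x &&
    anyB (fun b => (inUnion t P b || b == t.one) && t.mul (t.mul a x) b == q) t.size)
    t.size) t.size

def closedBase (t : Table) (P C : ℕ) : Bool :=
  allB (fun Q => impB (allB (fun q => impB (Q.testBit q) (inUnion t P q)) t.size &&
    allB (fun A => impB (P.testBit A) (anyB (fun q => A.testBit q && Q.testBit q) t.size))
      (2 ^ t.size)) (C.testBit (t.kappa Q))) (2 ^ t.size)

def closedOps (t : Table) (P C : ℕ) : Bool :=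
  allB (fun x => impB (C.testBit x) (
    allB (fun y => impB (C.testBit y) (C.testBit (t.mul x y))) t.size &&
    allB (fun a => impB (inUnion t P a) (
      allB (fun y => impB (C.testBit y) (C.testBit (t.mul (t.mul x a) y))) t.size &&
      C.testBit (t.tau (t.mul x a)) && C.testBit (t.tauRev (t.mul a x)))) t.size)) t.size

def closedShuffle (t : Table) (P C : ℕ) : Bool :=
  allB (fun Q => impB (
    allB (fun q => impB (Q.testBit q) (inUnion t P q || inExt t P C q)) t.size &&
    anyB (fun q => Q.testBit q && inExt t P C q) t.size) (C.testBit (t.kappa Q))) (2 ^ t.size)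

/-- The intersection of all closed sets, as in `OMonoid.mem_pow_kappa`. -/
def powKappa (t : Table) (P : ℕ) : ℕ :=
  mask (fun c => allB (fun C => impB (closedBase t P C && closedOps t P C && closedShuffle t P C)
    (C.testBit c)) (2 ^ t.size)) t.size

/-- The table of the powerset; the letter `c` is sent to the set of the images of the letters that
are related to it. -/
def pow (K : ℕ) (r : ℕ → ℕ → Bool) (t : Table) : Table :=
  build (2 ^ t.size) (powOne t) K (powMul t) (powTau t) (powTauRev t)
    (fun P => bif P == 0 then powOne t else powKappa t P)
    (fun c => mask (fun a => anyB (fun d => r c d && t.letter d == a) K) t.size)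
    (fun A => anyB (fun a => A.testBit a && t.accept a) t.size)

end Table

/-- The powerset of a ⊛-monoid on an initial segment of the natural numbers. -/
noncomputable def OMonoid.powFin {n : ℕ} (S : OMonoid (Fin n)) : OMonoid (Fin (2 ^ n)) :=
  S.pow.transport (bitsEquiv n)

namespace Describes

variable {n K : ℕ} {t : Table} {S : OMonoid (Fin n)} {h : Fin K → Fin n} {F : Finset (Fin n)}

theorem powOne (H : Describes t S h F) : t.powOne = S.powFin.one := by
  rw [OMonoid.powFin, OMonoid.transport_one, OMonoid.pow_one, Table.powOne, H.size, H.one]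
  refine mask_eq_bitsEquiv fun i => ?_
  simp [Fin.ext_iff]

theorem gen (H : Describes t S h F) (A : Set (Fin n)) (s : Fin n) :
    t.gen (bitsEquiv n A) s = true ↔ s ∈ S.gen A := by
  rw [Table.gen, H.size, S.mem_gen_iff]
  simp only [allB_pow_iff]
  simp only [allB_iff, impB_iff, Bool.and_eq_true, testBit_bitsEquiv, H.mul]

theorem inUnion (H : Describes t S h F) (P : Set (Set (Fin n))) (m : ℕ)
    (hm : ∀ A : Set (Fin n), m.testBit (bitsEquiv n A) = true ↔ A ∈ P) (a : Fin n) :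
    t.inUnion m a = true ↔ a ∈ ⋃₀ P := by
  rw [Table.inUnion, H.size]
  simp only [anyB_pow_iff, Bool.and_eq_true, testBit_bitsEquiv, hm]
  rfl

theorem inExt (H : Describes t S h F) (P : Set (Set (Fin n))) (m : ℕ)
    (hm : ∀ A : Set (Fin n), m.testBit (bitsEquiv n A) = true ↔ A ∈ P) (C : Set (Fin n))
    (q : Fin n) : t.inExt m (bitsEquiv n C) q = true ↔ q ∈ S.ext (⋃₀ P) C := by
  rw [Table.inExt, H.size]
  simp only [anyB_iff, Bool.and_eq_true, Bool.or_eq_true, testBit_bitsEquiv, H.inUnion P m hm,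
    H.one, H.mul, beq_iff_eq, ← Fin.ext_iff]
  rfl

theorem closed (H : Describes t S h F) (P : Set (Set (Fin n))) (m : ℕ)
    (hm : ∀ A : Set (Fin n), m.testBit (bitsEquiv n A) = true ↔ A ∈ P) (C : Set (Fin n)) :
    (t.closedBase m (bitsEquiv n C) && t.closedOps m (bitsEquiv n C) &&
      t.closedShuffle m (bitsEquiv n C)) = true ↔ S.ShuffleClosed P C := by
  have hbase : t.closedBase m (bitsEquiv n C) = true ↔
      ∀ Q : Set (Fin n), Q ⊆ ⋃₀ P → (∀ A ∈ P, (A ∩ Q).Nonempty) → S.kappa Q ∈ C := by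
    rw [Table.closedBase, H.size]
    simp only [allB_pow_iff, impB_iff, Bool.and_eq_true]
    simp only [allB_iff, anyB_iff, impB_iff, Bool.and_eq_true, testBit_bitsEquiv,
      H.inUnion P m hm, hm, H.kappa, and_imp]
    rfl
  have hops : t.closedOps m (bitsEquiv n C) = true ↔ ∀ x ∈ C, (∀ y ∈ C, S.mul x y ∈ C) ∧
      ∀ a ∈ ⋃₀ P, ((∀ y ∈ C, S.mul (S.mul x a) y ∈ C) ∧ S.tau (S.mul x a) ∈ C) ∧
        S.tauRev (S.mul a x) ∈ C := by
    rw [Table.closedOps, H.size]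
    simp only [allB_iff, impB_iff, Bool.and_eq_true, testBit_bitsEquiv, H.inUnion P m hm, H.mul,
      H.tau, H.tauRev]
  have hshuffle : t.closedShuffle m (bitsEquiv n C) = true ↔ ∀ Q : Set (Fin n),
      Q ⊆ ⋃₀ P ∪ S.ext (⋃₀ P) C → (Q ∩ S.ext (⋃₀ P) C).Nonempty → S.kappa Q ∈ C := by
    rw [Table.closedShuffle, H.size]
    simp only [allB_pow_iff]
    simp only [allB_iff, anyB_iff, impB_iff, Bool.and_eq_true, Bool.or_eq_true,
      testBit_bitsEquiv, H.inUnion P m hm, H.inExt P m hm, H.kappa, and_imp]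
    rfl
  rw [Bool.and_eq_true, Bool.and_eq_true, hbase, hops, hshuffle]
  constructor
  · rintro ⟨⟨h1, h2⟩, h3⟩
    exact ⟨h1, fun x hx => (h2 x hx).1, fun x hx a ha => ((h2 x hx).2 a ha).1.1,
      fun x hx a ha => ((h2 x hx).2 a ha).1.2, fun x hx a ha => ((h2 x hx).2 a ha).2, h3⟩
  · intro hC
    exact ⟨⟨hC.base, fun x hx => ⟨hC.mul x hx, fun a ha =>
      ⟨⟨hC.mul_mul x hx a ha, hC.tau x hx a ha⟩, hC.tauRev x hx a ha⟩⟩⟩, hC.shuffle⟩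

/-- The image of a letter in the powerset of the monoid, for a relation on the letters. -/
noncomputable def _root_.CountableWords.relImage {n K : ℕ} (h : Fin K → Fin n)
    (r : ℕ → ℕ → Bool) (c : Fin K) : Fin (2 ^ n) :=
  bitsEquiv n {a | ∃ d : Fin K, r c d = true ∧ h d = a}

open Classical in
theorem pow (H : Describes t S h F) (r : ℕ → ℕ → Bool) :
    Describes (Table.pow K r t) S.powFin (relImage h r)
      (Finset.univ.filter fun i => ∃ a ∈ (bitsEquiv n).symm i, a ∈ F) := by
  have hone := H.powOne
  rw [Table.pow, H.size]
  have hmem : ∀ (i : Fin (2 ^ n)) (a : Fin n), (i : ℕ).testBit a = true ↔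
      a ∈ (bitsEquiv n).symm i := fun i a => Iff.rfl
  have hgen : ∀ (i : Fin (2 ^ n)) (s : Fin n), t.gen i s = true ↔
      s ∈ S.gen ((bitsEquiv n).symm i) := fun i s => by
    rw [← H.gen, Equiv.apply_symm_apply]
  refine of_build hone ?_ ?_ ?_ ?_ ?_ ?_ ?_
  · intro i j
    rw [OMonoid.powFin, OMonoid.transport_mul, Table.powMul, H.size]
    refine mask_eq_bitsEquiv fun c => ?_
    simp only [anyB_iff, Bool.and_eq_true, beq_iff_eq, hmem, H.mul, ← Fin.ext_iff,
      OMonoid.mem_pow_mul]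
  · intro i
    rw [OMonoid.powFin, OMonoid.transport_tau, Table.powTau, H.size]
    refine mask_eq_bitsEquiv fun c => ?_
    simp only [anyB_iff, Bool.and_eq_true, beq_iff_eq, hgen, H.mul, H.tau, ← Fin.ext_iff,
      OMonoid.mem_pow_tau]
  · intro i
    rw [OMonoid.powFin, OMonoid.transport_tauRev, Table.powTauRev, H.size]
    refine mask_eq_bitsEquiv fun c => ?_
    simp only [anyB_iff, Bool.and_eq_true, beq_iff_eq, hgen, H.mul, H.tauRev, ← Fin.ext_iff,
      OMonoid.mem_pow_tauRev]
  · intro P hP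
    have hne : (((bitsEquiv (2 ^ n) P : Fin (2 ^ 2 ^ n)) : ℕ) == 0) = false :=
      beq_eq_false_iff_ne.2 (bitsEquiv_ne_zero hP)
    rw [hne, cond_false, OMonoid.powFin, OMonoid.transport_kappa _ _ hP, Table.powKappa, H.size]
    have hm : ∀ A : Set (Fin n), ((bitsEquiv (2 ^ n) P : Fin (2 ^ 2 ^ n)) : ℕ).testBit
        (bitsEquiv n A) = true ↔ A ∈ (bitsEquiv n).symm '' P := by
      intro A
      rw [testBit_bitsEquiv, Equiv.image_symm_eq_preimage]
      rfl
    refine mask_eq_bitsEquiv fun c => ?_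
    rw [S.mem_pow_kappa (hP.image _)]
    simp only [allB_pow_iff, impB_iff, H.closed _ _ hm, testBit_bitsEquiv]
  · exact hone
  · intro c
    refine mask_eq_bitsEquiv fun a => ?_
    simp only [anyB_iff, Bool.and_eq_true, beq_iff_eq, H.letter, ← Fin.ext_iff]
    rfl
  · intro i
    simp only [anyB_iff, Bool.and_eq_true, hmem, H.accept]
    simp

end Describes

end CountableWords

namespace CountableWords

/-! ### Elementary tables -/

namespace Table

/-- Complementation of the accepting set. -/
def compl (t : Table) : Table :=
  (t.1, t.2.1, t.2.2.1, t.2.2.2.1, t.2.2.2.2.1, t.2.2.2.2.2.1, t.2.2.2.2.2.2.1,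
    t.2.2.2.2.2.2.2.map not)

/-- Restriction to the first `k` letters. -/
def restrict (k : ℕ) (t : Table) : Table :=
  (t.1, t.2.1, t.2.2.1, t.2.2.2.1, t.2.2.2.2.1, t.2.2.2.2.2.1, t.2.2.2.2.2.2.1.take k,
    t.2.2.2.2.2.2.2)

/-- The table of `occFin`, without letters. -/
noncomputable def occBase : Table := (occFin.recognizer (K := 0) Fin.elim0 ∅).table

/-- Although `occEquiv` comes from choice, this function has only four inputs and is therefore
primitive recursive; likewise `occBase` is a constant. -/
noncomputable def occCode (s t : Bool) : ℕ := occEquiv (s = true, t = true, False)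

/-- The table of `occFin` for the occurrences of letters with the properties `σ` and `τ`. -/
noncomputable def occ (K : ℕ) (σ τ : ℕ → Bool) (acc : List Bool) : Table :=
  (occBase.1, occBase.2.1, occBase.2.2.1, occBase.2.2.2.1, occBase.2.2.2.2.1,
    occBase.2.2.2.2.2.1, (List.range K).map fun c => occCode (σ c) (τ c), acc)

end Table

open Classical in
/-- The elements of `occFin` with a given property. -/
noncomputable def occSet (p : Prop × Prop × Prop → Prop) : Finset (Fin occCard) :=
  Finset.univ.filter fun i => p (occEquiv.symm i)

noncomputable def occAccept (p : Prop × Prop × Prop → Prop) : List Bool :=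
  List.ofFn fun i => decide (i ∈ occSet p)

theorem describes_occ (K : ℕ) (σ τ : ℕ → Bool) (p : Prop × Prop × Prop → Prop) :
    Describes (Table.occ K σ τ (occAccept p)) occFin
      (fun c : Fin K => occEquiv (σ c = true, τ c = true, False)) (occSet p) := by
  refine Prod.ext rfl (Prod.ext rfl (Prod.ext rfl (Prod.ext rfl (Prod.ext rfl (Prod.ext rfl
    (Prod.ext ?_ rfl))))))
  exact map_range_eq_ofFn fun c => rfl

open Classical in
theorem occFin_π_mem {D : Type} [LinearOrder D] [Countable D] (s t : D → Prop)
    (p : Prop × Prop × Prop → Prop) :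
    occFin.π ⟨D, fun x => occEquiv (s x, t x, False)⟩ ∈ occSet p ↔
      p (∃ x, s x, ∃ x, t x, ∃ x y, x < y ∧ s x ∧ t y) := by
  rw [occSet, Finset.mem_filter]
  have h : occEquiv.symm (occFin.π ⟨D, fun x => occEquiv (s x, t x, False)⟩) =
      (∃ x, s x, ∃ x, t x, ∃ x y, x < y ∧ s x ∧ t y) := by
    refine (occEquiv.symm_apply_apply _).trans ?_
    simp [occMonoid, CWord.map]
  rw [h]
  simp

section

variable {n K : ℕ} {t : Table} {S : OMonoid (Fin n)} {h : Fin K → Fin n} {F : Finset (Fin n)}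

theorem Describes.compl (H : Describes t S h F) : Describes t.compl S h Fᶜ := by
  rw [Describes] at H
  subst H
  refine Prod.ext rfl (Prod.ext rfl (Prod.ext rfl (Prod.ext rfl (Prod.ext rfl (Prod.ext rfl
    (Prod.ext rfl ?_))))))
  change (List.ofFn fun i : Fin n => decide (i ∈ F)).map not =
    List.ofFn fun i : Fin n => decide (i ∈ Fᶜ)
  rw [List.map_ofFn]
  congr 1
  funext i
  simp

theorem Describes.restrict (H : Describes t S h F) {k : ℕ} (hk : k ≤ K) :
    Describes (t.restrict k) S (fun a => h (Fin.castLE hk a)) F := by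
  rw [Describes] at H
  subst H
  refine Prod.ext rfl (Prod.ext rfl (Prod.ext rfl (Prod.ext rfl (Prod.ext rfl (Prod.ext rfl
    (Prod.ext ?_ rfl))))))
  change (List.ofFn fun c : Fin K => (h c : ℕ)).take k =
    List.ofFn fun a : Fin k => (h (Fin.castLE hk a) : ℕ)
  apply List.ext_getElem
  · simp [hk]
  · intro i h1 h2
    simp only [List.getElem_take, List.getElem_ofFn]
    rfl

end

/-! ### Valuations coded by letters -/

/-- The size of the alphabet that codes letters below `k` with the values of the variables with
index below `N`. -/
def alphabet (k N : ℕ) : ℕ := k * 2 ^ (2 * N)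

def codeBit (k c q : ℕ) : Bool := (c / k).testBit q

/-- The codes `c` and `d` differ at most in the bit `p`. -/
def related (k N p c d : ℕ) : Bool :=
  c % k == d % k && allB (fun q => q == p || codeBit k c q == codeBit k d q) (2 * N)

theorem related_iff {k N p c d : ℕ} : related k N p c d = true ↔
    c % k = d % k ∧ ∀ q < 2 * N, q ≠ p → codeBit k c q = codeBit k d q := by
  rw [related, Bool.and_eq_true, allB_iff]
  simp only [beq_iff_eq, Bool.or_eq_true]
  refine and_congr_right fun _ => ⟨fun h q hq hqp => (h ⟨q, hq⟩).resolve_left hqp, fun h q => ?_⟩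
  exact or_iff_not_imp_left.2 fun hqp => h q q.2 hqp

/-- The code is `a + k * mask b (2 * N)`: the remainder modulo `k` is the letter and the quotient
carries the bits, of which `2 * i` belongs to `x_i` and `2 * i + 1` to `X_i`. -/
theorem exists_code {k : ℕ} (N : ℕ) (a : Fin k) (b : ℕ → Bool) :
    ∃ c : Fin (alphabet k N), (c : ℕ) % k = a ∧ ∀ q < 2 * N, codeBit k c q = b q := by
  have hk : 0 < k := Nat.zero_lt_of_lt a.2
  have hlt : (a : ℕ) + k * mask b (2 * N) < alphabet k N := by
    have h1 : (a : ℕ) + k * mask b (2 * N) < k * (mask b (2 * N) + 1) := by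
      rw [mul_add, mul_one, add_comm]
      exact Nat.add_lt_add_left a.2 _
    exact h1.trans_le (Nat.mul_le_mul_left k (mask_lt b (2 * N)))
  refine ⟨⟨_, hlt⟩, ?_, fun q hq => ?_⟩
  · rw [Nat.add_mul_mod_self_left, Nat.mod_eq_of_lt a.2]
  · rw [codeBit, Nat.add_mul_div_left _ _ hk, Nat.div_eq_of_lt a.2, zero_add,
      testBit_mask _ _ _ hq]

/-- The labelling `c` codes the word `w` with the valuations `v` and `V`. -/
def Codes {k : ℕ} (N : ℕ) (w : CWord (Fin k)) (v : ℕ → Option w.Dom) (V : ℕ → Set w.Dom)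
    (c : w.Dom → Fin (alphabet k N)) : Prop :=
  ∀ x, (c x : ℕ) % k = w.label x ∧ ∀ i < N, (codeBit k (c x) (2 * i) = true ↔ v i = some x) ∧
    (codeBit k (c x) (2 * i + 1) = true ↔ x ∈ V i)

theorem exists_related {k N : ℕ} {w : CWord (Fin k)} {v : ℕ → Option w.Dom}
    {V : ℕ → Set w.Dom} {c : w.Dom → Fin (alphabet k N)} (hc : Codes N w v V c) {p : ℕ}
    (hp : p < 2 * N) (X : Set w.Dom) : ∃ d : w.Dom → Fin (alphabet k N),
      (∀ x, related k N p (c x) (d x) = true) ∧ ∀ x, codeBit k (d x) p = true ↔ x ∈ X := by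
  classical
  choose d hd1 hd2 using fun x => exists_code N (w.label x) fun q =>
    if q = p then decide (x ∈ X) else codeBit k (c x) q
  refine ⟨d, fun x => related_iff.2 ⟨(hc x).1.trans (hd1 x).symm, fun q hq hqp => ?_⟩,
    fun x => ?_⟩
  · rw [hd2 x q hq, if_neg hqp]
  · rw [hd2 x p hp, if_pos rfl, decide_eq_true_iff]

theorem Codes.updateSO {k N : ℕ} {w : CWord (Fin k)} {v : ℕ → Option w.Dom}
    {V : ℕ → Set w.Dom} {c d : w.Dom → Fin (alphabet k N)} (hc : Codes N w v V c) {j : ℕ}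
    (h : ∀ x, related k N (2 * j + 1) (c x) (d x) = true) {X : Set w.Dom}
    (hX : ∀ x, codeBit k (d x) (2 * j + 1) = true ↔ x ∈ X) :
    Codes N w v (Function.update V j X) d := by
  intro x
  obtain ⟨h1, h2⟩ := related_iff.1 (h x)
  refine ⟨h1.symm.trans (hc x).1, fun i hi => ⟨?_, ?_⟩⟩
  · rw [← h2 (2 * i) (by omega) (by omega)]
    exact ((hc x).2 i hi).1
  · by_cases hij : i = j
    · subst hij
      rw [Function.update_self]
      exact hX x
    · rw [Function.update_of_ne hij, ← h2 (2 * i + 1) (by omega) (by omega)]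
      exact ((hc x).2 i hi).2

theorem Codes.updateFO {k N : ℕ} {w : CWord (Fin k)} {v : ℕ → Option w.Dom}
    {V : ℕ → Set w.Dom} {c d : w.Dom → Fin (alphabet k N)} (hc : Codes N w v V c) {j : ℕ}
    (h : ∀ x, related k N (2 * j) (c x) (d x) = true) {x₀ : w.Dom}
    (hX : ∀ x, codeBit k (d x) (2 * j) = true ↔ x = x₀) :
    Codes N w (Function.update v j (some x₀)) V d := by
  intro x
  obtain ⟨h1, h2⟩ := related_iff.1 (h x)
  refine ⟨h1.symm.trans (hc x).1, fun i hi => ⟨?_, ?_⟩⟩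
  · by_cases hij : i = j
    · subst hij
      rw [Function.update_self, hX x, Option.some_inj, eq_comm]
    · rw [Function.update_of_ne hij, ← h2 (2 * i) (by omega) (by omega)]
      exact ((hc x).2 i hi).1
  · rw [← h2 (2 * i + 1) (by omega) (by omega)]
    exact ((hc x).2 i hi).2

/-! ### Correctness of the tables of formulas -/

/-- The table `t` describes a ⊛-monoid that recognizes the codes of the models of `φ`. -/
def Captures (k N : ℕ) (t : Table) (φ : MSO) : Prop :=
  ∃ (n : ℕ) (S : OMonoid (Fin n)) (h : Fin (alphabet k N) → Fin n) (F : Finset (Fin n)),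
    Describes t S h F ∧ ∀ (w : CWord (Fin k)) (v : ℕ → Option w.Dom) (V : ℕ → Set w.Dom)
      (c : w.Dom → Fin (alphabet k N)), Codes N w v V c →
        (φ.Sat w v V ↔ S.π ⟨w.Dom, fun x => h (c x)⟩ ∈ F)

theorem captures_occ {k N : ℕ} {φ : MSO} (σ τ : ℕ → Bool) (p : Prop × Prop × Prop → Prop)
    (h : ∀ (w : CWord (Fin k)) (v : ℕ → Option w.Dom) (V : ℕ → Set w.Dom)
      (c : w.Dom → Fin (alphabet k N)), Codes N w v V c →
        (φ.Sat w v V ↔ p (∃ x, σ (c x) = true, ∃ x, τ (c x) = true,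
          ∃ x y, x < y ∧ σ (c x) = true ∧ τ (c y) = true))) :
    Captures k N (Table.occ (alphabet k N) σ τ (occAccept p)) φ := by
  refine ⟨_, _, _, _, describes_occ _ σ τ p, fun w v V c hc => ?_⟩
  rw [h w v V c hc]
  exact (occFin_π_mem (fun x => σ (c x) = true) (fun x => τ (c x) = true) p).symm

theorem prodFin_π {D : Type} [LinearOrder D] [Countable D] {m n : ℕ} (S : OMonoid (Fin m))
    (T : OMonoid (Fin n)) (a : D → Fin m) (b : D → Fin n) :
    (S.prodFin T).π ⟨D, fun x => finProdFinEquiv (a x, b x)⟩ =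
      finProdFinEquiv (S.π ⟨D, a⟩, T.π ⟨D, b⟩) := by
  refine congrArg finProdFinEquiv ?_
  simp [OMonoid.prod, CWord.map]

theorem prodFin_π_mem {D : Type} [LinearOrder D] [Countable D] {m n : ℕ} (S : OMonoid (Fin m))
    (T : OMonoid (Fin n)) (a : D → Fin m) (b : D → Fin n) (F : Finset (Fin m))
    (G : Finset (Fin n)) :
    (S.prodFin T).π ⟨D, fun x => finProdFinEquiv (a x, b x)⟩ ∈
      Finset.univ.filter (fun i => i.divNat ∈ F ∧ i.modNat ∈ G) ↔
      S.π ⟨D, a⟩ ∈ F ∧ T.π ⟨D, b⟩ ∈ G := by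
  have h := finProdFinEquiv.symm_apply_apply (S.π ⟨D, a⟩, T.π ⟨D, b⟩)
  rw [prodFin_π, Finset.mem_filter]
  rw [finProdFinEquiv_symm_apply, Prod.mk.injEq] at h
  rw [h.1, h.2]
  simp

open Classical in
theorem powFin_π_mem {D : Type} [LinearOrder D] [Countable D] {n K : ℕ} (S : OMonoid (Fin n))
    (h : Fin K → Fin n) (r : ℕ → ℕ → Bool) (F : Finset (Fin n)) (c : D → Fin K) :
    S.powFin.π ⟨D, fun x => relImage h r (c x)⟩ ∈
      Finset.univ.filter (fun i => ∃ a ∈ (bitsEquiv n).symm i, a ∈ F) ↔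
      ∃ d : D → Fin K, (∀ x, r (c x) (d x) = true) ∧ S.π ⟨D, fun x => h (d x)⟩ ∈ F := by
  have hπ : (bitsEquiv n).symm (S.powFin.π ⟨D, fun x => relImage h r (c x)⟩) =
      S.pow.π ⟨D, fun x => {a | ∃ d : Fin K, r (c x) d = true ∧ h d = a}⟩ := by
    refine ((bitsEquiv n).symm_apply_apply _).trans ?_
    simp only [CWord.map, relImage, Equiv.symm_apply_apply]
  rw [Finset.mem_filter, hπ]
  constructor
  · rintro ⟨-, a, ⟨l, hl, rfl⟩, ha⟩
    choose d hd1 hd2 using hl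
    refine ⟨d, hd1, ?_⟩
    have : (fun x => h (d x)) = l := funext hd2
    rw [this]
    exact ha
  · rintro ⟨d, hd, hF⟩
    exact ⟨Finset.mem_univ _, _, ⟨fun x => h (d x), fun x => ⟨d x, hd x, rfl⟩, rfl⟩, hF⟩

section captures

variable {k N : ℕ} {t u : Table} {φ ψ : MSO}

theorem Captures.neg (H : Captures k N t φ) : Captures k N t.compl φ.neg := by
  obtain ⟨n, S, h, F, hd, hs⟩ := H
  refine ⟨n, S, h, Fᶜ, hd.compl, fun w v V c hc => ?_⟩
  rw [Finset.mem_compl, ← hs w v V c hc]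
  rfl

theorem Captures.and (H : Captures k N t φ) (J : Captures k N u ψ) :
    Captures k N (Table.prod (alphabet k N) t u) (φ.and ψ) := by
  obtain ⟨m, S, h, F, hd, hs⟩ := H
  obtain ⟨n, T, g, G, hd', hs'⟩ := J
  refine ⟨_, _, _, _, hd.prod hd', fun w v V c hc => ?_⟩
  refine Iff.trans ?_ (prodFin_π_mem S T (fun x => h (c x)) (fun x => g (c x)) F G).symm
  rw [← hs w v V c hc, ← hs' w v V c hc]
  rfl

/-- Guessing the set is the same as choosing at each position a letter related to the given one, and
the product of the powerset ranges over these choices. -/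
theorem Captures.exSO (H : Captures k N t φ) {j : ℕ} (hj : j < N) :
    Captures k N (Table.pow (alphabet k N) (related k N (2 * j + 1)) t) (φ.exSO j) := by
  obtain ⟨n, S, h, F, hd, hs⟩ := H
  refine ⟨_, _, _, _, hd.pow _, fun w v V c hc => ?_⟩
  refine Iff.trans ?_ (powFin_π_mem S h _ F c).symm
  constructor
  · rintro ⟨X, hX⟩
    obtain ⟨d, hd1, hd2⟩ := exists_related hc (p := 2 * j + 1) (by omega) X
    exact ⟨d, hd1, (hs w _ _ d (hc.updateSO hd1 hd2)).1 hX⟩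
  · rintro ⟨d, hd1, hF⟩
    exact ⟨_, (hs w _ _ d (hc.updateSO hd1 (X := {x | codeBit k (d x) (2 * j + 1) = true})
      fun x => Iff.rfl)).2 hF⟩

/-- The property that exactly one position has the first property of `occFin`, when both
properties are the same. -/
def IsSingle (q : Prop × Prop × Prop) : Prop := q.1 ∧ ¬ q.2.2

/-- A free choice of the bit guesses a set; the factor `occFin` restricts it to one-element sets.
With both marks equal, two marked positions would form a pair `x < y`, which `IsSingle` excludes. -/
theorem Captures.exFO (H : Captures k N t φ) {j : ℕ} (hj : j < N) :
    Captures k N (Table.pow (alphabet k N) (related k N (2 * j)) (Table.prod (alphabet k N) t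
      (Table.occ (alphabet k N) (fun c => codeBit k c (2 * j)) (fun c => codeBit k c (2 * j))
        (occAccept IsSingle)))) (φ.exFO j) := by
  obtain ⟨n, S, h, F, hd, hs⟩ := H
  refine ⟨_, _, _, _, (hd.prod (describes_occ _ _ _ _)).pow _, fun w v V c hc => ?_⟩
  refine Iff.trans ?_ (powFin_π_mem _ _ _ _ c).symm
  have key : ∀ d : w.Dom → Fin (alphabet k N), (S.prodFin occFin).π ⟨w.Dom, fun x =>
      finProdFinEquiv (h (d x), occEquiv (codeBit k (d x) (2 * j) = true,
        codeBit k (d x) (2 * j) = true, False))⟩ ∈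
      Finset.univ.filter (fun i => i.divNat ∈ F ∧ i.modNat ∈ occSet IsSingle) ↔
      S.π ⟨w.Dom, fun x => h (d x)⟩ ∈ F ∧ ∃ x₀, ∀ x, codeBit k (d x) (2 * j) = true ↔ x = x₀ := by
    intro d
    rw [prodFin_π_mem S occFin (fun x => h (d x)) (fun x => occEquiv
      (codeBit k (d x) (2 * j) = true, codeBit k (d x) (2 * j) = true, False)) F
      (occSet IsSingle)]
    refine and_congr_right fun _ => ?_
    rw [occFin_π_mem (fun x => codeBit k (d x) (2 * j) = true)
      (fun x => codeBit k (d x) (2 * j) = true) IsSingle]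
    constructor
    · rintro ⟨⟨x₀, hx₀⟩, hno⟩
      refine ⟨x₀, fun x => ⟨fun hx => ?_, fun hx => hx ▸ hx₀⟩⟩
      rcases lt_trichotomy x x₀ with hlt | heq | hgt
      · exact absurd ⟨x, x₀, hlt, hx, hx₀⟩ hno
      · exact heq
      · exact absurd ⟨x₀, x, hgt, hx₀, hx⟩ hno
    · rintro ⟨x₀, hx₀⟩
      refine ⟨⟨x₀, (hx₀ x₀).2 rfl⟩, ?_⟩
      rintro ⟨x, y, hlt, hx, hy⟩
      exact hlt.ne (((hx₀ x).1 hx).trans ((hx₀ y).1 hy).symm)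
  constructor
  · rintro ⟨x₀, hx₀⟩
    obtain ⟨d, hd1, hd2⟩ := exists_related hc (p := 2 * j) (by omega) {x₀}
    exact ⟨d, hd1, (key d).2 ⟨(hs w _ _ d (hc.updateFO hd1 hd2)).1 hx₀, x₀, hd2⟩⟩
  · rintro ⟨d, hd1, hF⟩
    obtain ⟨hF, x₀, hx₀⟩ := (key d).1 hF
    exact ⟨x₀, (hs w _ _ d (hc.updateFO hd1 hx₀)).2 hF⟩

end captures

/-! ### The algorithm -/

/-- One step of the evaluation of a formula in prefix notation, from right to left, with a stack
of tables. -/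
noncomputable def evalStep (k N : ℕ) (s : ℕ × ℕ × ℕ) (st : List Table) : List Table :=
  bif s.1 == 0 then
    Table.occ (alphabet k N) (fun c => codeBit k c (2 * s.2.1)) (fun c => codeBit k c (2 * s.2.2))
      (occAccept fun q => q.2.2) :: st
  else bif s.1 == 1 then
    Table.occ (alphabet k N) (fun c => codeBit k c (2 * s.2.1) && codeBit k c (2 * s.2.2))
      (fun _ => false) (occAccept Prod.fst) :: st
  else bif s.1 == 2 then
    Table.occ (alphabet k N) (fun c => codeBit k c (2 * s.2.2) && c % k == s.2.1)
      (fun _ => false) (occAccept Prod.fst) :: st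
  else bif s.1 == 3 then
    Table.occ (alphabet k N) (fun c => codeBit k c (2 * s.2.1) && codeBit k c (2 * s.2.2 + 1))
      (fun _ => false) (occAccept Prod.fst) :: st
  -- The operands are always on the stack when the symbols come from a formula, so the default of
  -- `headI` is not reached.
  else bif s.1 == 4 then st.headI.compl :: st.tail
  else bif s.1 == 5 then Table.prod (alphabet k N) st.headI st.tail.headI :: st.tail.tail
  else bif s.1 == 6 then
    Table.pow (alphabet k N) (related k N (2 * s.2.1)) (Table.prod (alphabet k N) st.headI
      (Table.occ (alphabet k N) (fun c => codeBit k c (2 * s.2.1))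
        (fun c => codeBit k c (2 * s.2.1)) (occAccept IsSingle))) :: st.tail
  else Table.pow (alphabet k N) (related k N (2 * s.2.1 + 1)) st.headI :: st.tail

/-- The stack is arbitrary because evaluating a subformula must push exactly one table on whatever
is there. Reading from the right, the second conjunct is pushed first and the first one ends on top.
-/
theorem exists_captures {k N : ℕ} (φ : MSO) (hN : ∀ s ∈ φ.symbols, s.2.1 < N ∧ s.2.2 < N)
    (st : List Table) :
    ∃ t, Captures k N t φ ∧ φ.symbols.foldr (evalStep k N) st = t :: st := by
  induction φ generalizing st with
  | lt i j =>
    obtain ⟨hi, hj⟩ := hN _ (List.mem_singleton.2 rfl)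
    refine ⟨_, captures_occ (fun c => codeBit k c (2 * i)) (fun c => codeBit k c (2 * j))
      (fun q => q.2.2) ?_, rfl⟩
    intro w v V c hc
    constructor
    · rintro ⟨x, y, hx, hy, hxy⟩
      exact ⟨x, y, hxy, ((hc x).2 i hi).1.2 hx, ((hc y).2 j hj).1.2 hy⟩
    · rintro ⟨x, y, hxy, hx, hy⟩
      exact ⟨x, y, ((hc x).2 i hi).1.1 hx, ((hc y).2 j hj).1.1 hy, hxy⟩
  | eq i j =>
    obtain ⟨hi, hj⟩ := hN _ (List.mem_singleton.2 rfl)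
    refine ⟨_, captures_occ (fun c => codeBit k c (2 * i) && codeBit k c (2 * j))
      (fun _ => false) Prod.fst ?_, rfl⟩
    intro w v V c hc
    simp only [Bool.and_eq_true]
    constructor
    · rintro ⟨x, y, hx, hy, rfl⟩
      exact ⟨x, ((hc x).2 i hi).1.2 hx, ((hc x).2 j hj).1.2 hy⟩
    · rintro ⟨x, hx, hy⟩
      exact ⟨x, x, ((hc x).2 i hi).1.1 hx, ((hc x).2 j hj).1.1 hy, rfl⟩
  | letter a i =>
    obtain ⟨ha, hi⟩ := hN _ (List.mem_singleton.2 rfl)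
    refine ⟨_, captures_occ (fun c => codeBit k c (2 * i) && c % k == a)
      (fun _ => false) Prod.fst ?_, rfl⟩
    intro w v V c hc
    simp only [Bool.and_eq_true, beq_iff_eq]
    constructor
    · rintro ⟨x, hx, hxa⟩
      exact ⟨x, ((hc x).2 i hi).1.2 hx, (hc x).1.trans hxa⟩
    · rintro ⟨x, hx, hxa⟩
      exact ⟨x, ((hc x).2 i hi).1.1 hx, (hc x).1.symm.trans hxa⟩
  | mem i j =>
    obtain ⟨hi, hj⟩ := hN _ (List.mem_singleton.2 rfl)
    refine ⟨_, captures_occ (fun c => codeBit k c (2 * i) && codeBit k c (2 * j + 1))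
      (fun _ => false) Prod.fst ?_, rfl⟩
    intro w v V c hc
    simp only [Bool.and_eq_true]
    constructor
    · rintro ⟨x, hx, hxV⟩
      exact ⟨x, ((hc x).2 i hi).1.2 hx, ((hc x).2 j hj).2.2 hxV⟩
    · rintro ⟨x, hx, hxV⟩
      exact ⟨x, ((hc x).2 i hi).1.1 hx, ((hc x).2 j hj).2.1 hxV⟩
  | neg φ ih =>
    obtain ⟨t, ht, heq⟩ := ih (fun s hs => hN s (List.mem_cons_of_mem _ hs)) st
    refine ⟨_, ht.neg, ?_⟩
    rw [MSO.symbols, List.foldr_cons, heq]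
    rfl
  | and φ ψ ihφ ihψ =>
    obtain ⟨u, hu, heq'⟩ := ihψ
      (fun s hs => hN s (List.mem_cons_of_mem _ (List.mem_append_right _ hs))) st
    obtain ⟨t, ht, heq⟩ := ihφ
      (fun s hs => hN s (List.mem_cons_of_mem _ (List.mem_append_left _ hs))) (u :: st)
    refine ⟨_, ht.and hu, ?_⟩
    rw [MSO.symbols, List.foldr_cons, List.foldr_append, heq', heq]
    rfl
  | exFO i φ ih =>
    obtain ⟨t, ht, heq⟩ := ih (fun s hs => hN s (List.mem_cons_of_mem _ hs)) st
    refine ⟨_, ht.exFO (hN _ List.mem_cons_self).1, ?_⟩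
    rw [MSO.symbols, List.foldr_cons, heq]
    rfl
  | exSO j φ ih =>
    obtain ⟨t, ht, heq⟩ := ih (fun s hs => hN s (List.mem_cons_of_mem _ hs)) st
    refine ⟨_, ht.exSO (hN _ List.mem_cons_self).1, ?_⟩
    rw [MSO.symbols, List.foldr_cons, heq]
    rfl

/-- A bound on the indices that occur in a sequence of symbols. -/
def indexBound (l : List (ℕ × ℕ × ℕ)) : ℕ := l.foldr (fun s n => s.2.1 + s.2.2 + 1 + n) 0

theorem lt_indexBound (l : List (ℕ × ℕ × ℕ)) : ∀ s ∈ l, s.2.1 < indexBound l ∧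
    s.2.2 < indexBound l := by
  induction l with
  | nil => simp
  | cons a l ih =>
    have hcons : indexBound (a :: l) = a.2.1 + a.2.2 + 1 + indexBound l := rfl
    intro s hs
    rcases List.mem_cons.1 hs with rfl | hs
    · omega
    · have := ih s hs
      omega

/-- The algorithm that computes a recognizer from a formula. -/
noncomputable def evalFormula (p : ℕ × List (ℕ × ℕ × ℕ)) : Table :=
  ((p.2.foldr (evalStep p.1 (indexBound p.2)) []).headI).restrict p.1

theorem OMonoid.isMorphism_map {A : Type} {M : Type} (S : OMonoid M) (h : A → M) :
    IsMorphism S fun w => S.π (w.map h) :=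
  ⟨fun _ _ hw => S.π_iso _ _ (hw.map h), fun W => (S.π_assoc (W.map (CWord.map h))).symm⟩

theorem evalFormula_spec (k : ℕ) (φ : MSO) : ∃ R : Recognizer k,
    evalFormula (k, φ.symbols) = R.table ∧ R.Recognizes (φ.language k) := by
  obtain ⟨t, ⟨n, S, h, F, hd, hs⟩, heq⟩ :=
    exists_captures (k := k) φ (lt_indexBound φ.symbols) []
  have hk : k ≤ alphabet k (indexBound φ.symbols) := Nat.le_mul_of_pos_right k (by positivity)
  refine ⟨S.recognizer (fun a => h (Fin.castLE hk a)) F, ?_, S, S.induces_alg,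
    fun T hT => S.eq_of_induces hT, fun w => S.π (w.map fun a => h (Fin.castLE hk a)),
    S.isMorphism_map _, fun a => ?_, ?_⟩
  · rw [evalFormula, heq]
    exact hd.restrict hk
  · exact S.π_of_forall_eq ((CWord.single a).map _) (0 : Fin 1)
      fun _ => Subsingleton.elim (α := Fin 1) _ _
  · ext w
    -- A letter below `k` is its own code with all bits zero, that is, with undefined first-order
    -- variables and empty sets.
    refine hs w (fun _ => none) (fun _ => ∅) (fun x => Fin.castLE hk (w.label x)) fun x => ?_
    have hlt := (w.label x).2
    refine ⟨Nat.mod_eq_of_lt hlt, fun i _ => ⟨?_, ?_⟩⟩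
    · simp [codeBit, Nat.div_eq_of_lt hlt]
    · simp [codeBit, Nat.div_eq_of_lt hlt]

end CountableWords

namespace CountableWords

/-! ### The algorithm is primitive recursive -/

attribute [fun_prop] Primrec
attribute [fun_prop] Primrec.id Primrec.const Primrec.comp Primrec.fst Primrec.snd Primrec.pair

section primrec

variable {α : Type*} [Primcodable α]

section basic

variable {f g : α → ℕ} {s t : α → Bool}

@[fun_prop]
theorem primrec_add (hf : Primrec f) (hg : Primrec g) : Primrec fun a => f a + g a :=
  Primrec.nat_add.comp hf hg

@[fun_prop]
theorem primrec_mul (hf : Primrec f) (hg : Primrec g) : Primrec fun a => f a * g a :=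
  Primrec.nat_mul.comp hf hg

@[fun_prop]
theorem primrec_div (hf : Primrec f) (hg : Primrec g) : Primrec fun a => f a / g a :=
  Primrec.nat_div.comp hf hg

@[fun_prop]
theorem primrec_mod (hf : Primrec f) (hg : Primrec g) : Primrec fun a => f a % g a :=
  Primrec.nat_mod.comp hf hg

@[fun_prop]
theorem primrec_pow (hf : Primrec f) (hg : Primrec g) : Primrec fun a => f a ^ g a :=
  (Primrec₂.unpaired'.1 Nat.Primrec.pow).comp hf hg

@[fun_prop]
theorem primrec_beq {β : Type*} [Primcodable β] [DecidableEq β] {f g : α → β} (hf : Primrec f)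
    (hg : Primrec g) : Primrec fun a => (f a == g a) :=
  Primrec.beq.comp hf hg

@[fun_prop]
theorem primrec_not (hs : Primrec s) : Primrec fun a => !s a := Primrec.not.comp hs

@[fun_prop]
theorem primrec_and (hs : Primrec s) (ht : Primrec t) : Primrec fun a => s a && t a :=
  Primrec.and.comp hs ht

@[fun_prop]
theorem primrec_or (hs : Primrec s) (ht : Primrec t) : Primrec fun a => s a || t a :=
  Primrec.or.comp hs ht

@[fun_prop]
theorem primrec_impB (hs : Primrec s) (ht : Primrec t) : Primrec fun a => impB (s a) (t a) := by
  unfold impB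
  fun_prop

@[fun_prop]
theorem primrec_cond {β : Type*} [Primcodable β] {x y : α → β} (hs : Primrec s)
    (hx : Primrec x) (hy : Primrec y) : Primrec fun a => bif s a then x a else y a :=
  Primrec.cond hs hx hy

@[fun_prop]
theorem primrec_testBit (hf : Primrec f) (hg : Primrec g) :
    Primrec fun a => (f a).testBit (g a) := by
  have h : Primrec fun a => (f a / 2 ^ g a % 2 == 1) := by fun_prop
  refine h.of_eq fun a => ?_
  rw [Nat.testBit_eq_decide_div_mod_eq]
  rfl

end basic

@[fun_prop]
theorem primrec_allB {p : α → ℕ → Bool} {n : α → ℕ}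
    (hp : Primrec fun q : α × ℕ => p q.1 q.2) (hn : Primrec n) :
    Primrec fun a => allB (p a) (n a) := by
  refine (Primrec.nat_rec' hn (Primrec.const true) (h := fun a q => p a q.1 && q.2) ?_).of_eq ?_
  · exact Primrec.and.comp (hp.comp (Primrec.pair Primrec.fst (Primrec.fst.comp Primrec.snd)))
      (Primrec.snd.comp Primrec.snd)
  · intro a
    induction n a with
    | zero => rfl
    | succ m ih => simp only [allB, ← ih]

@[fun_prop]
theorem primrec_anyB {p : α → ℕ → Bool} {n : α → ℕ}
    (hp : Primrec fun q : α × ℕ => p q.1 q.2) (hn : Primrec n) :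
    Primrec fun a => anyB (p a) (n a) := by
  refine (Primrec.nat_rec' hn (Primrec.const false) (h := fun a q => p a q.1 || q.2) ?_).of_eq ?_
  · exact Primrec.or.comp (hp.comp (Primrec.pair Primrec.fst (Primrec.fst.comp Primrec.snd)))
      (Primrec.snd.comp Primrec.snd)
  · intro a
    induction n a with
    | zero => rfl
    | succ m ih => simp only [anyB, ← ih]

@[fun_prop]
theorem primrec_mask {p : α → ℕ → Bool} {n : α → ℕ}
    (hp : Primrec fun q : α × ℕ => p q.1 q.2) (hn : Primrec n) :
    Primrec fun a => mask (p a) (n a) := by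
  refine (Primrec.nat_rec' hn (Primrec.const 0)
    (h := fun a q => q.2 + bif p a q.1 then 2 ^ q.1 else 0) ?_).of_eq ?_
  · have h := hp.comp (Primrec.pair (Primrec.fst (α := α) (β := ℕ × ℕ))
      (Primrec.fst.comp Primrec.snd))
    exact primrec_add (by fun_prop) (Primrec.cond h (by fun_prop) (by fun_prop))
  · intro a
    induction n a with
    | zero => rfl
    | succ m ih => simp only [mask, ← ih]

section list

variable {β : Type*} [Primcodable β]

@[fun_prop]
theorem primrec_map_range {n : α → ℕ} {f : α → ℕ → β} (hn : Primrec n)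
    (hf : Primrec fun q : α × ℕ => f q.1 q.2) : Primrec fun a => (List.range (n a)).map (f a) :=
  Primrec.list_map (Primrec.list_range.comp hn) hf

@[fun_prop]
theorem primrec_getD {l : α → List β} {n : α → ℕ} (d : β) (hl : Primrec l) (hn : Primrec n) :
    Primrec fun a => (l a).getD (n a) d :=
  (Primrec.list_getD d).comp hl hn

@[fun_prop]
theorem primrec_headI [Inhabited β] {l : α → List β} (hl : Primrec l) :
    Primrec fun a => (l a).headI :=
  Primrec.list_headI.comp hl

@[fun_prop]
theorem primrec_tail {l : α → List β} (hl : Primrec l) : Primrec fun a => (l a).tail :=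
  Primrec.list_tail.comp hl

@[fun_prop]
theorem primrec_cons {x : α → β} {l : α → List β} (hx : Primrec x) (hl : Primrec l) :
    Primrec fun a => x a :: l a :=
  Primrec.list_cons.comp hx hl

end list

namespace Table

variable {t u : α → Table} {f g h : α → ℕ}

@[fun_prop]
theorem primrec_size (ht : Primrec t) : Primrec fun a => (t a).size := by
  unfold size
  fun_prop

@[fun_prop]
theorem primrec_one (ht : Primrec t) : Primrec fun a => (t a).one := by
  unfold one
  fun_prop

@[fun_prop]
theorem primrec_mul (ht : Primrec t) (hf : Primrec f) (hg : Primrec g) :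
    Primrec fun a => (t a).mul (f a) (g a) := by
  unfold mul
  fun_prop

@[fun_prop]
theorem primrec_tau (ht : Primrec t) (hf : Primrec f) : Primrec fun a => (t a).tau (f a) := by
  unfold tau
  fun_prop

@[fun_prop]
theorem primrec_tauRev (ht : Primrec t) (hf : Primrec f) :
    Primrec fun a => (t a).tauRev (f a) := by
  unfold tauRev
  fun_prop

@[fun_prop]
theorem primrec_kappa (ht : Primrec t) (hf : Primrec f) :
    Primrec fun a => (t a).kappa (f a) := by
  unfold kappa
  fun_prop

@[fun_prop]
theorem primrec_letter (ht : Primrec t) (hf : Primrec f) :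
    Primrec fun a => (t a).letter (f a) := by
  unfold letter
  fun_prop

@[fun_prop]
theorem primrec_accept (ht : Primrec t) (hf : Primrec f) :
    Primrec fun a => (t a).accept (f a) := by
  unfold accept
  fun_prop

@[fun_prop]
theorem primrec_build {n one K : α → ℕ} {mul : α → ℕ → ℕ → ℕ}
    {tau tauRev kappa letter : α → ℕ → ℕ} {accept : α → ℕ → Bool} (hn : Primrec n)
    (hone : Primrec one) (hK : Primrec K)
    (hmul : Primrec fun q : (α × ℕ) × ℕ => mul q.1.1 q.1.2 q.2)
    (htau : Primrec fun q : α × ℕ => tau q.1 q.2)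
    (htauRev : Primrec fun q : α × ℕ => tauRev q.1 q.2)
    (hkappa : Primrec fun q : α × ℕ => kappa q.1 q.2)
    (hletter : Primrec fun q : α × ℕ => letter q.1 q.2)
    (haccept : Primrec fun q : α × ℕ => accept q.1 q.2) :
    Primrec fun a => build (n a) (one a) (K a) (mul a) (tau a) (tauRev a) (kappa a) (letter a)
      (accept a) := by
  refine hn.pair (hone.pair (Primrec.pair ?_ (Primrec.pair ?_ (Primrec.pair ?_ (Primrec.pair ?_
    (Primrec.pair ?_ ?_))))))
  · exact primrec_map_range hn (primrec_map_range (hn.comp Primrec.fst) hmul)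
  · exact primrec_map_range hn htau
  · exact primrec_map_range hn htauRev
  · exact primrec_map_range (by fun_prop) hkappa
  · exact primrec_map_range hK hletter
  · exact primrec_map_range hn haccept

@[fun_prop]
theorem primrec_pairing (hu : Primrec u) (hf : Primrec f) (hg : Primrec g) :
    Primrec fun a => pairing (u a) (f a) (g a) := by
  unfold pairing
  fun_prop

@[fun_prop]
theorem primrec_prodKappa (ht : Primrec t) (hu : Primrec u) (hf : Primrec f) :
    Primrec fun a => prodKappa (t a) (u a) (f a) := by
  unfold prodKappa
  fun_prop

@[fun_prop]
theorem primrec_prod (hf : Primrec f) (ht : Primrec t) (hu : Primrec u) :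
    Primrec fun a => prod (f a) (t a) (u a) := by
  unfold prod
  apply primrec_build <;> fun_prop

@[fun_prop]
theorem primrec_powOne (ht : Primrec t) : Primrec fun a => (t a).powOne := by
  unfold powOne
  fun_prop

@[fun_prop]
theorem primrec_powMul (ht : Primrec t) (hf : Primrec f) (hg : Primrec g) :
    Primrec fun a => (t a).powMul (f a) (g a) := by
  unfold powMul
  fun_prop

@[fun_prop]
theorem primrec_gen (ht : Primrec t) (hf : Primrec f) (hg : Primrec g) :
    Primrec fun a => (t a).gen (f a) (g a) := by
  unfold gen
  fun_prop

@[fun_prop]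
theorem primrec_powTau (ht : Primrec t) (hf : Primrec f) :
    Primrec fun a => (t a).powTau (f a) := by
  unfold powTau
  fun_prop

@[fun_prop]
theorem primrec_powTauRev (ht : Primrec t) (hf : Primrec f) :
    Primrec fun a => (t a).powTauRev (f a) := by
  unfold powTauRev
  fun_prop

@[fun_prop]
theorem primrec_inUnion (ht : Primrec t) (hf : Primrec f) (hg : Primrec g) :
    Primrec fun a => (t a).inUnion (f a) (g a) := by
  unfold inUnion
  fun_prop

@[fun_prop]
theorem primrec_inExt (ht : Primrec t) (hf : Primrec f) (hg : Primrec g) (hh : Primrec h) :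
    Primrec fun a => (t a).inExt (f a) (g a) (h a) := by
  unfold inExt
  fun_prop

@[fun_prop]
theorem primrec_closedBase (ht : Primrec t) (hf : Primrec f) (hg : Primrec g) :
    Primrec fun a => (t a).closedBase (f a) (g a) := by
  unfold closedBase
  fun_prop

@[fun_prop]
theorem primrec_closedOps (ht : Primrec t) (hf : Primrec f) (hg : Primrec g) :
    Primrec fun a => (t a).closedOps (f a) (g a) := by
  unfold closedOps
  fun_prop

@[fun_prop]
theorem primrec_closedShuffle (ht : Primrec t) (hf : Primrec f) (hg : Primrec g) :
    Primrec fun a => (t a).closedShuffle (f a) (g a) := by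
  unfold closedShuffle
  fun_prop

@[fun_prop]
theorem primrec_powKappa (ht : Primrec t) (hf : Primrec f) :
    Primrec fun a => (t a).powKappa (f a) := by
  unfold powKappa
  fun_prop

@[fun_prop]
theorem primrec_pow {r : α → ℕ → ℕ → Bool} (hf : Primrec f)
    (hr : Primrec fun q : (α × ℕ) × ℕ => r q.1.1 q.1.2 q.2) (ht : Primrec t) :
    Primrec fun a => pow (f a) (r a) (t a) := by
  -- The relation is moved to the context that contains, besides the letter, also the element tested
  -- by the mask.
  have hr' : Primrec fun q : ((α × ℕ) × ℕ) × ℕ => r q.1.1.1 q.1.1.2 q.2 :=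
    hr.comp (g := fun q : ((α × ℕ) × ℕ) × ℕ => (q.1.1, q.2)) (by fun_prop)
  have hl : Primrec fun q : α × ℕ => mask (fun b => anyB (fun d => r q.1 q.2 d &&
      (t q.1).letter d == b) (f q.1)) (t q.1).size := by
    refine primrec_mask (primrec_anyB (primrec_and hr' ?_) ?_) ?_ <;> fun_prop
  unfold pow
  refine primrec_build ?_ ?_ ?_ ?_ ?_ ?_ ?_ hl ?_ <;> fun_prop

@[fun_prop]
theorem primrec_compl (ht : Primrec t) : Primrec fun a => (t a).compl := by
  have h : Primrec fun a => (t a).2.2.2.2.2.2.2.map not :=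
    Primrec.list_map (by fun_prop) (Primrec.not.comp Primrec.snd)
  unfold compl
  fun_prop

@[fun_prop]
theorem primrec_restrict (hf : Primrec f) (ht : Primrec t) :
    Primrec fun a => (t a).restrict (f a) := by
  have h : Primrec fun a => (t a).2.2.2.2.2.2.1.take (f a) :=
    Primrec.list_take.comp hf (by fun_prop)
  unfold restrict
  fun_prop

@[fun_prop]
theorem primrec_occ {σ τ : α → ℕ → Bool} (hf : Primrec f)
    (hσ : Primrec fun q : α × ℕ => σ q.1 q.2) (hτ : Primrec fun q : α × ℕ => τ q.1 q.2)
    (acc : List Bool) : Primrec fun a => occ (f a) (σ a) (τ a) acc := by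
  have h : Primrec fun a => (List.range (f a)).map fun c => occCode (σ a c) (τ a c) :=
    primrec_map_range hf ((Primrec.dom_bool₂ occCode).comp hσ hτ)
  unfold occ
  fun_prop

end Table

section eval

variable {k n p c d : α → ℕ}

@[fun_prop]
theorem primrec_alphabet (hk : Primrec k) (hn : Primrec n) :
    Primrec fun a => alphabet (k a) (n a) := by
  unfold alphabet
  fun_prop

@[fun_prop]
theorem primrec_codeBit (hk : Primrec k) (hc : Primrec c) (hp : Primrec p) :
    Primrec fun a => codeBit (k a) (c a) (p a) := by
  unfold codeBit
  fun_prop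

@[fun_prop]
theorem primrec_related (hk : Primrec k) (hn : Primrec n) (hp : Primrec p) (hc : Primrec c)
    (hd : Primrec d) : Primrec fun a => related (k a) (n a) (p a) (c a) (d a) := by
  unfold related
  fun_prop

@[fun_prop]
theorem primrec_evalStep {s : α → ℕ × ℕ × ℕ} {st : α → List Table} (hk : Primrec k)
    (hn : Primrec n) (hs : Primrec s) (hst : Primrec st) :
    Primrec fun a => evalStep (k a) (n a) (s a) (st a) := by
  unfold evalStep
  fun_prop

end eval

end primrec

@[fun_prop]
theorem primrec_indexBound : Primrec indexBound := by
  refine Primrec.list_foldr (h := fun _ (q : (ℕ × ℕ × ℕ) × ℕ) => q.1.2.1 + q.1.2.2 + 1 + q.2)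
    Primrec.id (Primrec.const 0) ?_
  unfold Primrec₂
  fun_prop

theorem primrec_evalFormula : Primrec evalFormula := by
  have h : Primrec fun p : ℕ × List (ℕ × ℕ × ℕ) =>
      p.2.foldr (evalStep p.1 (indexBound p.2)) [] := by
    refine Primrec.list_foldr (h := fun (p : ℕ × List (ℕ × ℕ × ℕ)) q =>
      evalStep p.1 (indexBound p.2) q.1 q.2) Primrec.snd (Primrec.const []) ?_
    unfold Primrec₂
    fun_prop
  unfold evalFormula
  fun_prop

end CountableWords

/-- MSO-definable languages of countable words are effectively recognizable: there is an algorithm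
that, given `k` and an MSO sentence `φ`, outputs the tables of a finite ⊛-algebra, with letter images
and accepting set, that recognizes the language of the countable words over `{0, …, k-1}` that
satisfy `φ`. -/
theorem mainTheorem3 :
    ∃ f : ℕ × List (ℕ × ℕ × ℕ) → CountableWords.Table, Computable f ∧
      ∀ (k : ℕ) (φ : CountableWords.MSO), φ.IsSentence →
        ∃ R : CountableWords.Recognizer k,
          f (k, φ.symbols) = R.table ∧ R.Recognizes (φ.language k) :=
  ⟨CountableWords.evalFormula, CountableWords.primrec_evalFormula.to_comp,
    fun k φ _ => CountableWords.evalFormula_spec k φ⟩
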